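/- Let $n\in\{2,3\}$ and let $\|\cdot\|$ be the Euclidean norm on $\mathbb R^n$. Let $x^o\in\mathbb R^n$ be a source and let $(a_i)_{i\ge 0}$ be a bounded sequence of sensor positions in $\mathbb R^n$ with reference sensor $a_0=0$ and $a_i\ne x^o$ for all $i\ge 0$. The measurements are $$d_i=\|a_i-x^o\|-\|x^o\|+r_i,\qquad i=1,2,\dots,$$ where $r_1,r_2,\dots$ are i.i.d. $\mathcal N(0,\sigma^2)$. Let $\mu$ be a probability measure on $\mathbb R^n$ with distribution function $F_\mu(z)=\mu\{a: a\preceq z\}$ ($\preceq$ coordinatewise) such that $\frac1m\#\{1\le i\le m: a_i\preceq z\}\to F_\mu(z)$ for every $z\in\mathbb R^n$. Assume that $\mu(S)\neq1$ whenever (i) $S$ is a hyperbola ($n=2$), resp. a two-sheeted hyperboloid of revolution ($n=3$), that passes through $a_0$ and has $x^o$ as a focus; or (ii) $S$ is a line ($n=2$), resp. a plane ($n=3$). Let the parameter set $\Theta\ni x^o$ be either a compact subset of $\mathbb R^n$, or $\Theta=\mathbb R^n$; in the latter case assume also that $\mu(S)\ne1$ for every parabola, resp. paraboloid of revolution, $S$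 that passes through $a_0$ and has focus $x^o$. Let $\hat x^{\rm ML}_m$ be (measurable) maximum likelihood estimates: almost surely, for all sufficiently large $m$, $\hat x^{\rm ML}_m$ is a global minimizer over $x\in\Theta$ of $$\frac1m\sum_{i=1}^m\bigl(d_i+\|x\|-\|a_i-x\|\bigr)^2 .$$ Then $\hat x^{\rm ML}_m\to x^o$ almost surely as $m\to\infty$. Moreover, suppose that $x^o$ is an interior point of $\Theta$, that $\mu(\{x^o\})=0$, and that $\mu(S)\neq1$ for every $S\ni a_0$ that is the union of two non-collinear rays emanating from $x^o$ ($n=2$), resp. one nappe of a circular cone with vertex $x^o$ and half-angle in $(0,\pi/2)$ ($n=3$) (these are the degenerate hyperbolas/hyperboloids whose two foci coincide at $x^o$). Put $f_i(x)=\|a_i-x\|-\|x\|$. Then the limits $$[M(x^o)]_{jk}=\lim_{m\to\infty}\frac1m\sum_{i=1}^m\frac{\partial f_i}{\partial x_j}(x^o)\,\frac{\partial f_i}{\partial x_k}(x^o)$$ exist, the matrix $M(x^o)$ is positive definite, and $$\sqrt m\,(\hat x^{\rm ML}_m-x^o)\longrightarrow\mathcal N\bigl(0,\sigma^2M(x^o)^{-1}\bigr)\quad\text{in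 distribution as } m\to\infty .$$ -/

import Mathlib

open MeasureTheory ProbabilityTheory Filter Topology
open scoped NNReal

noncomputable section

namespace TDOA

/-- The space `ℝⁿ` with its Euclidean norm. -/
abbrev Space (n : ℕ) : Type := EuclideanSpace ℝ (Fin n)

variable {n : ℕ}

/-- The noiseless range difference at `x` between a sensor at `b` and the reference sensor
at the origin: `‖b - x‖ - ‖x‖`. -/
def rangeDiff (b x : Space n) : ℝ := ‖b - x‖ - ‖x‖

/-- The measurement `d_i = ‖a_i - xo‖ - ‖xo‖ + r_i`. -/
def measurement (a : ℕ → Space n) (xo : Space n) (r : ℕ → ℝ) (i : ℕ) : ℝ :=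
  rangeDiff (a i) xo + r i

/-- The least-squares objective
`(1/m) ∑_{i=1}^m (d_i + ‖x‖ - ‖a_i - x‖)²` for measurements `d`. -/
def objective (a : ℕ → Space n) (d : ℕ → ℝ) (m : ℕ) (x : Space n) : ℝ :=
  (1 / (m : ℝ)) * ∑ i ∈ Finset.Icc 1 m, (d i + ‖x‖ - ‖a i - x‖) ^ 2

/-- `x` is a maximum likelihood estimate over the parameter set `Θ` from the first `m`
measurements: a global minimizer over `Θ` of the least-squares objective. -/
def IsMLEstimate (Θ : Set (Space n)) (a : ℕ → Space n) (d : ℕ → ℝ) (m : ℕ) (x : Space n) :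
    Prop :=
  x ∈ Θ ∧ ∀ y ∈ Θ, objective a d m x ≤ objective a d m y

open Classical in
/-- The sample distribution function `F_m(z) = #{i ∈ {1,…,m} : a_i ≼ z} / m`, where `≼` is the
coordinatewise order. -/
def sampleDistribution (a : ℕ → Space n) (m : ℕ) (z : Space n) : ℝ :=
  (((Finset.Icc 1 m).filter fun i => ∀ j, a i j ≤ z j).card : ℝ) / (m : ℝ)

/-- The distribution function of a measure: `F_μ(z) = μ {a : a ≼ z}`. -/
def distributionFunction (μ : Measure (Space n)) (z : Space n) : ℝ :=
  μ.real {b | ∀ j, b j ≤ z j}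

/-- An affine hyperplane: a line in the plane, a plane in space. -/
def IsHyperplane (S : Set (Space n)) : Prop :=
  ∃ (v : Space n) (c : ℝ), v ≠ 0 ∧ S = {z | inner ℝ v z = c}

/-- A (nondegenerate) hyperbola, resp. two-sheeted hyperboloid of revolution, both branches,
one focus of which is `F`: the points whose distances to `F` and to a second focus `F'`
differ by the constant `c`, where `0 < c < ‖F - F'‖`. -/
def IsHyperboloidWithFocus (F : Space n) (S : Set (Space n)) : Prop :=
  ∃ (F' : Space n) (c : ℝ), 0 < c ∧ c < dist F F' ∧ S = {z | |dist z F - dist z F'| = c}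

/-- A parabola, resp. paraboloid of revolution, with focus `F` and directrix
`{z : ⟨u, z⟩ = p}`, `u` a unit vector and `F` not on the directrix. -/
def IsParaboloidWithFocus (F : Space n) (S : Set (Space n)) : Prop :=
  ∃ (u : Space n) (p : ℝ), ‖u‖ = 1 ∧ inner ℝ u F ≠ p ∧ S = {z | dist z F = |inner ℝ u z - p|}

/-- One nappe of a circular cone with vertex `V` and half-angle strictly between `0` and `π/2`;
in the plane, the union of two rays from `V` that are not on one line. -/
def IsConeWithVertex (V : Space n) (S : Set (Space n)) : Prop :=
  ∃ (u : Space n) (c : ℝ), ‖u‖ = 1 ∧ 0 < c ∧ c < 1 ∧ S = {z | inner ℝ u (z - V) = c * dist z V}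

/-- `L` is the tail product of the sequences `(p_i)_{i ≥ 1}` and `(q_i)_{i ≥ 1}`:
the limit of `t⁻¹ ∑_{i=1}^t p_i q_i`. -/
def HasTailProduct (p q : ℕ → ℝ) (L : ℝ) : Prop :=
  Tendsto (fun t : ℕ => (t : ℝ)⁻¹ * ∑ i ∈ Finset.Icc 1 t, p i * q i) atTop (𝓝 L)

/-- The partial derivative `∂ f_i / ∂ x_j` at `x`, where `f_i(x) = ‖a_i - x‖ - ‖x‖`. -/
def partialRangeDiff (a : ℕ → Space n) (x : Space n) (j : Fin n) (i : ℕ) : ℝ :=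
  fderiv ℝ (rangeDiff (a i)) x (EuclideanSpace.single j 1)

/-- `M` is the matrix of the tail products of the sequences of partial derivatives at `x`. -/
def IsTailGram (a : ℕ → Space n) (x : Space n) (M : Matrix (Fin n) (Fin n) ℝ) : Prop :=
  ∀ j k, HasTailProduct (partialRangeDiff a x j) (partialRangeDiff a x k) (M j k)

end TDOA

end

/-! Write `f_z(x) = ‖z - x‖ - ‖x‖`. The objective at `x` exceeds its value at `xo` by the sensor
average of `(f_z(xo) - f_z(x))²` plus twice a weighted average of the noise
(`objective_sub_objective`).

Consistency. The weights `f_z(xo) - f_z(x)` are 2-Lipschitz in `z` and bounded on the sensors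
independently of `x`. Since the sensors form a totally bounded set, the noise term vanishes
uniformly in `x`, even over an unbounded `Θ` (`FourthMomentBound.ae_uniform_weighted_average`).
Hence the mean square discrepancy at the estimate tends to zero. Along an ultrafilter the estimates
either converge to some `y`, and then `f_z(xo) = f_z(y)` for almost every `z`, or escape to infinity
in a direction `u`, and then `f_z(xo) = -⟨u, z⟩` for almost every `z`. For `y ≠ xo` these loci are
hyperplanes, hyperboloids, paraboloids or parts of lines, all excluded by hypothesis.

Asymptotic normality. The function `f_z` is not differentiable at `z`, and sensors may accumulate at
`xo`, so a second-order Taylor expansion of the objective is not available. Instead, with `x = xo +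
s / √m`, the excess of the objective times `m` is shown to be `⟨s, M s⟩ - 2⟨Z, s⟩ + o(1)` in
probability, uniformly for bounded `s`, where `Z` is the score. For the signal, a first-order
expansion of `f_z` in mean square suffices: as `μ {xo} = 0`, the sensors near `xo` have small
frequency. For the noise, dyadic chaining with fourth moments bounds the supremum of `s ↦ ∑ φ_i(s)
ξ_i` through the mean square increments of the weights; the sum over scales converges because the
dimension is below 4. The same bound on dyadic shells shows that the rescaled estimates are bounded
in probability.

The matrix `M` is positive definite because a null direction would put `μ` on a hyperplane, a cone
with vertex `xo`, or a line. Completing the square then gives `√m (xhat - xo) - M⁻¹ Z → 0` in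
probability (`FourthMomentBound.tendstoInMeasure_sub_gramInverse_score`). Finally `M⁻¹ Z` is exactly
Gaussian for every `m`, so no central limit theorem is needed: it is enough that its covariance
converges. -/

noncomputable section

namespace TDOA

/-! ### Weighted sums of independent Gaussian variables -/

section Noise

variable {Ω : Type*} [MeasurableSpace Ω] {P : Measure Ω} {ξ : ℕ → Ω → ℝ}

/-- A weighted sum of independent centred Gaussian variables is a centred Gaussian variable. -/
theorem map_weightedSum_gaussian [IsProbabilityMeasure P] {v : ℝ≥0} (hind : iIndepFun ξ P)
    (hlaw : ∀ i, HasLaw (ξ i) (gaussianReal 0 v) P) (s : Finset ℕ) (c : ℕ → ℝ) :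
    P.map (fun ω => ∑ i ∈ s, c i * ξ i ω) =
      gaussianReal 0 (v * (∑ i ∈ s, (c i) ^ 2).toNNReal) := by
  classical
  have hind' : iIndepFun (fun i ω => c i * ξ i ω) P :=
    hind.comp (fun i x => c i * x) fun i => measurable_const_mul (c i)
  have hmeas : ∀ i, AEMeasurable (fun ω => c i * ξ i ω) P := fun i =>
    (hlaw i).aemeasurable.const_mul (c i)
  induction s using Finset.induction_on with
  | empty => simp [Measure.map_const]
  | insert i s hi ih =>
    have h1 : P.map (fun ω => c i * ξ i ω) =
        gaussianReal 0 (v * ((c i) ^ 2).toNNReal) := by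
      have := (gaussianReal_const_mul (hlaw i) (c i)).map_eq
      rw [this]
      congr 1
      · simp
      · ext; simp [Real.coe_toNNReal _ (sq_nonneg (c i)), mul_comm]
    have h2 := gaussianReal_add_gaussianReal_of_indepFun
      (hind'.indepFun_finsetSum_of_notMem₀ hmeas hi)
      (by
        have : (∑ j ∈ s, fun ω => c j * ξ j ω) = fun ω => ∑ j ∈ s, c j * ξ j ω := by
          ext ω; simp
        rw [this]; exact ih) h1
    have h3 : (fun ω => ∑ j ∈ insert i s, c j * ξ j ω) =
        (∑ j ∈ s, fun ω => c j * ξ j ω) + fun ω => c i * ξ i ω := by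
      ext ω; simp [Finset.sum_insert hi, add_comm]
    rw [h3, h2, Finset.sum_insert hi, Real.toNNReal_add (sq_nonneg _)
      (Finset.sum_nonneg fun _ _ => sq_nonneg _)]
    congr 1
    · simp
    · ring

/-- `κ` bounds the fourth moments of all weighted sums of the variables `ξ i`, relative to the
square of the sum of the squared weights. -/
structure FourthMomentBound (P : Measure Ω) (ξ : ℕ → Ω → ℝ) (κ : ℝ) : Prop where
  nonneg : 0 ≤ κ
  aemeasurable : ∀ i, AEMeasurable (ξ i) P
  lintegral_le : ∀ (s : Finset ℕ) (c : ℕ → ℝ),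
    ∫⁻ ω, ENNReal.ofReal ((∑ i ∈ s, c i * ξ i ω) ^ 4) ∂P ≤
      ENNReal.ofReal (κ * (∑ i ∈ s, (c i) ^ 2) ^ 2)

/-- Scaling from the standard Gaussian, whose fourth moment is `κ`. Its numerical value plays no
role. -/
theorem exists_lintegral_pow_four_gaussianReal :
    ∃ κ : ℝ, 0 ≤ κ ∧ ∀ v : ℝ≥0,
      ∫⁻ x, ENNReal.ofReal (x ^ 4) ∂(gaussianReal 0 v) = ENNReal.ofReal (κ * (v : ℝ) ^ 2) := by
  have hmem : MemLp id 4 (gaussianReal 0 1) := memLp_id_gaussianReal 4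
  have h_int : Integrable (fun x : ℝ => x ^ 4) (gaussianReal 0 1) := by
    have := hmem.integrable_norm_pow (by norm_num)
    simpa [Even.pow_abs (show Even 4 by decide)] using this
  refine ⟨∫ x, x ^ 4 ∂(gaussianReal 0 1), integral_nonneg fun x => by positivity, fun v => ?_⟩
  have hmap : gaussianReal 0 v = (gaussianReal 0 1).map (fun x => √(v : ℝ) * x) := by
    rw [gaussianReal_map_const_mul]
    congr 1
    · simp
    · ext; simp
  rw [hmap, lintegral_map (by fun_prop) (by fun_prop)]
  have : ∀ x : ℝ, ENNReal.ofReal ((√(v : ℝ) * x) ^ 4) =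
      ENNReal.ofReal ((v : ℝ) ^ 2) * ENNReal.ofReal (x ^ 4) := fun x => by
    rw [← ENNReal.ofReal_mul (by positivity)]
    congr 1
    rw [mul_pow, show √(v : ℝ) ^ 4 = (√(v : ℝ) ^ 2) ^ 2 by ring, Real.sq_sqrt v.coe_nonneg]
  simp_rw [this]
  rw [lintegral_const_mul _ (by fun_prop), ← ofReal_integral_eq_lintegral_ofReal h_int
    (ae_of_all _ fun x => by positivity), ← ENNReal.ofReal_mul (by positivity), mul_comm]

theorem exists_fourthMomentBound_of_gaussian [IsProbabilityMeasure P] {v : ℝ≥0}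
    (hind : iIndepFun ξ P)
    (hlaw : ∀ i, HasLaw (ξ i) (gaussianReal 0 v) P) : ∃ κ, FourthMomentBound P ξ κ := by
  obtain ⟨κ, hκ, h⟩ := exists_lintegral_pow_four_gaussianReal
  refine ⟨κ * (v : ℝ) ^ 2, by positivity, fun i => (hlaw i).aemeasurable, fun s c => ?_⟩
  have hm : AEMeasurable (fun ω => ∑ i ∈ s, c i * ξ i ω) P :=
    Finset.aemeasurable_fun_sum _ fun i _ => (hlaw i).aemeasurable.const_mul (c i)
  have := lintegral_map' (f := fun x : ℝ => ENNReal.ofReal (x ^ 4)) (by fun_prop) hm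
  rw [← this, map_weightedSum_gaussian hind hlaw, h]
  apply le_of_eq
  congr 1
  rw [NNReal.coe_mul, Real.coe_toNNReal _ (Finset.sum_nonneg fun _ _ => sq_nonneg _)]
  ring

/-- Markov's inequality for the fourth moment of a weighted sum. -/
theorem FourthMomentBound.measure_ge_le {κ : ℝ} (h : FourthMomentBound P ξ κ) (s : Finset ℕ)
    (c : ℕ → ℝ) {η : ℝ} (hη : 0 < η) :
    P {ω | η ≤ |∑ i ∈ s, c i * ξ i ω|} ≤
      ENNReal.ofReal (κ * (∑ i ∈ s, (c i) ^ 2) ^ 2 / η ^ 4) := by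
  have hm : AEMeasurable (fun ω => ∑ i ∈ s, c i * ξ i ω) P :=
    Finset.aemeasurable_fun_sum _ fun i _ => (h.aemeasurable i).const_mul (c i)
  have h0 : ENNReal.ofReal (η ^ 4) ≠ 0 := by simp; positivity
  calc P {ω | η ≤ |∑ i ∈ s, c i * ξ i ω|}
      ≤ P {ω | ENNReal.ofReal (η ^ 4) ≤ ENNReal.ofReal ((∑ i ∈ s, c i * ξ i ω) ^ 4)} := by
        refine measure_mono fun ω hω => ENNReal.ofReal_le_ofReal ?_
        rw [← Even.pow_abs (show Even 4 by decide) (∑ i ∈ s, c i * ξ i ω)]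
        exact pow_le_pow_left₀ hη.le hω 4
    _ ≤ (∫⁻ ω, ENNReal.ofReal ((∑ i ∈ s, c i * ξ i ω) ^ 4) ∂P) / ENNReal.ofReal (η ^ 4) :=
        meas_ge_le_lintegral_div (by fun_prop) h0 ENNReal.ofReal_ne_top
    _ ≤ ENNReal.ofReal (κ * (∑ i ∈ s, (c i) ^ 2) ^ 2) / ENNReal.ofReal (η ^ 4) := by
        gcongr; exact h.lintegral_le s c
    _ = _ := by rw [ENNReal.ofReal_div_of_pos (by positivity)]

/-- The strong law for bounded weights. -/
theorem FourthMomentBound.ae_tendsto_weighted_average {κ : ℝ} (h : FourthMomentBound P ξ κ)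
    {c : ℕ → ℝ} {C : ℝ} (hc : ∀ i, |c i| ≤ C) :
    ∀ᵐ ω ∂P, Tendsto (fun m : ℕ => (m : ℝ)⁻¹ * ∑ i ∈ Finset.range m, c i * ξ i ω) atTop
      (𝓝 0) := by
  have key : ∀ k : ℕ, ∀ᵐ ω ∂P, ∀ᶠ m : ℕ in atTop,
      |∑ i ∈ Finset.range m, c i * ξ i ω| < (1 / ((k : ℝ) + 1)) * m := by
    intro k
    set η : ℝ := 1 / ((k : ℝ) + 1) with hη
    have hη0 : 0 < η := by positivity
    -- The condition `0 < m` empties the event at `m = 0`, where the bound on the right is zero by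
    -- the convention for division. The decay `1 / m²` is what Borel–Cantelli needs.
    have hb : ∀ m : ℕ, P {ω | 0 < m ∧ η * m ≤ |∑ i ∈ Finset.range m, c i * ξ i ω|} ≤
        ENNReal.ofReal (κ * C ^ 4 / η ^ 4 * (1 / (m : ℝ) ^ 2)) := by
      intro m
      rcases Nat.eq_zero_or_pos m with rfl | hm
      · simp
      have hm' : (0 : ℝ) < m := by exact_mod_cast hm
      refine (measure_mono fun ω hω => hω.2).trans
        ((h.measure_ge_le _ c (mul_pos hη0 hm')).trans (ENNReal.ofReal_le_ofReal ?_))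
      have hs : ∑ i ∈ Finset.range m, (c i) ^ 2 ≤ m * C ^ 2 := by
        calc ∑ i ∈ Finset.range m, (c i) ^ 2 ≤ ∑ i ∈ Finset.range m, C ^ 2 :=
              Finset.sum_le_sum fun i _ => sq_le_sq.2 ((hc i).trans (le_abs_self C))
          _ = m * C ^ 2 := by simp
      have hs0 : 0 ≤ ∑ i ∈ Finset.range m, (c i) ^ 2 := Finset.sum_nonneg fun _ _ => sq_nonneg _
      have hκ := h.nonneg
      calc κ * (∑ i ∈ Finset.range m, (c i) ^ 2) ^ 2 / (η * m) ^ 4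
          ≤ κ * (m * C ^ 2) ^ 2 / (η * m) ^ 4 := by gcongr
        _ = _ := by field_simp
    have hsum : (∑' m : ℕ, P {ω | 0 < m ∧ η * m ≤ |∑ i ∈ Finset.range m, c i * ξ i ω|}) ≠ ⊤ := by
      refine ne_top_of_le_ne_top ?_ (ENNReal.tsum_le_tsum hb)
      exact (Summable.mul_left _ (Real.summable_one_div_nat_pow.2 one_lt_two)).tsum_ofReal_ne_top
    filter_upwards [ae_eventually_notMem hsum] with ω hω
    filter_upwards [hω, eventually_gt_atTop 0] with m hm hm0
    by_contra hcon
    exact hm ⟨hm0, not_lt.1 hcon⟩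
  filter_upwards [ae_all_iff.2 key] with ω hω
  rw [Metric.tendsto_nhds]
  intro ε hε
  obtain ⟨k, hk⟩ := exists_nat_one_div_lt hε
  filter_upwards [hω k, eventually_gt_atTop 0] with m hm hm0
  have hm' : (0 : ℝ) < m := by exact_mod_cast hm0
  rw [Real.dist_0_eq_abs, abs_mul, abs_of_pos (inv_pos.2 hm'), inv_mul_lt_iff₀ hm']
  nlinarith

/-- The averages of the absolute values of independent Gaussian variables are bounded. -/
theorem ae_eventually_average_abs_le {v : ℝ≥0} (hind : iIndepFun ξ P)
    (hlaw : ∀ i, HasLaw (ξ i) (gaussianReal 0 v) P) :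
    ∃ A : ℝ, 0 < A ∧ ∀ᵐ ω ∂P, ∀ᶠ m : ℕ in atTop,
      (m : ℝ)⁻¹ * ∑ i ∈ Finset.range m, |ξ i ω| ≤ A := by
  have hid : ∀ i, IdentDistrib (ξ i) (ξ 0) P P := fun i =>
    ⟨(hlaw i).aemeasurable, (hlaw 0).aemeasurable, by rw [(hlaw i).map_eq, (hlaw 0).map_eq]⟩
  have h_int : Integrable (ξ 0) P := by
    have h1 : Integrable id (gaussianReal 0 v) := (memLp_id_gaussianReal 1).integrable le_rfl
    rw [← (hlaw 0).map_eq] at h1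
    exact h1.comp_aemeasurable (hlaw 0).aemeasurable
  have := strong_law_ae_real (fun i ω => |ξ i ω|) h_int.abs
    (fun i j hij => (hind.indepFun hij).comp measurable_abs measurable_abs)
    (fun i => (hid i).comp measurable_abs)
  refine ⟨|∫ ω, |ξ 0 ω| ∂P| + 1, by positivity, ?_⟩
  filter_upwards [this] with ω hω
  filter_upwards [hω.eventually_lt_const (lt_of_le_of_lt (le_abs_self _) (lt_add_one _))]
    with m hm
  rw [inv_mul_eq_div]
  exact hm.le

end Noise

/-! ### Uniform strong law over Lipschitz weights -/

section UniformLaw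

variable {Ω : Type*} [MeasurableSpace Ω] {P : Measure Ω} {ξ : ℕ → Ω → ℝ}

/-- The weighted strong law holds uniformly over the weights `φ (b i)`, where `φ` is `L`-Lipschitz
and bounded by `C` on the totally bounded range of `b`. -/
theorem FourthMomentBound.ae_uniform_weighted_average {κ A : ℝ} (h : FourthMomentBound P ξ κ)
    (hA : 0 < A)
    (habs : ∀ᵐ ω ∂P, ∀ᶠ m : ℕ in atTop, (m : ℝ)⁻¹ * ∑ i ∈ Finset.range m, |ξ i ω| ≤ A)
    {E : Type*} [PseudoMetricSpace E] {b : ℕ → E} (hb : TotallyBounded (Set.range b))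
    {L : ℝ} (hL : 0 < L) {C : ℝ} :
    ∀ᵐ ω ∂P, ∀ ε > 0, ∀ᶠ m : ℕ in atTop, ∀ φ : E → ℝ,
      (∀ x y, |φ x - φ y| ≤ L * dist x y) → (∀ i, |φ (b i)| ≤ C) →
      |(m : ℝ)⁻¹ * ∑ i ∈ Finset.range m, φ (b i) * ξ i ω| ≤ ε := by
  classical
  -- Finite nets of mesh `1 / (k + 1)` with centres in the range of `b`, where the weights are
  -- bounded by `C`; `p i` is a net point near `b i`. Neither depends on the weight `φ`, so one null
  -- set serves all `φ`.
  have hnet : ∀ k : ℕ, ∃ t : Finset E, (∀ y ∈ t, y ∈ Set.range b) ∧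
      ∃ p : ℕ → E, ∀ i, p i ∈ t ∧ dist (b i) (p i) < 1 / ((k : ℝ) + 1) := by
    intro k
    obtain ⟨t, hts, htf, hcov⟩ :=
      Metric.finite_approx_of_totallyBounded hb (1 / ((k : ℝ) + 1)) (by positivity)
    refine ⟨htf.toFinset, fun y hy => hts (htf.mem_toFinset.1 hy), ?_⟩
    have : ∀ i, ∃ y, y ∈ htf.toFinset ∧ dist (b i) y < 1 / ((k : ℝ) + 1) := fun i => by
      have := hcov (Set.mem_range_self i)
      simpa using this
    choose p hp using this
    exact ⟨p, hp⟩
  choose t ht p hp using hnet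
  have hlaw : ∀ᵐ ω ∂P, ∀ k : ℕ, ∀ y ∈ t k, Tendsto (fun m : ℕ =>
      (m : ℝ)⁻¹ * ∑ i ∈ Finset.range m, (if p k i = y then 1 else 0) * ξ i ω) atTop (𝓝 0) := by
    refine ae_all_iff.2 fun k => (ae_ball_iff (t k).countable_toSet).2 fun y _ => ?_
    refine h.ae_tendsto_weighted_average (C := 1) fun i => ?_
    split_ifs <;> simp
  filter_upwards [hlaw, habs] with ω hω hωA ε hε
  obtain ⟨k, hk⟩ := exists_nat_one_div_lt (show 0 < ε / 2 / (L * A) by positivity)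
  have hsum : Tendsto (fun m : ℕ => ∑ y ∈ t k, C *
      |(m : ℝ)⁻¹ * ∑ i ∈ Finset.range m, (if p k i = y then 1 else 0) * ξ i ω|) atTop (𝓝 0) := by
    have : Tendsto (fun m : ℕ => ∑ y ∈ t k, C *
        |(m : ℝ)⁻¹ * ∑ i ∈ Finset.range m, (if p k i = y then 1 else 0) * ξ i ω|) atTop
        (𝓝 (∑ y ∈ t k, C * |(0 : ℝ)|)) :=
      tendsto_finsetSum _ fun y hy => ((hω k y hy).abs).const_mul C
    simpa using this
  filter_upwards [hsum.eventually_lt_const (half_pos hε), hωA] with m hm hmA φ hφ hφC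
  -- Replacing `b i` by its net point leaves finitely many noise averages free of `φ`, with bounded
  -- coefficients `φ y`, and an error of at most `L / (k + 1)` times the average of `|ξ i|`.
  have hdecomp : (m : ℝ)⁻¹ * ∑ i ∈ Finset.range m, φ (b i) * ξ i ω =
      (∑ y ∈ t k, φ y * ((m : ℝ)⁻¹ *
        ∑ i ∈ Finset.range m, (if p k i = y then 1 else 0) * ξ i ω)) +
      (m : ℝ)⁻¹ * ∑ i ∈ Finset.range m, (φ (b i) - φ (p k i)) * ξ i ω := by
    have : ∑ y ∈ t k, φ y * ((m : ℝ)⁻¹ *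
        ∑ i ∈ Finset.range m, (if p k i = y then 1 else 0) * ξ i ω) =
        (m : ℝ)⁻¹ * ∑ i ∈ Finset.range m, φ (p k i) * ξ i ω := by
      simp_rw [Finset.mul_sum]
      rw [Finset.sum_comm]
      refine Finset.sum_congr rfl fun i _ => ?_
      rw [Finset.sum_eq_single (p k i)]
      · simp; ring
      · intro y _ hy
        simp [hy.symm]
      · exact fun hn => absurd (hp k i).1 hn
    rw [this, ← mul_add, ← Finset.sum_add_distrib]
    congr 1
    exact Finset.sum_congr rfl fun i _ => by ring
  rw [hdecomp]
  have h1 : |∑ y ∈ t k, φ y * ((m : ℝ)⁻¹ *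
        ∑ i ∈ Finset.range m, (if p k i = y then 1 else 0) * ξ i ω)| ≤ ε / 2 := by
    refine (Finset.abs_sum_le_sum_abs _ _).trans (le_trans (Finset.sum_le_sum fun y hy => ?_) hm.le)
    rw [abs_mul]
    obtain ⟨i, rfl⟩ := ht k y hy
    gcongr
    exact hφC i
  have h2 : |(m : ℝ)⁻¹ * ∑ i ∈ Finset.range m, (φ (b i) - φ (p k i)) * ξ i ω| ≤ ε / 2 := by
    have hm0 : (0 : ℝ) ≤ (m : ℝ)⁻¹ := by positivity
    rw [abs_mul, abs_of_nonneg hm0]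
    have hd : L * (1 / ((k : ℝ) + 1)) * A ≤ ε / 2 := by
      have := mul_le_mul_of_nonneg_right hk.le (show 0 ≤ L * A by positivity)
      rw [div_mul_cancel₀ _ (by positivity)] at this
      linarith
    calc (m : ℝ)⁻¹ * |∑ i ∈ Finset.range m, (φ (b i) - φ (p k i)) * ξ i ω|
        ≤ (m : ℝ)⁻¹ * ∑ i ∈ Finset.range m, L * (1 / ((k : ℝ) + 1)) * |ξ i ω| := by
          gcongr
          refine (Finset.abs_sum_le_sum_abs _ _).trans (Finset.sum_le_sum fun i _ => ?_)
          rw [abs_mul]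
          gcongr
          refine (hφ _ _).trans ?_
          gcongr
          exact (hp k i).2.le
      _ = L * (1 / ((k : ℝ) + 1)) * ((m : ℝ)⁻¹ * ∑ i ∈ Finset.range m, |ξ i ω|) := by
          rw [← Finset.mul_sum]; ring
      _ ≤ L * (1 / ((k : ℝ) + 1)) * A := by gcongr
      _ ≤ ε / 2 := hd
  calc _ ≤ _ := abs_add_le _ _
    _ ≤ ε := by linarith

end UniformLaw

/-! ### Empirical averages of the sensor positions -/

section Empirical

/-- The average of `φ` over the first `m` points of the sequence `b`. -/
def average {E : Type*} (b : ℕ → E) (m : ℕ) (φ : E → ℝ) : ℝ :=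
  (m : ℝ)⁻¹ * ∑ i ∈ Finset.range m, φ (b i)

variable {n : ℕ} {b : ℕ → Space n} {μ : Measure (Space n)} [IsProbabilityMeasure μ]

/-- The box `∏ j, (u j, v j]`, with lower bounds imposed only for the coordinates in `J`. -/
def halfOpenBox (J : Finset (Fin n)) (u v : Fin n → ℝ) : Set (Space n) :=
  {z | (∀ j ∈ J, u j < z j) ∧ ∀ j, z j ≤ v j}

theorem measurableSet_halfOpenBox (J : Finset (Fin n)) (u v : Fin n → ℝ) :
    MeasurableSet (halfOpenBox J u v) := by
  have : halfOpenBox J u v =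
      (⋂ j ∈ J, {z : Space n | u j < z j}) ∩ ⋂ j, {z : Space n | z j ≤ v j} := by
    ext z; simp [halfOpenBox]
  rw [this]
  refine (Finset.measurableSet_biInter _ fun j _ => ?_).inter (MeasurableSet.iInter fun j => ?_)
  · exact measurableSet_lt measurable_const (by fun_prop)
  · exact measurableSet_le (by fun_prop) measurable_const

/-- Convergence of the sample distribution functions gives convergence of the frequencies of
half-open boxes. -/
theorem tendsto_average_halfOpenBox
    (hμ : ∀ z : Space n, Tendsto (fun m => average b m ({y | ∀ j, y j ≤ z j}.indicator 1)) atTop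
      (𝓝 (distributionFunction μ z)))
    (J : Finset (Fin n)) (u : Fin n → ℝ) : ∀ v : Fin n → ℝ, (∀ j ∈ J, u j ≤ v j) →
      Tendsto (fun m => average b m ((halfOpenBox J u v).indicator 1)) atTop
        (𝓝 (μ.real (halfOpenBox J u v))) := by
  classical
  induction J using Finset.induction_on with
  | empty =>
    intro v _
    have := hμ (WithLp.toLp 2 v)
    simpa [halfOpenBox, distributionFunction] using this
  | insert j J hj ih =>
    intro v hv
    have hjv : u j ≤ v j := hv j (Finset.mem_insert_self _ _)
    -- A lower bound in coordinate `j` removes the smaller box whose upper bound there is `u j`;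
    -- frequencies and measures both subtract.
    set v' := Function.update v j (u j) with hv'
    have hv'J : ∀ k ∈ J, u k ≤ v' k := fun k hk => by
      have hkj : k ≠ j := fun h => hj (h ▸ hk)
      simpa [hv', hkj] using hv k (Finset.mem_insert_of_mem hk)
    have hle : ∀ k, v' k ≤ v k := fun k => by
      by_cases hk : k = j
      · subst hk; simpa [hv'] using hjv
      · simp [hv', hk]
    have hsub : halfOpenBox J u v' ⊆ halfOpenBox J u v := fun z hz =>
      ⟨hz.1, fun k => (hz.2 k).trans (hle k)⟩
    have hdiff : halfOpenBox (insert j J) u v = halfOpenBox J u v \ halfOpenBox J u v' := by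
      ext z
      simp only [halfOpenBox, Finset.mem_insert, forall_eq_or_imp, Set.mem_sdiff,
        Set.mem_ofPred_eq, not_and, not_forall, not_le]
      constructor
      · rintro ⟨⟨h1, h2⟩, h3⟩
        exact ⟨⟨h2, h3⟩, fun _ => ⟨j, by simpa [hv'] using h1⟩⟩
      · rintro ⟨⟨h2, h3⟩, h4⟩
        obtain ⟨k, hk⟩ := h4 h2
        by_cases hkj : k = j
        · subst hkj
          exact ⟨⟨by simpa [hv'] using hk, h2⟩, h3⟩
        · simp [hv', hkj] at hk
          exact absurd (h3 k) (not_le.2 hk)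
    have h1 := ih v fun k hk => hv k (Finset.mem_insert_of_mem hk)
    have h2 := ih v' hv'J
    have h3 := h1.sub h2
    rw [hdiff, measureReal_sdiff hsub (measurableSet_halfOpenBox _ _ _)]
    refine h3.congr fun m => ?_
    rw [average, average, average, ← mul_sub, ← Finset.sum_sub_distrib]
    congr 1
    refine Finset.sum_congr rfl fun i _ => ?_
    rw [Set.indicator_sdiff hsub]
    rfl

theorem exists_halfOpenBox_mem_nhds {s : Set (Space n)} (hs : IsOpen s) {x : Space n}
    (hx : x ∈ s) : ∃ u v : Fin n → ℝ, (∀ j, u j ≤ v j) ∧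
      halfOpenBox Finset.univ u v ∈ 𝓝 x ∧ halfOpenBox Finset.univ u v ⊆ s := by
  set e := (EuclideanSpace.equiv (Fin n) ℝ).toHomeomorph with he
  have hopen : IsOpen (e '' s) := e.isOpenMap s hs
  obtain ⟨δ, hδ, hball⟩ := Metric.isOpen_iff.1 hopen (e x) ⟨x, hx, rfl⟩
  refine ⟨fun j => x j - δ / 2, fun j => x j + δ / 2, fun j => by linarith, ?_, ?_⟩
  · have hop : IsOpen {z : Space n | ∀ j, x j - δ / 2 < z j ∧ z j < x j + δ / 2} := by
      simp only [Set.ofPred_forall]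
      refine isOpen_iInter_of_finite fun j => ?_
      have h1 : IsOpen {z : Space n | x j - δ / 2 < z j} :=
        isOpen_lt continuous_const (by fun_prop)
      have h2 : IsOpen {z : Space n | z j < x j + δ / 2} :=
        isOpen_lt (by fun_prop) continuous_const
      exact h1.inter h2
    refine mem_of_superset (hop.mem_nhds fun j => ⟨by linarith, by linarith⟩) fun z hz => ?_
    exact ⟨fun j _ => (hz j).1, fun j => (hz j).2.le⟩
  · intro z hz
    have : e z ∈ Metric.ball (e x) δ := by
      rw [Metric.mem_ball, dist_pi_lt_iff hδ]
      intro j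
      have h1 := hz.1 j (Finset.mem_univ j)
      have h2 := hz.2 j
      have : dist (z j) (x j) < δ := by
        rw [Real.dist_eq, abs_lt]; constructor <;> linarith
      exact this
    obtain ⟨w, hw, hwz⟩ := hball this
    rwa [← e.injective hwz]

/-- The empirical distribution of the first `m + 1` points. -/
def empiricalMeasure (b : ℕ → Space n) (m : ℕ) : ProbabilityMeasure (Space n) :=
  ⟨((m + 1 : ℝ≥0)⁻¹) • ∑ i ∈ Finset.range (m + 1), Measure.dirac (b i), ⟨by
    simp only [Measure.smul_apply, Measure.coe_finsetSum, Finset.sum_apply, measure_univ,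
      Finset.sum_const, Finset.card_range, nsmul_eq_mul, mul_one]
    rw [ENNReal.smul_def, smul_eq_mul, ENNReal.coe_inv (by positivity)]
    push_cast
    exact ENNReal.inv_mul_cancel (by positivity) (by finiteness)⟩⟩

theorem integral_empiricalMeasure (b : ℕ → Space n) (m : ℕ) (φ : Space n → ℝ) :
    ∫ z, φ z ∂(empiricalMeasure b m : Measure (Space n)) = average b (m + 1) φ := by
  rw [empiricalMeasure, ProbabilityMeasure.coe_mk, integral_smul_nnreal_measure,
    integral_finsetSum_measure fun i _ => integrable_dirac (by simp)]
  simp [average, NNReal.smul_def]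

/-- Half-open boxes form a π-system that contains arbitrarily small neighbourhoods of every point,
so convergence of their frequencies implies weak convergence. No box has to be a continuity set,
since the distribution functions are assumed to converge at every point. -/
theorem tendsto_empiricalMeasure
    (hμ : ∀ z : Space n, Tendsto (fun m => average b m ({y | ∀ j, y j ≤ z j}.indicator 1)) atTop
      (𝓝 (distributionFunction μ z))) :
    Tendsto (empiricalMeasure b) atTop (𝓝 ⟨μ, inferInstance⟩) := by
  let S : Set (Set (Space n)) :=
    {s | ∃ u v : Fin n → ℝ, (∀ j, u j ≤ v j) ∧ s = halfOpenBox Finset.univ u v}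
  have hS : IsPiSystem S := by
    rintro _ ⟨u, v, -, rfl⟩ _ ⟨u', v', -, rfl⟩ ⟨z, hz, hz'⟩
    refine ⟨fun j => max (u j) (u' j), fun j => min (v j) (v' j), fun j => ?_, ?_⟩
    · exact (max_lt (hz.1 j (Finset.mem_univ j)) (hz'.1 j (Finset.mem_univ j))).le.trans
        (le_min (hz.2 j) (hz'.2 j))
    · ext w
      simp only [halfOpenBox, Finset.mem_univ, Set.mem_inter_iff, Set.mem_ofPred_eq, max_lt_iff,
        le_min_iff, true_imp_iff, forall_and]
      tauto
  refine hS.tendsto_probabilityMeasure_of_tendsto_of_mem ?_ ?_ ?_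
  · rintro _ ⟨u, v, -, rfl⟩
    exact measurableSet_halfOpenBox _ _ _
  · intro s hs x hx
    obtain ⟨u, v, huv, h1, h2⟩ := exists_halfOpenBox_mem_nhds hs hx
    exact ⟨_, ⟨u, v, huv, rfl⟩, h1, h2⟩
  · rintro _ ⟨u, v, huv, rfl⟩
    have h := (tendsto_average_halfOpenBox hμ Finset.univ u v fun j _ => huv j).comp
      (tendsto_add_atTop_nat 1)
    rw [← NNReal.tendsto_coe]
    refine h.congr fun m => ?_
    rw [Function.comp_apply, ← integral_empiricalMeasure,
      integral_indicator_one (measurableSet_halfOpenBox _ _ _)]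
    rfl

/-- Empirical averages of continuous functions converge along a bounded sequence whose sample
distribution functions converge; the limit measure is carried by the same ball. -/
theorem empirical_convergence {R : ℝ} (hb : ∀ i, ‖b i‖ ≤ R)
    (hμ : ∀ z : Space n, Tendsto (fun m => average b m ({y | ∀ j, y j ≤ z j}.indicator 1)) atTop
      (𝓝 (distributionFunction μ z))) :
    (∀ᵐ z ∂μ, ‖z‖ ≤ R) ∧ ∀ φ : Space n → ℝ, Continuous φ →
      Tendsto (fun m => average b m φ) atTop (𝓝 (∫ z, φ z ∂μ)) := by
  have hlim := tendsto_empiricalMeasure hμ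
  have hball : ∀ᵐ z ∂μ, ‖z‖ ≤ R := by
    have h1 := ProbabilityMeasure.limsup_measure_closed_le_of_tendsto hlim
      (Metric.isClosed_closedBall (x := (0 : Space n)) (ε := R))
    have h2 : ∀ m, (empiricalMeasure b m : Measure (Space n)) (Metric.closedBall 0 R) = 1 := by
      intro m
      have : ((empiricalMeasure b m : Measure (Space n))).real (Metric.closedBall 0 R) = 1 := by
        rw [← integral_indicator_one Metric.isClosed_closedBall.measurableSet,
          integral_empiricalMeasure, average]
        have : ∀ i, (Metric.closedBall (0 : Space n) R).indicator (1 : Space n → ℝ) (b i) = 1 :=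
          fun i => Set.indicator_of_mem (by simpa using hb i) _
        simp only [this, Finset.sum_const, Finset.card_range, nsmul_eq_mul, mul_one]
        exact inv_mul_cancel₀ (by positivity)
      rw [measureReal_def] at this
      exact (ENNReal.toReal_eq_one_iff _).1 this
    simp only [h2, limsup_const, ProbabilityMeasure.coe_mk] at h1
    have h3 : μ (Metric.closedBall 0 R) = 1 := le_antisymm prob_le_one h1
    have h4 := (prob_compl_eq_zero_iff Metric.isClosed_closedBall.measurableSet).2 h3
    filter_upwards [compl_mem_ae_iff.2 h4] with z hz
    simpa using hz
  refine ⟨hball, fun φ hφ => ?_⟩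
  obtain ⟨C, hC⟩ := (isCompact_closedBall (0 : Space n) R).exists_bound_of_continuousOn
    hφ.continuousOn
  -- Weak convergence tests bounded functions only. Clipping `φ` at its bound on the ball changes it
  -- neither at the sensors nor almost everywhere.
  let ψ : BoundedContinuousFunction (Space n) ℝ :=
    BoundedContinuousFunction.ofNormedAddCommGroup (fun z => max (-C) (min C (φ z)))
      (by fun_prop) |C| (fun z => by
        rw [Real.norm_eq_abs, abs_le]
        constructor
        · exact (neg_abs_le_neg C).trans' (by simp) |>.trans (le_max_left _ _)
        · exact max_le (neg_le_abs C) ((min_le_left _ _).trans (le_abs_self C)))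
  have hψ : ∀ z, ‖z‖ ≤ R → ψ z = φ z := fun z hz => by
    have := abs_le.1 (hC z (by simpa using hz))
    change max (-C) (min C (φ z)) = φ z
    rw [min_eq_right this.2, max_eq_right this.1]
  have h1 := (ProbabilityMeasure.tendsto_iff_forall_integral_tendsto.1 hlim) ψ
  rw [ProbabilityMeasure.coe_mk, integral_congr_ae (hball.mono fun z hz => hψ z hz)] at h1
  rw [← tendsto_add_atTop_iff_nat 1]
  refine h1.congr fun m => ?_
  rw [integral_empiricalMeasure, average, average]
  congr 1
  exact Finset.sum_congr rfl fun i _ => hψ _ (hb i)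

end Empirical

/-! ### Elementary geometry -/

section Geometry

variable {n : ℕ}

/-- Convexity of the norm, from the Cauchy–Schwarz inequality for `y` and `y + h`. -/
theorem norm_add_sub_norm_sub_inner_nonneg {y : Space n} (hy : y ≠ 0) (h : Space n) :
    0 ≤ ‖y + h‖ - ‖y‖ - inner ℝ y h / ‖y‖ := by
  have hy' : 0 < ‖y‖ := norm_pos_iff.2 hy
  have h1 := real_inner_le_norm y (y + h)
  rw [inner_add_right, real_inner_self_eq_norm_sq] at h1
  have h2 : inner ℝ y h / ‖y‖ ≤ ‖y + h‖ - ‖y‖ := by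
    rw [div_le_iff₀ hy']; nlinarith
  linarith

/-- The gap between the two sides is `(‖y + h‖ - ‖y‖)² / (2‖y‖)`. -/
theorem norm_add_sub_norm_sub_inner_le {y : Space n} (hy : y ≠ 0) (h : Space n) :
    ‖y + h‖ - ‖y‖ - inner ℝ y h / ‖y‖ ≤ ‖h‖ ^ 2 / (2 * ‖y‖) := by
  have hy' : 0 < ‖y‖ := norm_pos_iff.2 hy
  have h1 := norm_add_sq_real y h
  have h2 : ‖y + h‖ - ‖y‖ ≤ inner ℝ y h / ‖y‖ + ‖h‖ ^ 2 / (2 * ‖y‖) := by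
    have : inner ℝ y h / ‖y‖ + ‖h‖ ^ 2 / (2 * ‖y‖) = (‖y + h‖ ^ 2 - ‖y‖ ^ 2) / (2 * ‖y‖) := by
      rw [h1]; field_simp; ring
    rw [this, le_div_iff₀ (by positivity)]
    nlinarith [sq_nonneg (‖y + h‖ - ‖y‖)]
  linarith

theorem abs_norm_add_sub_norm_sub_inner_le {y : Space n} (hy : y ≠ 0) (h : Space n) :
    |‖y + h‖ - ‖y‖ - inner ℝ y h / ‖y‖| ≤ ‖h‖ ^ 2 / (2 * ‖y‖) := by
  rw [abs_of_nonneg (norm_add_sub_norm_sub_inner_nonneg hy h)]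
  exact norm_add_sub_norm_sub_inner_le hy h

theorem exists_ne_zero_inner_eq_zero (hn : 2 ≤ n) (w : Space n) :
    ∃ v : Space n, v ≠ 0 ∧ inner ℝ v w = 0 := by
  have h1 : Submodule.span ℝ {w} ≠ ⊤ := fun h => by
    have h2 := finrank_span_le_card (R := ℝ) ({w} : Set (Space n))
    rw [h, finrank_top, finrank_euclideanSpace_fin, Set.toFinset_card, Set.card_singleton] at h2
    omega
  have h2 : (Submodule.span ℝ {w})ᗮ ≠ ⊥ := fun h => h1 (Submodule.orthogonal_eq_bot_iff.1 h)
  obtain ⟨v, hv, hv0⟩ := Submodule.exists_mem_ne_zero_of_ne_bot h2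
  refine ⟨v, hv0, ?_⟩
  rw [real_inner_comm]
  exact (Submodule.mem_orthogonal _ _).1 hv w (Submodule.mem_span_singleton_self w)

theorem abs_rangeDiff_le (b x : Space n) : |rangeDiff b x| ≤ ‖b‖ := by
  rw [rangeDiff, ← norm_neg x]
  have := abs_norm_sub_norm_le (b - x) (-x)
  simpa using this

theorem abs_rangeDiff_sub_left_le (b b' x : Space n) :
    |rangeDiff b x - rangeDiff b' x| ≤ ‖b - b'‖ := by
  have := abs_norm_sub_norm_le (b - x) (b' - x)
  rw [rangeDiff, rangeDiff]
  simpa using this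

theorem abs_rangeDiff_sub_right_le (b x y : Space n) :
    |rangeDiff b x - rangeDiff b y| ≤ 2 * ‖x - y‖ := by
  have h1 := abs_norm_sub_norm_le (b - x) (b - y)
  have h2 := abs_norm_sub_norm_le x y
  rw [sub_sub_sub_cancel_left, norm_sub_rev y x] at h1
  rw [rangeDiff, rangeDiff]
  rw [abs_le] at *
  constructor <;> linarith

end Geometry

/-! ### Identifiability -/

section Identifiability

variable {n : ℕ} {μ : Measure (Space n)} [IsProbabilityMeasure μ] {xo : Space n}

theorem measure_eq_one_of_ae {S : Set (Space n)} (h : ∀ᵐ z ∂μ, z ∈ S) : μ S = 1 := by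
  have h' : S =ᵐ[μ] Set.univ := eventuallyEq_univ.2 h
  rw [measure_congr h', measure_univ]

/-- A measure that charges no line, resp. plane, fully is not carried by a line. -/
theorem not_ae_mem_line (hn : 2 ≤ n)
    (h_hyperplane : ∀ S : Set (Space n), IsHyperplane S → μ S ≠ 1) (p w : Space n) :
    ¬ ∀ᵐ z ∂μ, ∃ t : ℝ, z - p = t • w := by
  intro h
  obtain ⟨v, hv, hvw⟩ := exists_ne_zero_inner_eq_zero hn w
  refine h_hyperplane _ ⟨v, inner ℝ v p, hv, rfl⟩ (measure_eq_one_of_ae ?_)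
  filter_upwards [h] with z hz
  obtain ⟨t, ht⟩ := hz
  have : inner ℝ v (z - p) = 0 := by rw [ht, inner_smul_right, hvw, mul_zero]
  rw [inner_sub_right] at this
  exact sub_eq_zero.1 this

/-- No other source position gives the same noiseless range differences almost everywhere. -/
theorem not_ae_rangeDiff_eq (hn : 2 ≤ n)
    (h_hyperboloid : ∀ S, IsHyperboloidWithFocus xo S → (0 : Space n) ∈ S → μ S ≠ 1)
    (h_hyperplane : ∀ S : Set (Space n), IsHyperplane S → μ S ≠ 1) {x : Space n} (hx : x ≠ xo) :
    ¬ ∀ᵐ z ∂μ, rangeDiff z xo = rangeDiff z x := by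
  intro h
  have h' : ∀ᵐ z ∂μ, ‖z - x‖ - ‖z - xo‖ = ‖x‖ - ‖xo‖ := by
    filter_upwards [h] with z hz
    simp only [rangeDiff] at hz; linarith
  have hne : 0 < ‖x - xo‖ := norm_pos_iff.2 (sub_ne_zero.2 hx)
  -- The locus depends on `c = ‖x‖ - ‖xo‖`. It is the perpendicular bisector for `c = 0`, and it
  -- lies on a hyperboloid through the origin with foci `xo` and `x` for `0 < |c| < ‖x - xo‖`. For
  -- `|c| = ‖x - xo‖`, equality in the triangle inequality puts it on the line through the foci.
  rcases eq_or_ne (‖x‖ - ‖xo‖) 0 with hc | hc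
  · refine h_hyperplane _ ⟨x - xo, 0, sub_ne_zero.2 hx, rfl⟩ (measure_eq_one_of_ae ?_)
    filter_upwards [h'] with z hz
    have h1 : ‖z - x‖ ^ 2 = ‖z - xo‖ ^ 2 := by rw [show ‖z - x‖ = ‖z - xo‖ by linarith]
    rw [norm_sub_sq_real, norm_sub_sq_real, show ‖x‖ = ‖xo‖ by linarith] at h1
    change inner ℝ (x - xo) z = 0
    rw [inner_sub_left, real_inner_comm, real_inner_comm z xo]
    linarith
  have hle : |‖x‖ - ‖xo‖| ≤ ‖x - xo‖ := abs_norm_sub_norm_le x xo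
  rcases hle.lt_or_eq with hlt | heq
  · refine h_hyperboloid {z | |dist z xo - dist z x| = |‖x‖ - ‖xo‖|}
      ⟨x, |‖x‖ - ‖xo‖|, abs_pos.2 hc, by rwa [dist_comm, dist_eq_norm], rfl⟩ ?_
      (measure_eq_one_of_ae ?_)
    · change |dist 0 xo - dist 0 x| = _
      rw [dist_zero_left, dist_zero_left, abs_sub_comm]
    · filter_upwards [h'] with z hz
      rw [dist_eq_norm, dist_eq_norm, abs_sub_comm, hz]
  · refine not_ae_mem_line hn h_hyperplane xo (x - xo) ?_
    filter_upwards [h'] with z hz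
    rcases abs_cases (‖x‖ - ‖xo‖) with ⟨h1, -⟩ | ⟨h1, -⟩
    · have h2 : SameRay ℝ (xo - x) (z - xo) := by
        rw [sameRay_iff_norm_add]
        rw [show xo - x + (z - xo) = z - x by abel, norm_sub_rev xo x]
        linarith
      obtain ⟨t, -, ht⟩ := h2.exists_nonneg_left (sub_ne_zero.2 hx.symm)
      exact ⟨-t, by rw [← ht, neg_smul, ← smul_neg, neg_sub]⟩
    · have h2 : SameRay ℝ (x - xo) (z - x) := by
        rw [sameRay_iff_norm_add]
        rw [show x - xo + (z - x) = z - xo by abel]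
        linarith
      obtain ⟨t, -, ht⟩ := h2.exists_nonneg_left (sub_ne_zero.2 hx)
      exact ⟨1 + t, by rw [add_smul, one_smul, ht]; abel⟩

/-- No direction at infinity gives the noiseless range differences almost everywhere. -/
theorem not_ae_rangeDiff_eq_neg_inner (hn : 2 ≤ n)
    (h_hyperplane : ∀ S : Set (Space n), IsHyperplane S → μ S ≠ 1)
    (h_paraboloid : ∀ S, IsParaboloidWithFocus xo S → (0 : Space n) ∈ S → μ S ≠ 1)
    {u : Space n} (hu : ‖u‖ = 1) :
    ¬ ∀ᵐ z ∂μ, rangeDiff z xo = - inner ℝ u z := by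
  intro h
  -- The equation reads `‖z - xo‖ = ‖xo‖ - ⟨u, z⟩`: a paraboloid with directrix `⟨u, z⟩ = ‖xo‖`. If
  -- the focus lies on the directrix, it degenerates to equality in Cauchy–Schwarz, hence to part of
  -- a line.
  rcases eq_or_ne (inner ℝ u xo) ‖xo‖ with hc | hc
  · refine not_ae_mem_line hn h_hyperplane xo u ?_
    filter_upwards [h] with z hz
    have h1 : inner ℝ u (xo - z) = ‖u‖ * ‖xo - z‖ := by
      rw [inner_sub_right, hc, hu, one_mul, norm_sub_rev]
      simp only [rangeDiff] at hz; linarith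
    rw [inner_eq_norm_mul_iff_real, hu, one_smul] at h1
    exact ⟨-‖xo - z‖, by rw [neg_smul, h1]; abel⟩
  · refine h_paraboloid _ ⟨u, ‖xo‖, hu, hc, rfl⟩ ?_ (measure_eq_one_of_ae ?_)
    · change dist 0 xo = |inner ℝ u 0 - ‖xo‖|
      simp
    · filter_upwards [h] with z hz
      change dist z xo = |inner ℝ u z - ‖xo‖|
      simp only [rangeDiff] at hz
      have h1 : ‖xo‖ - inner ℝ u z = ‖z - xo‖ := by linarith
      rw [abs_sub_comm, h1, abs_of_nonneg (norm_nonneg _), dist_eq_norm]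

/-- The gradients of the range differences at the source do not lie in a hyperplane through the
origin almost everywhere. -/
theorem not_ae_inner_eq_mul_norm (hn : 2 ≤ n)
    (h_hyperplane : ∀ S : Set (Space n), IsHyperplane S → μ S ≠ 1)
    (h_cone : ∀ S, IsConeWithVertex xo S → (0 : Space n) ∈ S → μ S ≠ 1)
    {v : Space n} (hv : ‖v‖ = 1) {c : ℝ} (hc : inner ℝ v xo = c * ‖xo‖) (hxo : xo ≠ 0) :
    ¬ ∀ᵐ z ∂μ, inner ℝ v (xo - z) = c * ‖xo - z‖ := by
  -- For `c ≥ 0` the locus is a hyperplane (`c = 0`), a nappe of a cone (`0 < c < 1`) or a ray (`c =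
  -- 1`). The hypothesis on `xo` says that the origin belongs to it and, by Cauchy–Schwarz, forces
  -- `c ≤ 1`. Negative `c` reduces to this by changing the signs of `v` and `c`.
  have main : ∀ (v : Space n) (c : ℝ), ‖v‖ = 1 → 0 ≤ c → inner ℝ v xo = c * ‖xo‖ →
      ¬ ∀ᵐ z ∂μ, inner ℝ v (xo - z) = c * ‖xo - z‖ := by
    intro v c hv hc0 hc h
    have hxo' : 0 < ‖xo‖ := norm_pos_iff.2 hxo
    have hc1 : c ≤ 1 := by
      have := real_inner_le_norm v xo
      rw [hc, hv] at this
      exact le_of_mul_le_mul_right this hxo'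
    have hflip : ∀ z, inner ℝ (-v) (z - xo) = inner ℝ v (xo - z) := fun z => by
      rw [inner_neg_left, ← inner_neg_right, neg_sub]
    rcases hc0.eq_or_lt with rfl | hcpos
    · refine h_hyperplane _ ⟨v, inner ℝ v xo, fun h0 => by simp [h0] at hv, rfl⟩
        (measure_eq_one_of_ae ?_)
      filter_upwards [h] with z hz
      rw [inner_sub_right, zero_mul] at hz
      exact (sub_eq_zero.1 hz).symm
    rcases hc1.lt_or_eq with hlt | rfl
    · refine h_cone _ ⟨-v, c, by rwa [norm_neg], hcpos, hlt, rfl⟩ ?_ (measure_eq_one_of_ae ?_)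
      · change inner ℝ (-v) (0 - xo) = c * dist 0 xo
        rw [hflip, sub_zero, hc, dist_zero_left]
      · filter_upwards [h] with z hz
        change inner ℝ (-v) (z - xo) = c * dist z xo
        rw [hflip, hz, dist_eq_norm, norm_sub_rev]
    · refine not_ae_mem_line hn h_hyperplane xo v ?_
      filter_upwards [h] with z hz
      rw [one_mul, ← one_mul ‖xo - z‖, ← hv, inner_eq_norm_mul_iff_real, hv, one_smul] at hz
      exact ⟨-‖xo - z‖, by rw [neg_smul, hz]; abel⟩
  rcases le_total 0 c with h0 | h0
  · exact main v c hv h0 hc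
  · intro h
    refine main (-v) (-c) (by rwa [norm_neg]) (by linarith) (by simp [hc]) ?_
    filter_upwards [h] with z hz
    rw [inner_neg_left, hz]; ring

end Identifiability

/-! ### Consistency -/

section Consistency

variable {n : ℕ} {b : ℕ → Space n} {μ : Measure (Space n)} [IsProbabilityMeasure μ]
  {xo : Space n}

theorem average_mono {b : ℕ → Space n} {m : ℕ} {φ ψ : Space n → ℝ}
    (h : ∀ i, φ (b i) ≤ ψ (b i)) : average b m φ ≤ average b m ψ := by
  unfold average
  gcongr with i _
  exact h i

/-- If the functions `φ k` tend to the continuous function `ψ` uniformly on the sequence `b`, and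
the averages of `(φ k)²` tend to zero, then `ψ` vanishes almost everywhere. -/
theorem ae_eq_zero_of_tendsto_average_sq {R : ℝ} (hball : ∀ᵐ z ∂μ, ‖z‖ ≤ R)
    (hconv : ∀ φ : Space n → ℝ, Continuous φ →
      Tendsto (fun m => average b m φ) atTop (𝓝 (∫ z, φ z ∂μ)))
    {l : Filter ℕ} [l.NeBot] (hl : l ≤ atTop) {φ : ℕ → Space n → ℝ} {ψ : Space n → ℝ}
    (hψ : Continuous ψ) {δ : ℕ → ℝ} (hδ : Tendsto δ l (𝓝 0))
    (hφψ : ∀ᶠ m in l, ∀ i, |φ m (b i) - ψ (b i)| ≤ δ m)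
    (hφ : Tendsto (fun m => average b m fun z => (φ m z) ^ 2) l (𝓝 0)) :
    ∀ᵐ z ∂μ, ψ z = 0 := by
  have h1 : Tendsto (fun m => average b m fun z => (ψ z) ^ 2) l (𝓝 (∫ z, (ψ z) ^ 2 ∂μ)) :=
    (hconv _ (by fun_prop)).mono_left hl
  have h2 : Tendsto (fun m => 2 * average b m (fun z => (φ m z) ^ 2) + 2 * (δ m) ^ 2) l
      (𝓝 0) := by
    have := (hφ.const_mul 2).add ((hδ.pow 2).const_mul 2)
    simpa using this
  have hle : ∀ᶠ m in l, average b m (fun z => (ψ z) ^ 2) ≤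
      2 * average b m (fun z => (φ m z) ^ 2) + 2 * (δ m) ^ 2 := by
    filter_upwards [hφψ, hl (eventually_gt_atTop 0)] with m hm hm0
    have hm' : (m : ℝ) ≠ 0 := by exact_mod_cast hm0.ne'
    calc average b m (fun z => (ψ z) ^ 2)
        ≤ average b m (fun z => 2 * (φ m z) ^ 2 + 2 * (δ m) ^ 2) := by
          refine average_mono fun i => ?_
          have h3 : (φ m (b i) - ψ (b i)) ^ 2 ≤ (δ m) ^ 2 :=
            sq_le_sq.2 ((hm i).trans (le_abs_self _))
          -- Uses `2φ² + 2(φ - ψ)² - ψ² = (2φ - ψ)²`.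
          nlinarith [sq_nonneg (2 * φ m (b i) - ψ (b i))]
      _ = _ := by
          simp only [average, Finset.sum_add_distrib, ← Finset.mul_sum, Finset.sum_const,
            Finset.card_range, nsmul_eq_mul]
          field_simp
  have h3 : ∫ z, (ψ z) ^ 2 ∂μ ≤ 0 := le_of_tendsto_of_tendsto h1 h2 hle
  have h4 : ∫ z, (ψ z) ^ 2 ∂μ = 0 := le_antisymm h3 (integral_nonneg fun z => sq_nonneg _)
  obtain ⟨C, hC⟩ := (isCompact_closedBall (0 : Space n) R).exists_bound_of_continuousOn
    (show ContinuousOn (fun z => (ψ z) ^ 2) _ by fun_prop)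
  have h_int : Integrable (fun z => (ψ z) ^ 2) μ := by
    refine Integrable.of_bound (by fun_prop) C ?_
    filter_upwards [hball] with z hz
    exact hC z (by simpa using hz)
  rw [integral_eq_zero_iff_of_nonneg (fun z => sq_nonneg _) h_int] at h4
  filter_upwards [h4] with z hz
  exact pow_eq_zero_iff two_ne_zero |>.1 hz

/-- Positions whose noiseless range differences approach those of the source in mean square
converge to the source. -/
theorem tendsto_of_tendsto_average_sq {R : ℝ} (hb : ∀ i, ‖b i‖ ≤ R) (hball : ∀ᵐ z ∂μ, ‖z‖ ≤ R)
    (hconv : ∀ φ : Space n → ℝ, Continuous φ →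
      Tendsto (fun m => average b m φ) atTop (𝓝 (∫ z, φ z ∂μ)))
    (hfin : ∀ x, x ≠ xo → ¬ ∀ᵐ z ∂μ, rangeDiff z xo = rangeDiff z x) {x : ℕ → Space n}
    (hinf : (∃ C, ∀ᶠ m in atTop, ‖x m‖ ≤ C) ∨
      ∀ u : Space n, ‖u‖ = 1 → ¬ ∀ᵐ z ∂μ, rangeDiff z xo = - inner ℝ u z)
    (hx : Tendsto (fun m => average b m fun z => (rangeDiff z xo - rangeDiff z (x m)) ^ 2) atTop
      (𝓝 0)) :
    Tendsto x atTop (𝓝 xo) := by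
  have hR : 0 ≤ R := (norm_nonneg _).trans (hb 0)
  -- An ultrafilter replaces the extraction of subsequences: along it the positions are either
  -- eventually bounded, hence convergent, or their norms tend to infinity while their directions
  -- converge.
  rw [tendsto_iff_ultrafilter]
  intro U hU
  by_cases hbdd : ∃ C, ∀ᶠ m in U, ‖x m‖ ≤ C
  · obtain ⟨C, hC⟩ := hbdd
    obtain ⟨y, -, hy⟩ := (isCompact_closedBall (0 : Space n) C).ultrafilter_le_nhds (U.map x)
      (by
        rw [Ultrafilter.coe_map, le_principal_iff, mem_map]
        filter_upwards [hC] with m hm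
        simpa using hm)
    have hy' : Tendsto x U (𝓝 y) := hy
    suffices y = xo by rwa [← this]
    by_contra hne
    refine hfin y hne ?_
    have hδ : Tendsto (fun m => 2 * ‖x m - y‖) U (𝓝 0) := by
      have := ((hy'.sub_const y).norm).const_mul 2
      simpa using this
    have := ae_eq_zero_of_tendsto_average_sq hball hconv hU
      (φ := fun m z => rangeDiff z xo - rangeDiff z (x m))
      (ψ := fun z => rangeDiff z xo - rangeDiff z y) (by unfold rangeDiff; fun_prop) hδ
      (Eventually.of_forall fun m i => ?_) (hx.mono_left hU)
    · filter_upwards [this] with z hz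
      exact sub_eq_zero.1 hz
    · rw [sub_sub_sub_cancel_left, abs_sub_comm]
      exact abs_rangeDiff_sub_right_le _ _ _
  · exfalso
    rcases hinf with ⟨C, hC⟩ | hinf
    · exact hbdd ⟨C, hU hC⟩
    have hlarge : Tendsto (fun m => ‖x m‖) U atTop := by
      refine tendsto_atTop.2 fun C => ?_
      have : ∀ᶠ m in U, ¬ ‖x m‖ ≤ C := by
        rw [Ultrafilter.eventually_not]
        exact fun h => hbdd ⟨C, h⟩
      filter_upwards [this] with m hm
      exact (not_le.1 hm).le
    obtain ⟨u, -, hu⟩ := (isCompact_closedBall (0 : Space n) 1).ultrafilter_le_nhds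
      (U.map fun m => ‖x m‖⁻¹ • x m)
      (by
        rw [Ultrafilter.coe_map, le_principal_iff, mem_map]
        refine Filter.Eventually.of_forall fun m => ?_
        simp only [mem_closedBall_zero_iff, norm_smul, norm_inv, norm_norm]
        exact inv_mul_le_one)
    have hu' : Tendsto (fun m => ‖x m‖⁻¹ • x m) U (𝓝 u) := hu
    have hpos : ∀ᶠ m in U, 0 < ‖x m‖ := hlarge.eventually_gt_atTop 0
    have hu1 : ‖u‖ = 1 := by
      refine tendsto_nhds_unique hu'.norm (tendsto_const_nhds.congr' ?_)
      filter_upwards [hpos] with m hm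
      rw [norm_smul, norm_inv, norm_norm, inv_mul_cancel₀ hm.ne']
    refine hinf u hu1 ?_
    -- The first term bounds the second-order remainder of the norm at `x m`; the second is the cost
    -- of replacing the direction of `x m` by its limit `u`.
    have hδ : Tendsto (fun m => R ^ 2 / (2 * ‖x m‖) + ‖‖x m‖⁻¹ • x m - u‖ * R) U (𝓝 0) := by
      have h1 : Tendsto (fun m => R ^ 2 / (2 * ‖x m‖)) U (𝓝 0) :=
        (hlarge.const_mul_atTop two_pos).const_div_atTop _
      have h2 := ((hu'.sub_const u).norm).mul_const R
      simpa using h1.add h2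
    have := ae_eq_zero_of_tendsto_average_sq hball hconv hU
      (φ := fun m z => rangeDiff z xo - rangeDiff z (x m))
      (ψ := fun z => rangeDiff z xo + inner ℝ u z) (by unfold rangeDiff; fun_prop) hδ
      ?_ (hx.mono_left hU)
    · filter_upwards [this] with z hz
      linarith
    · filter_upwards [hpos] with m hm i
      have hx0 : x m ≠ 0 := norm_pos_iff.1 hm
      have h1 := abs_norm_add_sub_norm_sub_inner_le hx0 (-(b i))
      rw [norm_neg, inner_neg_right, ← sub_eq_add_neg, norm_sub_rev] at h1
      have h2 : |inner ℝ (‖x m‖⁻¹ • x m - u) (b i)| ≤ ‖‖x m‖⁻¹ • x m - u‖ * R :=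
        (abs_real_inner_le_norm _ _).trans (by gcongr; exact hb i)
      have h3 : ‖b i‖ ^ 2 / (2 * ‖x m‖) ≤ R ^ 2 / (2 * ‖x m‖) := by
        gcongr; exact hb i
      have h4 : rangeDiff (b i) xo - rangeDiff (b i) (x m) - (rangeDiff (b i) xo + inner ℝ u (b i))
          = -(‖b i - x m‖ - ‖x m‖ - -inner ℝ (x m) (b i) / ‖x m‖) +
            inner ℝ (‖x m‖⁻¹ • x m - u) (b i) := by
        rw [inner_sub_left, real_inner_smul_left, rangeDiff, rangeDiff, neg_div,
          div_eq_inv_mul]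
        ring
      rw [h4]
      refine (abs_add_le _ _).trans ?_
      rw [abs_neg]
      linarith

end Consistency

/-! ### Dyadic chaining -/

section Chaining

variable {n : ℕ}

/-- The point of the grid of mesh `2⁻ᵏ` with integer coordinates `z`. -/
def dyadicPoint (k : ℕ) (z : Fin n → ℤ) : Space n := WithLp.toLp 2 fun j => (z j : ℝ) / 2 ^ k

/-- The integer coordinates of the grid point of mesh `2⁻ᵏ` next to `h` from below. -/
def dyadicFloor (k : ℕ) (h : Space n) : Fin n → ℤ := fun j => ⌊2 ^ k * h j⌋

/-- The integer coordinates of the grid points of mesh `2⁻ᵏ` in the cube `[-1, 1]ⁿ`. -/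
def dyadicGrid (n k : ℕ) : Finset (Fin n → ℤ) :=
  Fintype.piFinset fun _ => Finset.Icc (-2 ^ k) (2 ^ k)

theorem dyadicFloor_mem_grid {h : Space n} (hh : ‖h‖ ≤ 1) (k : ℕ) :
    dyadicFloor k h ∈ dyadicGrid n k := by
  refine Fintype.mem_piFinset.2 fun j => Finset.mem_Icc.2 ?_
  have hj := abs_le.1 ((PiLp.norm_apply_le h j).trans hh)
  have h2 : (0 : ℝ) < 2 ^ k := by positivity
  constructor
  · refine Int.le_floor.2 ?_
    push_cast
    nlinarith [hj.1]
  · have : (⌊2 ^ k * h j⌋ : ℝ) ≤ 2 ^ k := (Int.floor_le _).trans (by nlinarith [hj.2])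
    exact_mod_cast this

/-- The parent of a grid point is thus a function of the point alone. A chain from `h` to the coarse
grid uses one edge per scale, and the edges at a scale are no more numerous than the finer grid
points. -/
theorem dyadicFloor_eq_div_two (k : ℕ) (h : Space n) (j : Fin n) :
    dyadicFloor k h j = dyadicFloor (k + 1) h j / 2 := by
  simp only [dyadicFloor]
  have h1 := Int.floor_le (2 ^ (k + 1) * h j)
  have h2 := Int.lt_floor_add_one (2 ^ (k + 1) * h j)
  set w := ⌊2 ^ (k + 1) * h j⌋
  have h3 : 2 * (w / 2) ≤ w := by omega
  have h4 : w + 1 ≤ 2 * (w / 2) + 2 := by omega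
  rw [Int.floor_eq_iff]
  have h3' : 2 * ((w / 2 : ℤ) : ℝ) ≤ w := by exact_mod_cast h3
  have h4' : (w : ℝ) + 1 ≤ 2 * ((w / 2 : ℤ) : ℝ) + 2 := by exact_mod_cast h4
  rw [pow_succ] at h1 h2
  constructor <;> linarith

theorem card_dyadicGrid_le (hn : n ≤ 3) (k : ℕ) :
    ((dyadicGrid n (k + 1)).card : ℝ) ≤ 512 * 8 ^ k := by
  have h1 : (dyadicGrid n (k + 1)).card ≤ (2 ^ (k + 3)) ^ n := by
    rw [dyadicGrid, Fintype.card_piFinset_const, Int.card_Icc]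
    refine Nat.pow_le_pow_left ?_ n
    zify
    have : (1 : ℤ) ≤ 2 ^ k := one_le_pow₀ (by norm_num)
    rw [Int.toNat_of_nonneg (by rw [pow_succ]; linarith), pow_succ, pow_add]
    linarith
  have h2 : (2 ^ (k + 3)) ^ n ≤ (2 ^ (k + 3)) ^ 3 := Nat.pow_le_pow_right (by positivity) hn
  have h3 : (2 ^ (k + 3)) ^ 3 = 512 * 8 ^ k := by
    rw [pow_add, mul_pow, ← pow_mul, mul_comm k 3, pow_mul]; norm_num [mul_comm]
  exact_mod_cast (h1.trans h2).trans_eq h3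

theorem norm_dyadicPoint_sub_sq_le (k : ℕ) (z : Fin n → ℤ) :
    ‖dyadicPoint (k + 1) z - dyadicPoint k fun j => z j / 2‖ ^ 2 ≤ n * (1 / 4) ^ (k + 1) := by
  rw [EuclideanSpace.real_norm_sq_eq]
  calc ∑ j, ((dyadicPoint (k + 1) z - dyadicPoint k fun j => z j / 2) j) ^ 2
      ≤ ∑ j : Fin n, (1 / 4 : ℝ) ^ (k + 1) := by
        refine Finset.sum_le_sum fun j _ => ?_
        have h1 : (dyadicPoint (k + 1) z - dyadicPoint k fun j => z j / 2) j =
            (((z j) % 2 : ℤ) : ℝ) * (1 / 2) ^ (k + 1) := by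
          have : ((z j : ℤ) : ℝ) = 2 * ((z j / 2 : ℤ) : ℝ) + ((z j % 2 : ℤ) : ℝ) := by
            exact_mod_cast (Int.mul_ediv_add_emod (z j) 2).symm
          simp only [dyadicPoint, PiLp.sub_apply]
          rw [this, one_div_pow, pow_succ]
          field_simp
          ring
        have h2 : (0 : ℝ) ≤ ((z j % 2 : ℤ) : ℝ) := by
          exact_mod_cast Int.emod_nonneg (z j) (by norm_num)
        have h3 : ((z j % 2 : ℤ) : ℝ) ≤ 1 := by
          exact_mod_cast (by omega : z j % 2 ≤ 1)
        rw [h1, mul_pow, ← pow_mul, mul_comm (k + 1) 2, pow_mul]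
        rw [show ((1 / 2 : ℝ) ^ 2) = 1 / 4 by norm_num]
        exact mul_le_of_le_one_left (by positivity) (pow_le_one₀ h2 h3)
    _ = n * (1 / 4) ^ (k + 1) := by simp

theorem tendsto_dyadicPoint_dyadicFloor (h : Space n) :
    Tendsto (fun k => dyadicPoint k (dyadicFloor k h)) atTop (𝓝 h) := by
  have h1 : Tendsto (fun k j => ((dyadicFloor k h j : ℤ) : ℝ) / 2 ^ k) atTop
      (𝓝 fun j => h j) := by
    refine tendsto_pi_nhds.2 fun j => ?_
    have h2 : Tendsto (fun k : ℕ => h j - (1 / 2) ^ k) atTop (𝓝 (h j)) := by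
      have := (tendsto_pow_atTop_nhds_zero_of_lt_one (r := (1 / 2 : ℝ)) (by norm_num)
        (by norm_num)).const_sub (h j)
      simpa using this
    refine tendsto_of_tendsto_of_tendsto_of_le_of_le h2 tendsto_const_nhds
      (fun k => ?_) (fun k => ?_)
    · have := Int.lt_floor_add_one (2 ^ k * h j)
      have h2 : (0 : ℝ) < 2 ^ k := by positivity
      simp only [dyadicFloor]
      rw [le_div_iff₀ h2, sub_mul, one_div_pow, one_div_mul_cancel h2.ne']
      linarith
    · have := Int.floor_le (2 ^ k * h j)
      have h2 : (0 : ℝ) < 2 ^ k := by positivity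
      simp only [dyadicFloor]
      rw [div_le_iff₀ h2]
      linarith
  exact ((PiLp.continuous_toLp 2 fun _ : Fin n => ℝ).tendsto _).comp h1

/-- Turns fourth moments into first moments: values below the threshold `d` cost `d`, larger ones
are dominated by their fourth power. -/
theorem le_add_pow_four_div {x d : ℝ} (hx : 0 ≤ x) (hd : 0 < d) : x ≤ d + x ^ 4 / d ^ 3 := by
  rcases le_total x d with h | h
  · have : 0 ≤ x ^ 4 / d ^ 3 := by positivity
    linarith
  · have : x ≤ x ^ 4 / d ^ 3 := by
      rw [le_div_iff₀ (by positivity)]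
      calc x * d ^ 3 ≤ x * x ^ 3 := by gcongr
        _ = x ^ 4 := by ring
    linarith

variable {Ω : Type*} {ξ : ℕ → Ω → ℝ} {κ : ℝ}

/-- The process `h ↦ ∑ i ∈ s, φ i h * ξ i`. -/
def weightedSum (ξ : ℕ → Ω → ℝ) (s : Finset ℕ) (φ : ℕ → Space n → ℝ) (ω : Ω) (h : Space n) :
    ℝ := ∑ i ∈ s, φ i h * ξ i ω

/-- The weights `φ i`, `i ∈ s`, are continuous and their increments are bounded in mean square. -/
structure SquareLipschitz (s : Finset ℕ) (φ : ℕ → Space n → ℝ) (Λ : ℝ) : Prop where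
  continuous : ∀ i, Continuous (φ i)
  sum_sq_le : ∀ h h', ∑ i ∈ s, (φ i h - φ i h') ^ 2 ≤ Λ * ‖h - h'‖ ^ 2

/-- The bound for the increments between the grids of mesh `2⁻ᵏ` and `2⁻ᵏ⁻¹`. -/
def chainingLevel (ξ : ℕ → Ω → ℝ) (s : Finset ℕ) (φ : ℕ → Space n → ℝ) (k : ℕ) (ω : Ω) : ℝ :=
  (9 / 10) ^ k + ∑ z ∈ dyadicGrid n (k + 1),
    (weightedSum ξ s φ ω (dyadicPoint (k + 1) z) -
      weightedSum ξ s φ ω (dyadicPoint k fun j => z j / 2)) ^ 4 / ((9 / 10) ^ k) ^ 3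

/-- The expectation bound for `chainingLevel`. -/
def chainingRate (κ Λ : ℝ) (k : ℕ) : ℝ :=
  (9 / 10) ^ k + 288 * κ * Λ ^ 2 * (500 / 729) ^ k

theorem weightedSum_sub (s : Finset ℕ) (φ : ℕ → Space n → ℝ) (ω : Ω) (h h' : Space n) :
    weightedSum ξ s φ ω h - weightedSum ξ s φ ω h' =
      ∑ i ∈ s, (φ i h - φ i h') * ξ i ω := by
  simp only [weightedSum, ← Finset.sum_sub_distrib, sub_mul]

/-- Summing the fourth-power terms over all edges, rather than keeping the one below `h`, makes the
bound independent of `h`. -/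
theorem abs_weightedSum_sub_le_chainingLevel {s : Finset ℕ} {φ : ℕ → Space n → ℝ} (k : ℕ)
    (ω : Ω) {h : Space n} (hh : ‖h‖ ≤ 1) :
    |weightedSum ξ s φ ω (dyadicPoint (k + 1) (dyadicFloor (k + 1) h)) -
      weightedSum ξ s φ ω (dyadicPoint k (dyadicFloor k h))| ≤ chainingLevel ξ s φ k ω := by
  have h1 : dyadicFloor k h = fun j => dyadicFloor (k + 1) h j / 2 :=
    funext fun j => dyadicFloor_eq_div_two k h j
  rw [h1]
  refine (le_add_pow_four_div (abs_nonneg _) (show (0 : ℝ) < (9 / 10) ^ k by positivity)).trans ?_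
  rw [Even.pow_abs (by decide), chainingLevel]
  gcongr
  exact Finset.single_le_sum (f := fun z => (weightedSum ξ s φ ω (dyadicPoint (k + 1) z) -
      weightedSum ξ s φ ω (dyadicPoint k fun j => z j / 2)) ^ 4 / ((9 / 10) ^ k) ^ 3)
    (fun _ _ => by positivity) (dyadicFloor_mem_grid hh (k + 1))

/-- **Chaining**: the fluctuation of the process over the cells of the grid of mesh `2⁻ᴷ`. -/
theorem ofReal_abs_weightedSum_sub_le {s : Finset ℕ} {φ : ℕ → Space n → ℝ} {Λ : ℝ}
    (hφ : SquareLipschitz s φ Λ) (K : ℕ) (ω : Ω) {h : Space n} (hh : ‖h‖ ≤ 1) :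
    ENNReal.ofReal |weightedSum ξ s φ ω h -
      weightedSum ξ s φ ω (dyadicPoint K (dyadicFloor K h))| ≤
      ∑' k, ENNReal.ofReal (chainingLevel ξ s φ (k + K) ω) := by
  set Y : ℕ → ℝ := fun k => weightedSum ξ s φ ω (dyadicPoint k (dyadicFloor k h)) with hY
  have hcont : Continuous (weightedSum ξ s φ ω) :=
    continuous_finsetSum _ fun i _ => (hφ.continuous i).mul continuous_const
  have hlim : Tendsto (fun N => Y (N + K)) atTop (𝓝 (weightedSum ξ s φ ω h)) :=
    ((hcont.tendsto h).comp (tendsto_dyadicPoint_dyadicFloor h)).comp (tendsto_add_atTop_nat K)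
  have hfin : ∀ N, |Y (N + K) - Y K| ≤
      ∑ k ∈ Finset.range N, chainingLevel ξ s φ (k + K) ω := by
    intro N
    induction N with
    | zero => simp
    | succ N ih =>
      rw [Finset.sum_range_succ]
      have h1 := abs_weightedSum_sub_le_chainingLevel (ξ := ξ) (s := s) (φ := φ) (N + K) ω hh
      have h2 : Y (N + 1 + K) - Y K = (Y (N + K) - Y K) + (Y (N + K + 1) - Y (N + K)) := by
        rw [show N + 1 + K = N + K + 1 by ring]; ring
      rw [h2]
      exact (abs_add_le _ _).trans (add_le_add ih h1)
  have hlim2 : Tendsto (fun N => ENNReal.ofReal |Y (N + K) - Y K|) atTop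
      (𝓝 (ENNReal.ofReal |weightedSum ξ s φ ω h - Y K|)) :=
    ENNReal.tendsto_ofReal ((hlim.sub_const _).abs)
  refine le_of_tendsto' hlim2 fun N => ?_
  refine (ENNReal.ofReal_le_ofReal (hfin N)).trans ?_
  rw [ENNReal.ofReal_sum_of_nonneg fun k _ => ?_]
  · exact ENNReal.sum_le_tsum _
  · exact add_nonneg (by positivity) (Finset.sum_nonneg fun _ _ => by positivity)

theorem summable_chainingRate (κ Λ : ℝ) : Summable (chainingRate κ Λ) :=
  (summable_geometric_of_lt_one (by norm_num) (by norm_num)).add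
    ((summable_geometric_of_lt_one (by norm_num) (by norm_num)).mul_left _)

/-- A majorant of the process over the unit ball, in terms of its values on the grid of
mesh `2⁻ᴷ`. -/
def chainingMajorant (ξ : ℕ → Ω → ℝ) (s : Finset ℕ) (φ : ℕ → Space n → ℝ) (K : ℕ) (ω : Ω) :
    ENNReal :=
  ∑ z ∈ dyadicGrid n K, ENNReal.ofReal |weightedSum ξ s φ ω (dyadicPoint K z)| +
    ∑' k, ENNReal.ofReal (chainingLevel ξ s φ (k + K) ω)

theorem ofReal_abs_weightedSum_le {s : Finset ℕ} {φ : ℕ → Space n → ℝ} {Λ : ℝ}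
    (hφ : SquareLipschitz s φ Λ) (K : ℕ) (ω : Ω) {h : Space n} (hh : ‖h‖ ≤ 1) :
    ENNReal.ofReal |weightedSum ξ s φ ω h| ≤ chainingMajorant ξ s φ K ω := by
  have h1 := ofReal_abs_weightedSum_sub_le (ξ := ξ) hφ K ω hh
  set y := weightedSum ξ s φ ω (dyadicPoint K (dyadicFloor K h)) with hy
  have h2 : |weightedSum ξ s φ ω h| ≤ |y| + |weightedSum ξ s φ ω h - y| := by
    have := abs_add_le y (weightedSum ξ s φ ω h - y)
    simpa using this
  refine (ENNReal.ofReal_le_ofReal h2).trans ?_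
  rw [ENNReal.ofReal_add (abs_nonneg _) (abs_nonneg _), chainingMajorant]
  refine add_le_add ?_ h1
  exact Finset.single_le_sum
    (f := fun z => ENNReal.ofReal |weightedSum ξ s φ ω (dyadicPoint K z)|)
    (fun _ _ => zero_le) (dyadicFloor_mem_grid hh K)

variable [MeasurableSpace Ω] {P : Measure Ω}

theorem FourthMomentBound.lintegral_abs_le [IsProbabilityMeasure P]
    (hξ : FourthMomentBound P ξ κ) (s : Finset ℕ)
    (c : ℕ → ℝ) {d : ℝ} (hd : 0 < d) :
    ∫⁻ ω, ENNReal.ofReal |∑ i ∈ s, c i * ξ i ω| ∂P ≤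
      ENNReal.ofReal (d + κ * (∑ i ∈ s, (c i) ^ 2) ^ 2 / d ^ 3) := by
  have hκ := hξ.nonneg
  calc ∫⁻ ω, ENNReal.ofReal |∑ i ∈ s, c i * ξ i ω| ∂P
      ≤ ∫⁻ ω, (ENNReal.ofReal d + ENNReal.ofReal (1 / d ^ 3) *
          ENNReal.ofReal ((∑ i ∈ s, c i * ξ i ω) ^ 4)) ∂P := by
        refine lintegral_mono fun ω => ?_
        rw [← ENNReal.ofReal_mul (by positivity), ← ENNReal.ofReal_add hd.le (by positivity)]
        refine ENNReal.ofReal_le_ofReal ((le_add_pow_four_div (abs_nonneg _) hd).trans_eq ?_)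
        rw [Even.pow_abs (by decide)]; ring
    _ = ENNReal.ofReal d + ENNReal.ofReal (1 / d ^ 3) *
          ∫⁻ ω, ENNReal.ofReal ((∑ i ∈ s, c i * ξ i ω) ^ 4) ∂P := by
        rw [lintegral_add_left measurable_const, lintegral_const, measure_univ, mul_one,
          lintegral_const_mul' _ _ ENNReal.ofReal_ne_top]
    _ ≤ ENNReal.ofReal d + ENNReal.ofReal (1 / d ^ 3) *
          ENNReal.ofReal (κ * (∑ i ∈ s, (c i) ^ 2) ^ 2) := by
        gcongr; exact hξ.lintegral_le s c
    _ = _ := by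
        rw [← ENNReal.ofReal_mul (by positivity), ← ENNReal.ofReal_add hd.le (by positivity)]
        congr 1; ring

theorem FourthMomentBound.lintegral_chainingLevel_le [IsProbabilityMeasure P] (hn : n ≤ 3)
    (hξ : FourthMomentBound P ξ κ)
    {s : Finset ℕ} {φ : ℕ → Space n → ℝ} {Λ : ℝ} (hΛ : 0 ≤ Λ) (hφ : SquareLipschitz s φ Λ)
    (k : ℕ) :
    ∫⁻ ω, ENNReal.ofReal (chainingLevel ξ s φ k ω) ∂P ≤ ENNReal.ofReal (chainingRate κ Λ k) := by
  have hκ := hξ.nonneg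
  have hq : (0 : ℝ) < (9 / 10) ^ k := by positivity
  have hedge : ∀ z : Fin n → ℤ, ∫⁻ ω, ENNReal.ofReal
      ((weightedSum ξ s φ ω (dyadicPoint (k + 1) z) -
      weightedSum ξ s φ ω (dyadicPoint k fun j => z j / 2)) ^ 4) ∂P ≤
        ENNReal.ofReal (κ * (Λ * (3 * (1 / 4) ^ (k + 1))) ^ 2) := by
    intro z
    simp_rw [weightedSum_sub]
    refine (hξ.lintegral_le s _).trans (ENNReal.ofReal_le_ofReal ?_)
    have h1 := hφ.sum_sq_le (dyadicPoint (k + 1) z) (dyadicPoint k fun j => z j / 2)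
    have h2 := norm_dyadicPoint_sub_sq_le k z
    have h3 : (n : ℝ) ≤ 3 := by exact_mod_cast hn
    have h4 : 0 ≤ ∑ i ∈ s,
        (φ i (dyadicPoint (k + 1) z) - φ i (dyadicPoint k fun j => z j / 2)) ^ 2 :=
      Finset.sum_nonneg fun _ _ => sq_nonneg _
    gcongr
    refine h1.trans ?_
    gcongr
    exact h2.trans (by gcongr)
  have hmeas : ∀ h, AEMeasurable (fun ω => weightedSum ξ s φ ω h) P := fun h =>
    Finset.aemeasurable_fun_sum _ fun i _ => (hξ.aemeasurable i).const_mul _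
  calc ∫⁻ ω, ENNReal.ofReal (chainingLevel ξ s φ k ω) ∂P
      = ∫⁻ ω, (ENNReal.ofReal ((9 / 10) ^ k) + ∑ z ∈ dyadicGrid n (k + 1),
          ENNReal.ofReal (1 / ((9 / 10) ^ k) ^ 3) * ENNReal.ofReal
          ((weightedSum ξ s φ ω (dyadicPoint (k + 1) z) -
            weightedSum ξ s φ ω (dyadicPoint k fun j => z j / 2)) ^ 4)) ∂P := by
        refine lintegral_congr fun ω => ?_
        rw [chainingLevel, ENNReal.ofReal_add hq.le
          (Finset.sum_nonneg fun _ _ => by positivity),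
          ENNReal.ofReal_sum_of_nonneg fun _ _ => by positivity]
        congr 1
        refine Finset.sum_congr rfl fun z _ => ?_
        rw [← ENNReal.ofReal_mul (by positivity)]
        congr 1; ring
    _ = ENNReal.ofReal ((9 / 10) ^ k) + ∑ z ∈ dyadicGrid n (k + 1),
          ENNReal.ofReal (1 / ((9 / 10) ^ k) ^ 3) * ∫⁻ ω, ENNReal.ofReal
          ((weightedSum ξ s φ ω (dyadicPoint (k + 1) z) -
            weightedSum ξ s φ ω (dyadicPoint k fun j => z j / 2)) ^ 4) ∂P := by
        rw [lintegral_add_left measurable_const, lintegral_const, measure_univ, mul_one,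
          lintegral_finsetSum']
        · simp_rw [lintegral_const_mul' _ _ ENNReal.ofReal_ne_top]
        · intro z _
          exact ((((hmeas _).sub (hmeas _)).pow_const 4).ennreal_ofReal).const_mul _
    _ ≤ ENNReal.ofReal ((9 / 10) ^ k) + ∑ z ∈ dyadicGrid n (k + 1),
          ENNReal.ofReal (1 / ((9 / 10) ^ k) ^ 3) *
            ENNReal.ofReal (κ * (Λ * (3 * (1 / 4) ^ (k + 1))) ^ 2) := by
        gcongr with z _
        exact hedge z
    _ = ENNReal.ofReal ((9 / 10) ^ k + (dyadicGrid n (k + 1)).card *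
          (1 / ((9 / 10) ^ k) ^ 3 * (κ * (Λ * (3 * (1 / 4) ^ (k + 1))) ^ 2))) := by
        rw [Finset.sum_const, nsmul_eq_mul, ← ENNReal.ofReal_mul (by positivity),
          ← ENNReal.ofReal_natCast, ← ENNReal.ofReal_mul (by positivity),
          ← ENNReal.ofReal_add (by positivity) (by positivity)]
    _ ≤ ENNReal.ofReal (chainingRate κ Λ k) := by
        refine ENNReal.ofReal_le_ofReal ?_
        rw [chainingRate]
        -- There are at most `512 · 8ᵏ` edges, each with fourth moment at most `9 κ Λ² / 16ᵏ⁺¹`, and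
        -- `512 · 9 / 16 = 288`. Division by the cubed threshold `(9/10)³ᵏ` gives the ratio `(8/16)
        -- / (729/1000) = 500/729 < 1`.
        refine add_le_add le_rfl ?_
        calc _ ≤ 512 * 8 ^ k *
              (1 / ((9 / 10) ^ k) ^ 3 * (κ * (Λ * (3 * (1 / 4) ^ (k + 1))) ^ 2)) := by
              gcongr; exact card_dyadicGrid_le hn k
          _ = 288 * κ * Λ ^ 2 * (8 ^ k * (1 / ((9 / 10) ^ k) ^ 3) * ((1 / 4) ^ k) ^ 2) := by
              rw [pow_succ]; ring
          _ = 288 * κ * Λ ^ 2 * (500 / 729) ^ k := by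
              congr 1
              rw [← pow_mul, ← pow_mul, mul_comm k 3, mul_comm k 2, pow_mul, pow_mul,
                ← one_div_pow, ← mul_pow, ← mul_pow]
              norm_num

/-- Markov's inequality is applied to the majorant, so the measurability of suprema over the ball
never has to be discussed. -/
theorem FourthMomentBound.aemeasurable_chainingMajorant (hξ : FourthMomentBound P ξ κ)
    (s : Finset ℕ) (φ : ℕ → Space n → ℝ) (K : ℕ) :
    AEMeasurable (chainingMajorant ξ s φ K) P := by
  have hmeas : ∀ h, AEMeasurable (fun ω => weightedSum ξ s φ ω h) P := fun h =>
    Finset.aemeasurable_fun_sum _ fun i _ => (hξ.aemeasurable i).const_mul _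
  refine AEMeasurable.add ?_ ?_
  · refine Finset.aemeasurable_fun_sum _ fun z _ => ?_
    exact (measurable_abs.comp_aemeasurable (hmeas _)).ennreal_ofReal
  · refine AEMeasurable.tsum fun k => AEMeasurable.ennreal_ofReal ?_
    refine AEMeasurable.const_add (Finset.aemeasurable_fun_sum _ fun z _ => ?_) _
    exact (((hmeas _).sub (hmeas _)).pow_const 4).div_const _

theorem FourthMomentBound.lintegral_chainingMajorant_le [IsProbabilityMeasure P] (hn : n ≤ 3)
    (hξ : FourthMomentBound P ξ κ) {s : Finset ℕ} {φ : ℕ → Space n → ℝ} {Λ : ℝ} (hΛ : 0 ≤ Λ)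
    (hφ : SquareLipschitz s φ Λ) (K : ℕ) {d : ℝ} (hd : 0 < d) :
    ∫⁻ ω, chainingMajorant ξ s φ K ω ∂P ≤
      ∑ z ∈ dyadicGrid n K,
        ENNReal.ofReal (d + κ * (∑ i ∈ s, (φ i (dyadicPoint K z)) ^ 2) ^ 2 / d ^ 3) +
      ∑' k, ENNReal.ofReal (chainingRate κ Λ (k + K)) := by
  have hmeas : ∀ h, AEMeasurable (fun ω => weightedSum ξ s φ ω h) P := fun h =>
    Finset.aemeasurable_fun_sum _ fun i _ => (hξ.aemeasurable i).const_mul _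
  simp only [chainingMajorant]
  rw [lintegral_add_left', lintegral_finsetSum', lintegral_tsum]
  · gcongr with z _ k
    · exact hξ.lintegral_abs_le s _ hd
    · exact hξ.lintegral_chainingLevel_le hn hΛ hφ _
  · intro k
    refine AEMeasurable.ennreal_ofReal ?_
    refine AEMeasurable.const_add (Finset.aemeasurable_fun_sum _ fun z _ => ?_) _
    exact (((hmeas _).sub (hmeas _)).pow_const 4).div_const _
  · intro z _
    exact (measurable_abs.comp_aemeasurable (hmeas _)).ennreal_ofReal
  · refine Finset.aemeasurable_fun_sum _ fun z _ => ?_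
    exact (measurable_abs.comp_aemeasurable (hmeas _)).ennreal_ofReal

/-- The processes whose weights vanish at the origin are bounded in mean on the unit ball,
uniformly in the weights. -/
theorem FourthMomentBound.exists_lintegral_chainingMajorant_le [IsProbabilityMeasure P] (hn : n ≤ 3)
    (hξ : FourthMomentBound P ξ κ) {Λ : ℝ} (hΛ : 0 ≤ Λ) :
    ∃ C : ℝ, 0 < C ∧ ∀ (s : Finset ℕ) (φ : ℕ → Space n → ℝ), SquareLipschitz s φ Λ →
      (∀ i, φ i 0 = 0) → ∫⁻ ω, chainingMajorant ξ s φ 0 ω ∂P ≤ ENNReal.ofReal C := by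
  have hκ := hξ.nonneg
  -- The case `K = 0`, `d = 1`: at the points of the unit grid the sums of squared weights are
  -- controlled by comparison with the origin, where the weights vanish.
  set B : ENNReal := ∑ z ∈ dyadicGrid n 0,
      ENNReal.ofReal (1 + κ * (Λ * ‖dyadicPoint 0 z‖ ^ 2) ^ 2 / 1 ^ 3) +
      ∑' k, ENNReal.ofReal (chainingRate κ Λ (k + 0)) with hB
  have hBtop : B ≠ ⊤ := by
    refine ENNReal.add_ne_top.2 ⟨?_, ?_⟩
    · exact ENNReal.sum_ne_top.2 fun _ _ => ENNReal.ofReal_ne_top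
    · exact (summable_chainingRate κ Λ).tsum_ofReal_ne_top
  refine ⟨B.toReal + 1, by positivity, fun s φ hφ hφ0 => ?_⟩
  refine (hξ.lintegral_chainingMajorant_le hn hΛ hφ 0 one_pos).trans (le_trans ?_
    (ENNReal.ofReal_le_ofReal (le_add_of_nonneg_right zero_le_one)))
  rw [ENNReal.ofReal_toReal hBtop]
  refine add_le_add (Finset.sum_le_sum fun z _ => ENNReal.ofReal_le_ofReal ?_) le_rfl
  have h1 := hφ.sum_sq_le (dyadicPoint 0 z) 0
  simp only [hφ0, sub_zero] at h1
  have h2 : 0 ≤ ∑ i ∈ s, (φ i (dyadicPoint 0 z)) ^ 2 := Finset.sum_nonneg fun _ _ => sq_nonneg _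
  gcongr

/-- Processes with uniformly square-Lipschitz weights that tend to zero in mean square pointwise
tend to zero uniformly on the unit ball. -/
theorem FourthMomentBound.exists_lintegral_chainingMajorant_small [IsProbabilityMeasure P]
    (hn : n ≤ 3)
    (hξ : FourthMomentBound P ξ κ) {Λ : ℝ} (hΛ : 0 ≤ Λ) {s : ℕ → Finset ℕ}
    {φ : ℕ → ℕ → Space n → ℝ} (hφ : ∀ m, SquareLipschitz (s m) (φ m) Λ)
    (hlim : ∀ h, Tendsto (fun m => ∑ i ∈ s m, (φ m i h) ^ 2) atTop (𝓝 0))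
    {ε : ENNReal} (hε : 0 < ε) :
    ∃ K, ∀ᶠ m in atTop, ∫⁻ ω, chainingMajorant ξ (s m) (φ m) K ω ∂P < ε := by
  have htail := ENNReal.tendsto_sum_nat_add (fun k => ENNReal.ofReal (chainingRate κ Λ k))
    (summable_chainingRate κ Λ).tsum_ofReal_ne_top
  obtain ⟨ε', hε', hεε'⟩ := exists_between hε
  -- The order of choice matters: `K` makes the tail of the chain small, then `d` makes the
  -- thresholds at the finitely many grid points small, and only then does `m` grow.
  obtain ⟨K, hK⟩ := (htail.eventually_lt_const hε').exists
  set N : ℝ := ((dyadicGrid n K).card : ℝ) with hN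
  have hpos : 0 < ε - ε' := tsub_pos_of_lt hεε'
  have hd : ∃ d : ℝ, 0 < d ∧ ENNReal.ofReal (N * d) < ε - ε' := by
    have h1 : Tendsto (fun d : ℝ => ENNReal.ofReal (N * d)) (𝓝[>] 0) (𝓝 0) := by
      have : Tendsto (fun d : ℝ => ENNReal.ofReal (N * d)) (𝓝 0) (𝓝 (ENNReal.ofReal (N * 0))) :=
        ENNReal.tendsto_ofReal (tendsto_id.const_mul N)
      simp only [mul_zero, ENNReal.ofReal_zero] at this
      exact this.mono_left nhdsWithin_le_nhds
    obtain ⟨d, hd1, hd2⟩ := ((h1.eventually_lt_const hpos).and self_mem_nhdsWithin).exists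
    exact ⟨d, hd2, hd1⟩
  obtain ⟨d, hd, hdN⟩ := hd
  have hgrid : Tendsto (fun m => ∑ z ∈ dyadicGrid n K, ENNReal.ofReal
      (d + κ * (∑ i ∈ s m, (φ m i (dyadicPoint K z)) ^ 2) ^ 2 / d ^ 3)) atTop
      (𝓝 (ENNReal.ofReal (N * d))) := by
    have : Tendsto (fun m => ∑ z ∈ dyadicGrid n K, ENNReal.ofReal
      (d + κ * (∑ i ∈ s m, (φ m i (dyadicPoint K z)) ^ 2) ^ 2 / d ^ 3)) atTop
      (𝓝 (∑ z ∈ dyadicGrid n K, ENNReal.ofReal (d + κ * 0 ^ 2 / d ^ 3))) :=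
      tendsto_finsetSum _ fun z _ => ENNReal.tendsto_ofReal
        (((((hlim _).pow 2).const_mul κ).div_const _).const_add d)
    convert this using 2
    rw [Finset.sum_const, nsmul_eq_mul, ← ENNReal.ofReal_natCast,
      ← ENNReal.ofReal_mul (by positivity)]
    simp [hN]
  refine ⟨K, ?_⟩
  filter_upwards [hgrid.eventually_lt_const hdN] with m hm
  refine (hξ.lintegral_chainingMajorant_le hn hΛ (hφ m) K hd).trans_lt ?_
  calc _ < (ε - ε') + ε' := ENNReal.add_lt_add hm hK
    _ = ε := tsub_add_cancel_of_le hεε'.le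

end Chaining

/-! ### First-order expansion of the range differences -/

section Expansion

variable {n : ℕ} {xo : Space n}

/-- The gradient at `xo` of the range difference to a sensor at `z`. -/
def rangeDiffGrad (xo z : Space n) : Space n := ‖xo - z‖⁻¹ • (xo - z) - ‖xo‖⁻¹ • xo

/-- The increment of the range difference from `xo` to `xo + h`. -/
def rangeDiffIncr (xo z h : Space n) : ℝ := rangeDiff z (xo + h) - rangeDiff z xo

/-- The remainder in the first-order expansion of the range difference at `xo`. -/
def rangeDiffRem (xo z h : Space n) : ℝ := rangeDiffIncr xo z h - inner ℝ (rangeDiffGrad xo z) h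

theorem norm_inv_norm_smul_le_one (y : Space n) : ‖‖y‖⁻¹ • y‖ ≤ 1 := by
  rw [norm_smul, norm_inv, norm_norm]
  exact inv_mul_le_one

theorem norm_rangeDiffGrad_le (xo z : Space n) : ‖rangeDiffGrad xo z‖ ≤ 2 := by
  refine (norm_sub_le _ _).trans ?_
  linarith [norm_inv_norm_smul_le_one (xo - z), norm_inv_norm_smul_le_one xo]

theorem abs_inner_rangeDiffGrad_le (xo z h : Space n) :
    |inner ℝ (rangeDiffGrad xo z) h| ≤ 2 * ‖h‖ :=
  (abs_real_inner_le_norm _ _).trans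
    (mul_le_mul_of_nonneg_right (norm_rangeDiffGrad_le xo z) (norm_nonneg h))

theorem abs_rangeDiffIncr_sub_le (xo z h h' : Space n) :
    |rangeDiffIncr xo z h - rangeDiffIncr xo z h'| ≤ 2 * ‖h - h'‖ := by
  have := abs_rangeDiff_sub_right_le z (xo + h) (xo + h')
  simpa [rangeDiffIncr] using this

@[simp]
theorem rangeDiffIncr_zero (xo z : Space n) : rangeDiffIncr xo z 0 = 0 := by
  simp [rangeDiffIncr]

/-- Uniform in `z`, hence usable for sensors arbitrarily close to `xo`, where the constant of the
quadratic bound `abs_rangeDiffRem_le_sq` blows up. -/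
theorem abs_rangeDiffRem_sub_le (xo z h h' : Space n) :
    |rangeDiffRem xo z h - rangeDiffRem xo z h'| ≤ 4 * ‖h - h'‖ := by
  have h1 := abs_rangeDiffIncr_sub_le xo z h h'
  have h2 := abs_inner_rangeDiffGrad_le xo z (h - h')
  have h3 : rangeDiffRem xo z h - rangeDiffRem xo z h' =
      (rangeDiffIncr xo z h - rangeDiffIncr xo z h') -
        inner ℝ (rangeDiffGrad xo z) (h - h') := by
    rw [rangeDiffRem, rangeDiffRem, inner_sub_right]; ring
  rw [h3]
  refine (abs_sub _ _).trans ?_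
  linarith

theorem abs_rangeDiffRem_le (xo z h : Space n) : |rangeDiffRem xo z h| ≤ 4 * ‖h‖ := by
  have := abs_rangeDiffRem_sub_le xo z h 0
  simpa [rangeDiffRem] using this

theorem continuous_rangeDiffIncr (xo z : Space n) : Continuous (rangeDiffIncr xo z) := by
  unfold rangeDiffIncr rangeDiff; fun_prop

theorem continuous_rangeDiffRem (xo z : Space n) : Continuous (rangeDiffRem xo z) := by
  unfold rangeDiffRem
  exact (continuous_rangeDiffIncr xo z).sub (by fun_prop)

theorem abs_rangeDiffRem_le_sq {z : Space n} (hxo : xo ≠ 0) (hz : z ≠ xo) (h : Space n) :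
    |rangeDiffRem xo z h| ≤ (1 / (2 * ‖xo - z‖) + 1 / (2 * ‖xo‖)) * ‖h‖ ^ 2 := by
  have h1 := abs_norm_add_sub_norm_sub_inner_le (sub_ne_zero.2 hz.symm) h
  have h2 := abs_norm_add_sub_norm_sub_inner_le hxo h
  have h3 : rangeDiffRem xo z h =
      (‖xo - z + h‖ - ‖xo - z‖ - inner ℝ (xo - z) h / ‖xo - z‖) -
        (‖xo + h‖ - ‖xo‖ - inner ℝ xo h / ‖xo‖) := by
    rw [rangeDiffRem, rangeDiffIncr, rangeDiff, rangeDiff, rangeDiffGrad, inner_sub_left,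
      real_inner_smul_left, real_inner_smul_left, norm_sub_rev z (xo + h), norm_sub_rev z xo,
      show xo + h - z = xo - z + h by abel]
    ring
  rw [h3]
  refine (abs_sub _ _).trans ((add_le_add h1 h2).trans_eq ?_)
  ring

theorem hasFDerivAt_rangeDiff {z : Space n} (hxo : xo ≠ 0) (hz : z ≠ xo) :
    HasFDerivAt (rangeDiff z) (innerSL ℝ (rangeDiffGrad xo z)) xo := by
  rw [hasFDerivAt_iff_isLittleO_nhds_zero]
  have h1 : (fun h => rangeDiff z (xo + h) - rangeDiff z xo - innerSL ℝ (rangeDiffGrad xo z) h)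
      =O[𝓝 0] fun h => ‖h‖ ^ 2 :=
    Asymptotics.IsBigO.of_bound (1 / (2 * ‖xo - z‖) + 1 / (2 * ‖xo‖))
      (Eventually.of_forall fun h => by
        have := abs_rangeDiffRem_le_sq hxo hz h
        simpa [rangeDiffRem, rangeDiffIncr] using this)
  exact h1.trans_isLittleO (Asymptotics.isLittleO_norm_pow_id one_lt_two)

theorem partialRangeDiff_eq {a : ℕ → Space n} {i : ℕ} (hxo : xo ≠ 0) (hz : a i ≠ xo)
    (j : Fin n) : partialRangeDiff a xo j i = rangeDiffGrad xo (a i) j := by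
  rw [partialRangeDiff, (hasFDerivAt_rangeDiff hxo hz).fderiv]
  simp [EuclideanSpace.inner_single_right]

theorem continuousAt_rangeDiffGrad {z : Space n} (hz : z ≠ xo) :
    ContinuousAt (rangeDiffGrad xo) z := by
  unfold rangeDiffGrad
  have : ‖xo - z‖ ≠ 0 := norm_ne_zero_iff.2 (sub_ne_zero.2 hz.symm)
  fun_prop (disch := assumption)

end Expansion

/-! ### Averages of functions with one discontinuity -/

section Design

variable {n : ℕ} {b : ℕ → Space n} {μ : Measure (Space n)} [IsProbabilityMeasure μ]
  {xo : Space n}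

/-- A continuous cutoff that vanishes at `xo` and equals `1` at distance `1 / (k + 1)`. -/
def cutoff (xo : Space n) (k : ℕ) (z : Space n) : ℝ := min 1 ((k + 1) * ‖z - xo‖)

theorem cutoff_nonneg (xo : Space n) (k : ℕ) (z : Space n) : 0 ≤ cutoff xo k z :=
  le_min zero_le_one (by positivity)

theorem cutoff_le_one (xo : Space n) (k : ℕ) (z : Space n) : cutoff xo k z ≤ 1 := min_le_left _ _

theorem continuous_cutoff (xo : Space n) (k : ℕ) : Continuous (cutoff xo k) := by
  unfold cutoff; fun_prop

/-- The integrand is bounded by `1` and supported in balls shrinking to the null point `xo`. It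
serves as a continuous substitute for their indicators, to which `hconv` applies. -/
theorem tendsto_integral_one_sub_cutoff (hμ : μ {xo} = 0) :
    Tendsto (fun k => ∫ z, (1 - cutoff xo k z) ∂μ) atTop (𝓝 0) := by
  have h : Tendsto (fun k => ∫ z, (1 - cutoff xo k z) ∂μ) atTop (𝓝 (∫ _, (0 : ℝ) ∂μ)) := by
    refine tendsto_integral_of_dominated_convergence (fun _ => 1) (fun k => ?_)
      (integrable_const 1) (fun k => ae_of_all _ fun z => ?_) ?_
    · exact (continuous_const.sub (continuous_cutoff xo k)).aestronglyMeasurable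
    · rw [Real.norm_eq_abs, abs_le]
      constructor <;> linarith [cutoff_nonneg xo k z, cutoff_le_one xo k z]
    · filter_upwards [compl_mem_ae_iff.2 hμ] with z hz
      have hz' : 0 < ‖z - xo‖ := norm_pos_iff.2 (sub_ne_zero.2 hz)
      refine tendsto_const_nhds.congr' ?_
      obtain ⟨N, hN⟩ := exists_nat_gt (1 / ‖z - xo‖)
      filter_upwards [eventually_ge_atTop N] with k hk
      have hk' : (N : ℝ) ≤ k := by exact_mod_cast hk
      rw [div_lt_iff₀ hz'] at hN
      rw [cutoff, min_eq_left (by nlinarith), sub_self]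
  simpa using h

/-- Bounded functions that are continuous off a null point have convergent averages. -/
theorem tendsto_average_of_continuousAt_compl
    (hconv : ∀ φ : Space n → ℝ, Continuous φ →
      Tendsto (fun m => average b m φ) atTop (𝓝 (∫ z, φ z ∂μ)))
    (hμ : μ {xo} = 0) {φ : Space n → ℝ} {C : ℝ} (hφC : ∀ z, |φ z| ≤ C)
    (hφ : ∀ z, z ≠ xo → ContinuousAt φ z) :
    AEStronglyMeasurable φ μ ∧ Tendsto (fun m => average b m φ) atTop (𝓝 (∫ z, φ z ∂μ)) := by
  have hC : 0 ≤ C := (abs_nonneg _).trans (hφC 0)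
  -- At `xo` the boundedness of `φ` and the vanishing of the cutoff suffice. The error `C (1 -
  -- cutoff)` of this replacement is small both in average and in integral.
  have hcut : ∀ k, Continuous fun z => φ z * cutoff xo k z := by
    intro k
    rw [continuous_iff_continuousAt]
    intro z
    by_cases hz : z = xo
    · subst hz
      have h0 : cutoff z k z = 0 := by simp [cutoff]
      have h1 : Tendsto (fun w => C * cutoff z k w) (𝓝 z) (𝓝 0) := by
        have := ((continuous_cutoff z k).tendsto z).const_mul C
        rwa [h0, mul_zero] at this
      rw [ContinuousAt, h0, mul_zero]
      refine squeeze_zero_norm (fun w => ?_) h1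
      rw [Real.norm_eq_abs, abs_mul, abs_of_nonneg (cutoff_nonneg z k w)]
      exact mul_le_mul_of_nonneg_right (hφC w) (cutoff_nonneg z k w)
    · exact (hφ z hz).mul (continuous_cutoff xo k).continuousAt
  have hmeas : AEStronglyMeasurable φ μ := by
    refine aestronglyMeasurable_of_tendsto_ae atTop (f := fun k z => φ z * cutoff xo k z)
      (fun k => (hcut k).aestronglyMeasurable) ?_
    filter_upwards [compl_mem_ae_iff.2 hμ] with z hz
    have hz' : 0 < ‖z - xo‖ := norm_pos_iff.2 (sub_ne_zero.2 hz)
    refine tendsto_const_nhds.congr' ?_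
    obtain ⟨N, hN⟩ := exists_nat_gt (1 / ‖z - xo‖)
    filter_upwards [eventually_ge_atTop N] with k hk
    have hk' : (N : ℝ) ≤ k := by exact_mod_cast hk
    rw [div_lt_iff₀ hz'] at hN
    rw [cutoff, min_eq_left (by nlinarith), mul_one]
  refine ⟨hmeas, ?_⟩
  have hdiff : ∀ k z, |φ z - φ z * cutoff xo k z| ≤ C * (1 - cutoff xo k z) := by
    intro k z
    have h1 : 0 ≤ 1 - cutoff xo k z := by linarith [cutoff_le_one xo k z]
    rw [← mul_one_sub, abs_mul, abs_of_nonneg h1]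
    exact mul_le_mul_of_nonneg_right (hφC z) h1
  have hint1 : Integrable φ μ := Integrable.of_bound hmeas C (ae_of_all _ hφC)
  have hint2 : ∀ k, Integrable (fun z => φ z * cutoff xo k z) μ := fun k =>
    Integrable.of_bound (hcut k).aestronglyMeasurable C (ae_of_all _ fun z => by
      rw [Real.norm_eq_abs, abs_mul, abs_of_nonneg (cutoff_nonneg xo k z)]
      exact (mul_le_mul (hφC z) (cutoff_le_one xo k z) (cutoff_nonneg xo k z) hC).trans_eq
        (mul_one C))
  have hcontc : ∀ k, Continuous fun z => 1 - cutoff xo k z := fun k =>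
    continuous_const.sub (continuous_cutoff xo k)
  have hint3 : ∀ k, Integrable (fun z => 1 - cutoff xo k z) μ := fun k =>
    Integrable.of_bound (hcontc k).aestronglyMeasurable 1 (ae_of_all _ fun z => by
      rw [Real.norm_eq_abs, abs_le]
      constructor <;> linarith [cutoff_nonneg xo k z, cutoff_le_one xo k z])
  rw [Metric.tendsto_nhds]
  intro ε hε
  have hsmall : Tendsto (fun k => C * ∫ z, (1 - cutoff xo k z) ∂μ) atTop (𝓝 0) := by
    have := (tendsto_integral_one_sub_cutoff hμ).const_mul C
    rwa [mul_zero] at this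
  obtain ⟨k, hk⟩ := (hsmall.eventually_lt_const (show 0 < ε / 4 by positivity)).exists
  have h1 := hconv _ (hcut k)
  have h2 := (hconv _ (hcontc k)).const_mul C
  filter_upwards [Metric.tendsto_nhds.1 h1 (ε / 4) (by positivity),
    h2.eventually_lt_const hk] with m hm1 hm2
  have e1 : |average b m φ - average b m fun z => φ z * cutoff xo k z| ≤
      C * average b m fun z => 1 - cutoff xo k z := by
    simp only [average]
    rw [← mul_sub, ← Finset.sum_sub_distrib, abs_mul, abs_of_nonneg (by positivity),
      mul_left_comm, Finset.mul_sum]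
    gcongr
    exact (Finset.abs_sum_le_sum_abs _ _).trans (Finset.sum_le_sum fun i _ => hdiff k (b i))
  have e2 : |∫ z, φ z * cutoff xo k z ∂μ - ∫ z, φ z ∂μ| ≤ C * ∫ z, (1 - cutoff xo k z) ∂μ := by
    rw [← integral_sub (hint2 k) hint1, ← integral_const_mul]
    refine (abs_integral_le_integral_abs).trans (integral_mono ((hint2 k).sub hint1).abs
      ((hint3 k).const_mul C) fun z => ?_)
    dsimp only
    rw [abs_sub_comm]
    exact hdiff k z
  rw [Real.dist_eq] at hm1 ⊢
  calc |average b m φ - ∫ z, φ z ∂μ|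
      = |(average b m φ - average b m fun z => φ z * cutoff xo k z) +
          ((average b m fun z => φ z * cutoff xo k z) - ∫ z, φ z * cutoff xo k z ∂μ) +
          (∫ z, φ z * cutoff xo k z ∂μ - ∫ z, φ z ∂μ)| := by congr 1; ring
    _ ≤ _ := abs_add_three _ _ _
    _ < ε := by linarith

/-- The averages of the squared remainders are negligible for small increments. -/
theorem average_rangeDiffRem_sq_le
    (hconv : ∀ φ : Space n → ℝ, Continuous φ →
      Tendsto (fun m => average b m φ) atTop (𝓝 (∫ z, φ z ∂μ)))
    (hμ : μ {xo} = 0) (hxo : xo ≠ 0) (hb : ∀ i, b i ≠ xo) {ε : ℝ} (hε : 0 < ε) :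
    ∃ δ > 0, ∀ᶠ m in atTop, ∀ h : Space n, ‖h‖ ≤ δ →
      average b m (fun z => (rangeDiffRem xo z h) ^ 2) ≤ ε * ‖h‖ ^ 2 := by
  obtain ⟨k, hk⟩ := ((tendsto_integral_one_sub_cutoff hμ).eventually_lt_const
    (show 0 < ε / 64 by positivity)).exists
  have h1 := hconv (fun z => 1 - cutoff xo k z)
    (continuous_const.sub (continuous_cutoff xo k))
  have hxo' : 0 < ‖xo‖ := norm_pos_iff.2 hxo
  set D : ℝ := (k + 1) + 1 / (2 * ‖xo‖) with hD
  have hD0 : 0 < D := by positivity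
  refine ⟨√(ε / 2) / D, by positivity, ?_⟩
  filter_upwards [h1.eventually_lt_const hk, eventually_gt_atTop 0] with m hm hm0 h hh
  have hm' : (m : ℝ) ≠ 0 := by exact_mod_cast hm0.ne'
  -- Near sensors (cutoff at most `1/2`) satisfy `16‖h‖² ≤ 32‖h‖² (1 - cutoff)`. For the others `‖xo
  -- - b i‖ > 1 / (2 (k + 1))`, so the quadratic bound holds with the constant `D`.
  have hpt : ∀ i, (rangeDiffRem xo (b i) h) ^ 2 ≤
      32 * ‖h‖ ^ 2 * (1 - cutoff xo k (b i)) + ε / 2 * ‖h‖ ^ 2 := by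
    intro i
    have hc : 0 ≤ 1 - cutoff xo k (b i) := by linarith [cutoff_le_one xo k (b i)]
    by_cases hfar : cutoff xo k (b i) ≤ 1 / 2
    · have h2 : (rangeDiffRem xo (b i) h) ^ 2 ≤ (4 * ‖h‖) ^ 2 :=
        sq_le_sq.2 ((abs_rangeDiffRem_le xo (b i) h).trans (le_abs_self _))
      have h3 : 0 ≤ ε / 2 * ‖h‖ ^ 2 := by positivity
      nlinarith [sq_nonneg ‖h‖]
    · have h2 : 1 / 2 < (k + 1) * ‖xo - b i‖ := by
        rw [norm_sub_rev]
        exact (not_le.1 hfar).trans_le (min_le_right _ _)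
      have hpos : 0 < ‖xo - b i‖ := norm_pos_iff.2 (sub_ne_zero.2 (hb i).symm)
      have h3 : 1 / (2 * ‖xo - b i‖) ≤ k + 1 := by
        rw [div_le_iff₀ (by positivity)]; linarith
      have h4 : |rangeDiffRem xo (b i) h| ≤ √(ε / 2) * ‖h‖ := by
        refine (abs_rangeDiffRem_le_sq hxo (hb i) h).trans ?_
        calc (1 / (2 * ‖xo - b i‖) + 1 / (2 * ‖xo‖)) * ‖h‖ ^ 2 ≤ D * ‖h‖ ^ 2 := by
              gcongr; rw [hD]; linarith
          _ = D * ‖h‖ * ‖h‖ := by ring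
          _ ≤ √(ε / 2) * ‖h‖ := by
              gcongr
              rwa [le_div_iff₀ hD0, mul_comm] at hh
      have h5 : (rangeDiffRem xo (b i) h) ^ 2 ≤ (√(ε / 2) * ‖h‖) ^ 2 :=
        sq_le_sq.2 (h4.trans (le_abs_self _))
      rw [mul_pow, Real.sq_sqrt (by positivity)] at h5
      have h6 : 0 ≤ 32 * ‖h‖ ^ 2 * (1 - cutoff xo k (b i)) := by positivity
      linarith
  calc average b m (fun z => (rangeDiffRem xo z h) ^ 2)
      ≤ average b m (fun z => 32 * ‖h‖ ^ 2 * (1 - cutoff xo k z) + ε / 2 * ‖h‖ ^ 2) :=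
        average_mono hpt
    _ = 32 * ‖h‖ ^ 2 * average b m (fun z => 1 - cutoff xo k z) + ε / 2 * ‖h‖ ^ 2 := by
        simp only [average, Finset.sum_add_distrib, ← Finset.mul_sum, Finset.sum_const,
          Finset.card_range, nsmul_eq_mul]
        field_simp
    _ ≤ 32 * ‖h‖ ^ 2 * (ε / 64) + ε / 2 * ‖h‖ ^ 2 := by gcongr
    _ = ε * ‖h‖ ^ 2 := by ring

/-- The matrix of second moments of the gradients at `xo`. -/
def gramMatrix (μ : Measure (Space n)) (xo : Space n) : Matrix (Fin n) (Fin n) ℝ :=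
  Matrix.of fun j k => ∫ z, rangeDiffGrad xo z j * rangeDiffGrad xo z k ∂μ

theorem abs_rangeDiffGrad_apply_le (xo z : Space n) (j : Fin n) : |rangeDiffGrad xo z j| ≤ 2 :=
  (PiLp.norm_apply_le (rangeDiffGrad xo z) j).trans (norm_rangeDiffGrad_le xo z)

theorem tendsto_average_rangeDiffGrad_mul
    (hconv : ∀ φ : Space n → ℝ, Continuous φ →
      Tendsto (fun m => average b m φ) atTop (𝓝 (∫ z, φ z ∂μ)))
    (hμ : μ {xo} = 0) (j k : Fin n) :
    Tendsto (fun m => average b m fun z => rangeDiffGrad xo z j * rangeDiffGrad xo z k) atTop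
      (𝓝 (gramMatrix μ xo j k)) := by
  refine (tendsto_average_of_continuousAt_compl hconv hμ (C := 2 * 2) (fun z => ?_)
    fun z hz => ?_).2
  · rw [abs_mul]
    exact mul_le_mul (abs_rangeDiffGrad_apply_le xo z j) (abs_rangeDiffGrad_apply_le xo z k)
      (abs_nonneg _) (by norm_num)
  · have hc : ∀ j, ContinuousAt (fun z => rangeDiffGrad xo z j) z := fun j =>
      (EuclideanSpace.proj (𝕜 := ℝ) j).continuous.continuousAt.comp
        (continuousAt_rangeDiffGrad hz)
    exact (hc j).mul (hc k)

theorem average_inner_rangeDiffGrad_sq (m : ℕ) (h : Space n) :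
    average b m (fun z => (inner ℝ (rangeDiffGrad xo z) h) ^ 2) =
      ∑ j, ∑ k, h j * h k *
        average b m fun z => rangeDiffGrad xo z j * rangeDiffGrad xo z k := by
  have h1 : ∀ z, (inner ℝ (rangeDiffGrad xo z) h) ^ 2 =
      ∑ j, ∑ k, h j * h k * (rangeDiffGrad xo z j * rangeDiffGrad xo z k) := by
    intro z
    rw [sq, PiLp.inner_apply, Finset.sum_mul_sum]
    refine Finset.sum_congr rfl fun j _ => Finset.sum_congr rfl fun k _ => ?_
    simp only [RCLike.inner_apply, conj_trivial]
    ring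
  simp only [average, h1]
  rw [Finset.sum_comm, Finset.mul_sum]
  refine Finset.sum_congr rfl fun j _ => ?_
  rw [Finset.sum_comm, Finset.mul_sum]
  refine Finset.sum_congr rfl fun k _ => ?_
  rw [← Finset.mul_sum]
  ring

/-- The quadratic form of `gramMatrix`. -/
def gramForm (μ : Measure (Space n)) (xo h : Space n) : ℝ :=
  ∑ j, ∑ k, h j * h k * gramMatrix μ xo j k

theorem tendsto_average_inner_rangeDiffGrad_sq
    (hconv : ∀ φ : Space n → ℝ, Continuous φ →
      Tendsto (fun m => average b m φ) atTop (𝓝 (∫ z, φ z ∂μ)))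
    (hμ : μ {xo} = 0) (h : Space n) :
    Tendsto (fun m => average b m fun z => (inner ℝ (rangeDiffGrad xo z) h) ^ 2) atTop
      (𝓝 (gramForm μ xo h)) := by
  simp_rw [average_inner_rangeDiffGrad_sq]
  exact tendsto_finsetSum _ fun j _ => tendsto_finsetSum _ fun k _ =>
    (tendsto_average_rangeDiffGrad_mul hconv hμ j k).const_mul _

/-- Uniformity in `h` comes from the finitely many matrix entries and `|h j * h k| ≤ ‖h‖²`. -/
theorem abs_average_inner_rangeDiffGrad_sq_sub_le
    (hconv : ∀ φ : Space n → ℝ, Continuous φ →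
      Tendsto (fun m => average b m φ) atTop (𝓝 (∫ z, φ z ∂μ)))
    (hμ : μ {xo} = 0) {ε : ℝ} (hε : 0 < ε) :
    ∀ᶠ m in atTop, ∀ h : Space n,
      |average b m (fun z => (inner ℝ (rangeDiffGrad xo z) h) ^ 2) - gramForm μ xo h| ≤
        ε * ‖h‖ ^ 2 := by
  have hlim : Tendsto (fun m => ∑ j, ∑ k,
      |(average b m fun z => rangeDiffGrad xo z j * rangeDiffGrad xo z k) -
        gramMatrix μ xo j k|) atTop (𝓝 0) := by
    have : Tendsto (fun m => ∑ j, ∑ k,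
      |(average b m fun z => rangeDiffGrad xo z j * rangeDiffGrad xo z k) -
        gramMatrix μ xo j k|) atTop (𝓝 (∑ j : Fin n, ∑ k : Fin n,
          |gramMatrix μ xo j k - gramMatrix μ xo j k|)) :=
      tendsto_finsetSum _ fun j _ => tendsto_finsetSum _ fun k _ =>
        ((tendsto_average_rangeDiffGrad_mul hconv hμ j k).sub_const _).abs
    simpa using this
  filter_upwards [hlim.eventually_lt_const hε] with m hm h
  rw [average_inner_rangeDiffGrad_sq, gramForm, ← Finset.sum_sub_distrib]
  simp_rw [← Finset.sum_sub_distrib, ← mul_sub]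
  calc _ ≤ ∑ j, ∑ k, ‖h‖ ^ 2 *
        |(average b m fun z => rangeDiffGrad xo z j * rangeDiffGrad xo z k) -
          gramMatrix μ xo j k| := by
        refine (Finset.abs_sum_le_sum_abs _ _).trans (Finset.sum_le_sum fun j _ => ?_)
        refine (Finset.abs_sum_le_sum_abs _ _).trans (Finset.sum_le_sum fun k _ => ?_)
        rw [abs_mul, abs_mul, sq]
        gcongr
        · exact PiLp.norm_apply_le h j
        · exact PiLp.norm_apply_le h k
    _ = (∑ j, ∑ k, |(average b m fun z => rangeDiffGrad xo z j * rangeDiffGrad xo z k) -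
          gramMatrix μ xo j k|) * ‖h‖ ^ 2 := by
        simp_rw [← Finset.mul_sum]; ring
    _ ≤ ε * ‖h‖ ^ 2 := by gcongr

/-- The averages of the squared increments are asymptotically given by the quadratic form of
`gramMatrix`. -/
theorem abs_average_rangeDiffIncr_sq_sub_le
    (hconv : ∀ φ : Space n → ℝ, Continuous φ →
      Tendsto (fun m => average b m φ) atTop (𝓝 (∫ z, φ z ∂μ)))
    (hμ : μ {xo} = 0) (hxo : xo ≠ 0) (hb : ∀ i, b i ≠ xo) {ε : ℝ} (hε : 0 < ε) :
    ∃ δ > 0, ∀ᶠ m in atTop, ∀ h : Space n, ‖h‖ ≤ δ →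
      |average b m (fun z => (rangeDiffIncr xo z h) ^ 2) - gramForm μ xo h| ≤ ε * ‖h‖ ^ 2 := by
  -- The weight in `|2pρ| ≤ t p² + ρ² / t`: since `p² ≤ 4‖h‖²`, the first term costs `4t‖h‖² = (ε /
  -- 3)‖h‖²`.
  set t : ℝ := ε / 12 with ht
  have ht0 : 0 < t := by positivity
  obtain ⟨δ, hδ, hrem⟩ := average_rangeDiffRem_sq_le hconv hμ hxo hb
    (show 0 < ε / 3 / (1 + 1 / t) by positivity)
  refine ⟨δ, hδ, ?_⟩
  filter_upwards [hrem, abs_average_inner_rangeDiffGrad_sq_sub_le hconv hμ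
    (show 0 < ε / 3 by positivity), eventually_gt_atTop 0] with m hm1 hm2 hm0 h hh
  have hm' : (m : ℝ) ≠ 0 := by exact_mod_cast hm0.ne'
  have h1 := hm1 h hh
  have h2 := hm2 h
  have hpt : ∀ i, |(rangeDiffIncr xo (b i) h) ^ 2 - (inner ℝ (rangeDiffGrad xo (b i)) h) ^ 2| ≤
      4 * t * ‖h‖ ^ 2 + (1 + 1 / t) * (rangeDiffRem xo (b i) h) ^ 2 := by
    intro i
    set p : ℝ := inner ℝ (rangeDiffGrad xo (b i)) h with hp
    set ρ := rangeDiffRem xo (b i) h with hρ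
    have hincr : rangeDiffIncr xo (b i) h = p + ρ := by rw [hρ, rangeDiffRem]; ring
    have hp2 : p ^ 2 ≤ (2 * ‖h‖) ^ 2 :=
      sq_le_sq.2 ((abs_inner_rangeDiffGrad_le xo (b i) h).trans (le_abs_self _))
    have hcross : |2 * p * ρ| ≤ t * p ^ 2 + 1 / t * ρ ^ 2 := by
      rw [abs_le]
      have e1 : 0 ≤ (t * p + ρ) ^ 2 / t := by positivity
      have e2 : 0 ≤ (t * p - ρ) ^ 2 / t := by positivity
      have e3 : (t * p + ρ) ^ 2 / t = t * p ^ 2 + 2 * p * ρ + 1 / t * ρ ^ 2 := by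
        field_simp; ring
      have e4 : (t * p - ρ) ^ 2 / t = t * p ^ 2 - 2 * p * ρ + 1 / t * ρ ^ 2 := by
        field_simp; ring
      constructor <;> linarith
    rw [hincr, show (p + ρ) ^ 2 - p ^ 2 = 2 * p * ρ + ρ ^ 2 by ring]
    refine (abs_add_le _ _).trans ?_
    rw [abs_of_nonneg (sq_nonneg ρ)]
    nlinarith
  have h3 : |average b m (fun z => (rangeDiffIncr xo z h) ^ 2) -
      average b m (fun z => (inner ℝ (rangeDiffGrad xo z) h) ^ 2)| ≤
      4 * t * ‖h‖ ^ 2 + (1 + 1 / t) * average b m (fun z => (rangeDiffRem xo z h) ^ 2) := by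
    calc _ ≤ average b m (fun z => 4 * t * ‖h‖ ^ 2 + (1 + 1 / t) * (rangeDiffRem xo z h) ^ 2) := by
          simp only [average]
          rw [← mul_sub, ← Finset.sum_sub_distrib, abs_mul, abs_of_nonneg (by positivity)]
          gcongr
          exact (Finset.abs_sum_le_sum_abs _ _).trans (Finset.sum_le_sum fun i _ => hpt i)
      _ = _ := by
          simp only [average, Finset.sum_add_distrib, ← Finset.mul_sum, Finset.sum_const,
            Finset.card_range, nsmul_eq_mul]
          field_simp
  have h4 : (1 + 1 / t) * average b m (fun z => (rangeDiffRem xo z h) ^ 2) ≤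
      ε / 3 * ‖h‖ ^ 2 := by
    calc _ ≤ (1 + 1 / t) * (ε / 3 / (1 + 1 / t) * ‖h‖ ^ 2) := by gcongr
      _ = ε / 3 * ‖h‖ ^ 2 := by field_simp
  calc _ ≤ _ := abs_sub_le _ (average b m fun z => (inner ℝ (rangeDiffGrad xo z) h) ^ 2) _
    _ ≤ ε * ‖h‖ ^ 2 := by
      have h5 : 4 * t * ‖h‖ ^ 2 = ε / 3 * ‖h‖ ^ 2 := by rw [ht]; ring
      linarith

theorem gramForm_pos (hn : 2 ≤ n)
    (hconv : ∀ φ : Space n → ℝ, Continuous φ →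
      Tendsto (fun m => average b m φ) atTop (𝓝 (∫ z, φ z ∂μ)))
    (hμ : μ {xo} = 0) (hxo : xo ≠ 0)
    (h_hyperplane : ∀ S : Set (Space n), IsHyperplane S → μ S ≠ 1)
    (h_cone : ∀ S, IsConeWithVertex xo S → (0 : Space n) ∈ S → μ S ≠ 1)
    {h : Space n} (hh : h ≠ 0) : 0 < gramForm μ xo h := by
  obtain ⟨hmeas, hlim⟩ := tendsto_average_of_continuousAt_compl hconv hμ
    (φ := fun z => (inner ℝ (rangeDiffGrad xo z) h) ^ 2) (C := (2 * ‖h‖) ^ 2)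
    (fun z => by
      rw [abs_of_nonneg (sq_nonneg _)]
      exact sq_le_sq.2 ((abs_inner_rangeDiffGrad_le xo z h).trans (le_abs_self _)))
    (fun z hz =>
      (ContinuousAt.inner (𝕜 := ℝ) (continuousAt_rangeDiffGrad hz) continuousAt_const).pow 2)
  rw [tendsto_nhds_unique (tendsto_average_inner_rangeDiffGrad_sq hconv hμ h) hlim]
  refine (integral_nonneg fun z => sq_nonneg _).lt_of_ne' fun h0 => ?_
  have h_int : Integrable (fun z => (inner ℝ (rangeDiffGrad xo z) h) ^ 2) μ :=
    Integrable.of_bound hmeas ((2 * ‖h‖) ^ 2) (ae_of_all _ fun z => by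
      rw [Real.norm_eq_abs, abs_of_nonneg (sq_nonneg _)]
      exact sq_le_sq.2 ((abs_inner_rangeDiffGrad_le xo z h).trans (le_abs_self _)))
  rw [integral_eq_zero_iff_of_nonneg (fun z => sq_nonneg _) h_int] at h0
  have hxo' : ‖xo‖ ≠ 0 := norm_ne_zero_iff.2 hxo
  have hh' : ‖h‖ ≠ 0 := norm_ne_zero_iff.2 hh
  -- Orthogonality of the gradient to `h` says that `xo - z` makes with `h` the same angle as `xo`
  -- does; `c` is the cosine of this angle.
  refine not_ae_inner_eq_mul_norm (μ := μ) (xo := xo) hn h_hyperplane h_cone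
    (v := ‖h‖⁻¹ • h) (c := inner ℝ (‖h‖⁻¹ • h) xo / ‖xo‖) ?_ ?_ hxo ?_
  · rw [norm_smul, norm_inv, norm_norm, inv_mul_cancel₀ hh']
  · rw [div_mul_cancel₀ _ hxo']
  · filter_upwards [h0] with z hz
    by_cases hzx : z = xo
    · simp [hzx]
    have hz' : ‖xo - z‖ ≠ 0 := norm_ne_zero_iff.2 (sub_ne_zero.2 (Ne.symm hzx))
    have h1 : inner ℝ (rangeDiffGrad xo z) h = 0 := pow_eq_zero_iff two_ne_zero |>.1 hz
    rw [rangeDiffGrad, inner_sub_left, real_inner_smul_left, real_inner_smul_left,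
      real_inner_comm, real_inner_comm h xo, sub_eq_zero] at h1
    rw [real_inner_smul_left, real_inner_smul_left]
    field_simp
    field_simp at h1
    linarith

end Design

/-! ### Positive definiteness and coercivity of the Gram form -/

section GramForm

variable {n : ℕ} {μ : Measure (Space n)} {xo : Space n}

theorem gramForm_eq_inner (h : Space n) :
    gramForm μ xo h = inner ℝ h (Matrix.toEuclideanCLM (𝕜 := ℝ) (gramMatrix μ xo) h) := by
  rw [Matrix.inner_toEuclideanCLM, gramForm]
  simp only [dotProduct, Matrix.mulVec, Finset.mul_sum]
  exact Finset.sum_congr rfl fun j _ => Finset.sum_congr rfl fun k _ => by ring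

theorem gramMatrix_posDef (hpos : ∀ h : Space n, h ≠ 0 → 0 < gramForm μ xo h) :
    (gramMatrix μ xo).PosDef := by
  refine Matrix.PosDef.of_dotProduct_mulVec_pos ?_ fun x hx => ?_
  · ext j k
    simp [gramMatrix, mul_comm]
  · have h1 := hpos (WithLp.toLp 2 x) (by simpa using hx)
    rw [gramForm_eq_inner, Matrix.inner_toEuclideanCLM] at h1
    simpa using h1

theorem exists_gramForm_ge (hpos : ∀ h : Space n, h ≠ 0 → 0 < gramForm μ xo h) :
    ∃ c > 0, ∀ h : Space n, c * ‖h‖ ^ 2 ≤ gramForm μ xo h := by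
  have hcont : Continuous (gramForm μ xo) := by unfold gramForm; fun_prop
  have hhom : ∀ (t : ℝ) (h : Space n), gramForm μ xo (t • h) = t ^ 2 * gramForm μ xo h := by
    intro t h
    simp only [gramForm, PiLp.smul_apply, smul_eq_mul, Finset.mul_sum]
    exact Finset.sum_congr rfl fun j _ => Finset.sum_congr rfl fun k _ => by ring
  -- The sphere is empty only for `n = 0`. Otherwise `c` is the minimum on the sphere, extended by
  -- homogeneity.
  rcases (Metric.sphere (0 : Space n) 1).eq_empty_or_nonempty with he | hne
  · refine ⟨1, one_pos, fun h => ?_⟩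
    have : h = 0 := by
      by_contra h0
      have : ‖h‖⁻¹ • h ∈ Metric.sphere (0 : Space n) 1 := by
        rw [mem_sphere_zero_iff_norm, norm_smul, norm_inv, norm_norm,
          inv_mul_cancel₀ (norm_ne_zero_iff.2 h0)]
      rw [he] at this
      exact this
    simp [this, gramForm]
  · obtain ⟨y, hy, hmin⟩ := (isCompact_sphere (0 : Space n) 1).exists_isMinOn hne
      hcont.continuousOn
    have hy0 : y ≠ 0 := by
      rintro rfl
      simp at hy
    refine ⟨gramForm μ xo y, hpos y hy0, fun h => ?_⟩
    by_cases h0 : h = 0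
    · simp [h0, gramForm]
    have hn0 : ‖h‖ ≠ 0 := norm_ne_zero_iff.2 h0
    have hmem : ‖h‖⁻¹ • h ∈ Metric.sphere (0 : Space n) 1 := by
      rw [mem_sphere_zero_iff_norm, norm_smul, norm_inv, norm_norm, inv_mul_cancel₀ hn0]
    have h1 : gramForm μ xo y ≤ gramForm μ xo (‖h‖⁻¹ • h) := hmin hmem
    rw [hhom, inv_pow] at h1
    calc gramForm μ xo y * ‖h‖ ^ 2 ≤ (‖h‖ ^ 2)⁻¹ * gramForm μ xo h * ‖h‖ ^ 2 := by gcongr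
      _ = gramForm μ xo h := by field_simp

end GramForm

/-! ### Localization of the least-squares objective -/

section Local

variable {n : ℕ} {b : ℕ → Space n} {xo : Space n} {Ω : Type*} {ξ : ℕ → Ω → ℝ}

/-- The noise term of the objective at the local parameter `s`. -/
def localNoise (b : ℕ → Space n) (xo : Space n) (ξ : ℕ → Ω → ℝ) (m : ℕ) (ω : Ω) (s : Space n) :
    ℝ := ∑ i ∈ Finset.range m, rangeDiffIncr xo (b i) ((√(m : ℝ))⁻¹ • s) * ξ i ω

/-- The signal term of the objective at the local parameter `s`. -/
def localSignal (b : ℕ → Space n) (xo : Space n) (m : ℕ) (s : Space n) : ℝ :=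
  ∑ i ∈ Finset.range m, (rangeDiffIncr xo (b i) ((√(m : ℝ))⁻¹ • s)) ^ 2

/-- The score: the rescaled gradient of the noise term at the source. -/
def score (b : ℕ → Space n) (xo : Space n) (ξ : ℕ → Ω → ℝ) (m : ℕ) (ω : Ω) : Space n :=
  ∑ i ∈ Finset.range m, ((√(m : ℝ))⁻¹ * ξ i ω) • rangeDiffGrad xo (b i)

/-- The objective at the local parameter `s`, minus its value at the source, times `m`. -/
def localExcess (b : ℕ → Space n) (xo : Space n) (ξ : ℕ → Ω → ℝ) (m : ℕ) (ω : Ω) (s : Space n) :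
    ℝ := localSignal b xo m s - 2 * localNoise b xo ξ m ω s

theorem localNoise_eq (m : ℕ) (ω : Ω) (s : Space n) :
    localNoise b xo ξ m ω s = inner ℝ (score b xo ξ m ω) s +
      ∑ i ∈ Finset.range m, rangeDiffRem xo (b i) ((√(m : ℝ))⁻¹ • s) * ξ i ω := by
  rw [localNoise, score, sum_inner, ← Finset.sum_add_distrib]
  refine Finset.sum_congr rfl fun i _ => ?_
  rw [rangeDiffRem, real_inner_smul_left, real_inner_smul_right]
  ring

/-- Each of the `m` squared increments carries a factor `1 / m` from the scale `r / √m`, so the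
constant is free of `m`. With `t = 1 / r` it is also free of `r`, which is what allows all dyadic
shells to be treated alike. -/
theorem squareLipschitz_rescale {ψ : ℕ → Space n → ℝ} {L : ℝ}
    (hL : ∀ i h h', |ψ i h - ψ i h'| ≤ L * ‖h - h'‖) (hψ : ∀ i, Continuous (ψ i)) (m : ℕ)
    (t r : ℝ) :
    SquareLipschitz (Finset.range m) (fun i s => t * ψ i ((r / √(m : ℝ)) • s))
      ((t * L * r) ^ 2) := by
  refine ⟨fun i => continuous_const.mul ((hψ i).comp (continuous_const_smul _)), fun s s' => ?_⟩
  rcases Nat.eq_zero_or_pos m with rfl | hm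
  · simp; positivity
  have hm' : (0 : ℝ) < m := by exact_mod_cast hm
  have hterm : ∀ i, (t * ψ i ((r / √(m : ℝ)) • s) - t * ψ i ((r / √(m : ℝ)) • s')) ^ 2 ≤
      (t * L * r) ^ 2 * ‖s - s'‖ ^ 2 / m := by
    intro i
    have h1 := hL i ((r / √(m : ℝ)) • s) ((r / √(m : ℝ)) • s')
    rw [← smul_sub, norm_smul] at h1
    have h2 : (ψ i ((r / √(m : ℝ)) • s) - ψ i ((r / √(m : ℝ)) • s')) ^ 2 ≤
        (L * (‖r / √(m : ℝ)‖ * ‖s - s'‖)) ^ 2 := sq_le_sq.2 (h1.trans (le_abs_self _))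
    rw [← mul_sub, mul_pow]
    calc _ ≤ t ^ 2 * (L * (‖r / √(m : ℝ)‖ * ‖s - s'‖)) ^ 2 := by gcongr
      _ = _ := by
        rw [mul_pow L, mul_pow ‖r / √(m : ℝ)‖, Real.norm_eq_abs, sq_abs, div_pow,
          Real.sq_sqrt hm'.le]
        ring
  calc _ ≤ ∑ i ∈ Finset.range m, (t * L * r) ^ 2 * ‖s - s'‖ ^ 2 / m :=
        Finset.sum_le_sum fun i _ => hterm i
    _ = (t * L * r) ^ 2 * ‖s - s'‖ ^ 2 := by
        rw [Finset.sum_const, Finset.card_range, nsmul_eq_mul]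
        field_simp

variable {μ : Measure (Space n)} [IsProbabilityMeasure μ]

theorem gramForm_smul {μ : Measure (Space n)} (t : ℝ) (h : Space n) :
    gramForm μ xo (t • h) = t ^ 2 * gramForm μ xo h := by
  simp only [gramForm, PiLp.smul_apply, smul_eq_mul, Finset.mul_sum]
  exact Finset.sum_congr rfl fun j _ => Finset.sum_congr rfl fun k _ => by ring

theorem abs_localSignal_sub_gramForm_le
    (hconv : ∀ φ : Space n → ℝ, Continuous φ →
      Tendsto (fun m => average b m φ) atTop (𝓝 (∫ z, φ z ∂μ)))
    (hμ : μ {xo} = 0) (hxo : xo ≠ 0) (hb : ∀ i, b i ≠ xo) {ε : ℝ} (hε : 0 < ε) :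
    ∃ δ > 0, ∀ᶠ m : ℕ in atTop, ∀ s : Space n, ‖s‖ ≤ δ * √(m : ℝ) →
      |localSignal b xo m s - gramForm μ xo s| ≤ ε * ‖s‖ ^ 2 := by
  obtain ⟨δ, hδ, h⟩ := abs_average_rangeDiffIncr_sq_sub_le hconv hμ hxo hb hε
  refine ⟨δ, hδ, ?_⟩
  filter_upwards [h, eventually_gt_atTop 0] with m hm hm0 s hs
  have hm' : (0 : ℝ) < m := by exact_mod_cast hm0
  have hsq : 0 < √(m : ℝ) := Real.sqrt_pos.2 hm'
  have hnorm : ‖(√(m : ℝ))⁻¹ • s‖ = (√(m : ℝ))⁻¹ * ‖s‖ := by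
    rw [norm_smul, norm_inv, Real.norm_of_nonneg hsq.le]
  have h1 := hm ((√(m : ℝ))⁻¹ • s) (by rw [hnorm, inv_mul_le_iff₀ hsq, mul_comm]; exact hs)
  rw [hnorm, gramForm_smul, mul_pow, inv_pow, Real.sq_sqrt hm'.le, average, ← mul_sub, abs_mul,
    abs_of_pos (inv_pos.2 hm'), mul_left_comm] at h1
  exact le_of_mul_le_mul_left h1 (inv_pos.2 hm')

/-- The sum is `m` times an average that is `o(‖h‖² / m)`. This pointwise convergence is the input
of `FourthMomentBound.exists_lintegral_chainingMajorant_small`. -/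
theorem tendsto_sum_rangeDiffRem_sq
    (hconv : ∀ φ : Space n → ℝ, Continuous φ →
      Tendsto (fun m => average b m φ) atTop (𝓝 (∫ z, φ z ∂μ)))
    (hμ : μ {xo} = 0) (hxo : xo ≠ 0) (hb : ∀ i, b i ≠ xo) (r : ℝ) (h : Space n) :
    Tendsto (fun m : ℕ => ∑ i ∈ Finset.range m,
      (rangeDiffRem xo (b i) ((r / √(m : ℝ)) • h)) ^ 2) atTop (𝓝 0) := by
  rw [Metric.tendsto_nhds]
  intro ε hε
  set A : ℝ := r ^ 2 * ‖h‖ ^ 2 + 1 with hA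
  have hA0 : 0 < A := by positivity
  obtain ⟨δ, hδ, hrem⟩ := average_rangeDiffRem_sq_le hconv hμ hxo hb
    (show 0 < ε / A by positivity)
  have hlim : Tendsto (fun m : ℕ => ‖(r / √(m : ℝ)) • h‖) atTop (𝓝 0) := by
    have h1 : Tendsto (fun m : ℕ => r / √(m : ℝ)) atTop (𝓝 0) :=
      (Real.tendsto_sqrt_atTop.comp tendsto_natCast_atTop_atTop).const_div_atTop r
    have h2 := (h1.smul_const h).norm
    simpa using h2
  filter_upwards [hrem, hlim.eventually_le_const hδ, eventually_gt_atTop 0] with m hm hmδ hm0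
  have hm' : (0 : ℝ) < m := by exact_mod_cast hm0
  have h1 := hm _ hmδ
  rw [average, norm_smul, mul_pow, Real.norm_eq_abs, sq_abs, div_pow, Real.sq_sqrt hm'.le,
    inv_mul_le_iff₀ hm'] at h1
  rw [Real.dist_0_eq_abs, abs_of_nonneg (Finset.sum_nonneg fun _ _ => sq_nonneg _)]
  calc _ ≤ _ := h1
    _ = ε / A * (A - 1) := by rw [hA]; field_simp; ring
    _ < ε / A * A := by gcongr; linarith
    _ = ε := by field_simp

end Local

/-! ### Stochastic bounds -/

section Stochastic

variable {n : ℕ} {b : ℕ → Space n} {xo : Space n} {Ω : Type*} [MeasurableSpace Ω]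
  {P : Measure Ω} [IsProbabilityMeasure P] {ξ : ℕ → Ω → ℝ} {κ : ℝ}

/-- Outside a set of small probability, the noise term is dominated by the square of the local
parameter, for all large values of the latter. -/
theorem FourthMomentBound.exists_abs_localNoise_le (hn : n ≤ 3) (hξ : FourthMomentBound P ξ κ)
    {c : ℝ} (hc : 0 < c) {η : ENNReal} (hη : η ≠ 0) :
    ∃ J : ℕ, ∀ m, ∃ A : Set Ω, P A ≤ η ∧ ∀ ω ∉ A, ∀ s : Space n, 2 ^ J ≤ ‖s‖ →
      |localNoise b xo ξ m ω s| ≤ c * ‖s‖ ^ 2 := by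
  obtain ⟨C, hC, hmaj⟩ := hξ.exists_lintegral_chainingMajorant_le hn (Λ := 4) (by norm_num)
  have hlim : Tendsto (fun J : ℕ => ENNReal.ofReal (8 * C / c * (1 / 2) ^ J)) atTop (𝓝 0) := by
    have h1 := (tendsto_pow_atTop_nhds_zero_of_lt_one (r := (1 / 2 : ℝ)) (by norm_num)
        (by norm_num)).const_mul (8 * C / c)
    have h2 := ENNReal.tendsto_ofReal h1
    simpa using h2
  obtain ⟨J, hJ⟩ := (hlim.eventually_le_const (pos_iff_ne_zero.2 hη)).exists
  refine ⟨J, fun m => ?_⟩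
  -- Peeling: the noise on the ball of radius `2ʲ`, divided by `2ʲ` and moved to the unit ball, has
  -- majorants of mean at most `C` for all `j`. Markov at level `(c / 4) 2ʲ` gives probabilities `4C
  -- / (c 2ʲ)`, with sum `8C / (c 2ᴶ)` over `j ≥ J`.
  set φ : ℕ → ℕ → Space n → ℝ := fun j i s =>
    ((2 : ℝ) ^ j)⁻¹ * rangeDiffIncr xo (b i) (((2 : ℝ) ^ j / √(m : ℝ)) • s) with hφ
  have hLip : ∀ j, SquareLipschitz (Finset.range m) (φ j) 4 := fun j => by
    have := squareLipschitz_rescale (ψ := fun i => rangeDiffIncr xo (b i)) (L := 2)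
      (fun i => abs_rangeDiffIncr_sub_le xo (b i)) (fun i => continuous_rangeDiffIncr xo (b i)) m
      ((2 : ℝ) ^ j)⁻¹ ((2 : ℝ) ^ j)
    rwa [show (((2 : ℝ) ^ j)⁻¹ * 2 * (2 : ℝ) ^ j) ^ 2 = 4 by field_simp; norm_num] at this
  have hmaj' : ∀ j, ∫⁻ ω, chainingMajorant ξ (Finset.range m) (φ j) 0 ω ∂P ≤ ENNReal.ofReal C :=
    fun j => hmaj _ _ (hLip j) fun i => by simp [hφ]
  refine ⟨⋃ j : ℕ, {ω | ENNReal.ofReal (c / 4 * 2 ^ (j + J)) ≤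
    chainingMajorant ξ (Finset.range m) (φ (j + J)) 0 ω}, ?_, fun ω hω s hs => ?_⟩
  · calc _ ≤ ∑' j : ℕ, P {ω | ENNReal.ofReal (c / 4 * 2 ^ (j + J)) ≤
          chainingMajorant ξ (Finset.range m) (φ (j + J)) 0 ω} := measure_iUnion_le _
      _ ≤ ∑' j : ℕ, ENNReal.ofReal (4 * C / c * (1 / 2) ^ J * (1 / 2) ^ j) := by
          refine ENNReal.tsum_le_tsum fun j => ?_
          have hpos : 0 < c / 4 * 2 ^ (j + J) := by positivity
          refine (meas_ge_le_lintegral_div (hξ.aemeasurable_chainingMajorant _ _ _)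
            (ENNReal.ofReal_pos.2 hpos).ne' ENNReal.ofReal_ne_top).trans ?_
          refine (ENNReal.div_le_div_right (hmaj' _) _).trans ?_
          rw [← ENNReal.ofReal_div_of_pos hpos]
          refine ENNReal.ofReal_le_ofReal (le_of_eq ?_)
          rw [pow_add, one_div_pow, one_div_pow]
          field_simp
      _ = ENNReal.ofReal (8 * C / c * (1 / 2) ^ J) := by
          rw [← ENNReal.ofReal_tsum_of_nonneg (fun j => by positivity)
            ((summable_geometric_of_lt_one (by norm_num) (by norm_num)).mul_left _),
            tsum_mul_left, tsum_geometric_of_lt_one (by norm_num) (by norm_num)]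
          congr 1; ring
      _ ≤ η := hJ
  · have h1 : (1 : ℝ) ≤ ‖s‖ := (one_le_pow₀ one_le_two).trans hs
    obtain ⟨k, hk1, hk2⟩ := exists_nat_pow_near h1 one_lt_two
    have hJk : J ≤ k := by
      by_contra hcon
      have : (2 : ℝ) ^ (k + 1) ≤ 2 ^ J := pow_le_pow_right₀ one_le_two (by omega)
      linarith
    have hω' : ω ∉ {ω | ENNReal.ofReal (c / 4 * 2 ^ (k + 1 - J + J)) ≤
        chainingMajorant ξ (Finset.range m) (φ (k + 1 - J + J)) 0 ω} := fun hmem =>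
      hω (Set.mem_iUnion.2 ⟨k + 1 - J, hmem⟩)
    rw [Nat.sub_add_cancel (by omega : J ≤ k + 1)] at hω'
    set q : ℝ := 2 ^ (k + 1) with hq
    have hq0 : 0 < q := by positivity
    have h2 : ‖q⁻¹ • s‖ ≤ 1 := by
      rw [norm_smul, norm_inv, Real.norm_of_nonneg hq0.le, inv_mul_le_iff₀ hq0]
      linarith
    have h3 := (ofReal_abs_weightedSum_le (ξ := ξ) (hLip (k + 1)) 0 ω h2).trans_lt
      (not_le.1 hω')
    have h4 := (ENNReal.ofReal_lt_ofReal_iff_of_nonneg (abs_nonneg _)).1 h3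
    have h5 : weightedSum ξ (Finset.range m) (φ (k + 1)) ω (q⁻¹ • s) =
        q⁻¹ * localNoise b xo ξ m ω s := by
      rw [weightedSum, localNoise, Finset.mul_sum]
      refine Finset.sum_congr rfl fun i _ => ?_
      rw [hφ]
      dsimp only
      rw [← hq, smul_smul, div_mul_eq_mul_div, mul_inv_cancel₀ hq0.ne', one_div]
      ring
    rw [h5, abs_mul, abs_of_pos (inv_pos.2 hq0), inv_mul_lt_iff₀ hq0] at h4
    have h6 : q ≤ 2 * ‖s‖ := by rw [hq, pow_succ]; linarith
    calc _ ≤ q * (c / 4 * q) := h4.le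
      _ ≤ (2 * ‖s‖) * (c / 4 * (2 * ‖s‖)) := by gcongr
      _ = c * ‖s‖ ^ 2 := by ring

/-- The score is bounded in probability. -/
theorem FourthMomentBound.exists_norm_score_le (hn : n ≤ 3) (hξ : FourthMomentBound P ξ κ)
    {η : ENNReal} (hη : η ≠ 0) :
    ∃ ρ : ℝ, 0 < ρ ∧ ∀ m, P {ω | ρ ≤ ‖score b xo ξ m ω‖} ≤ η := by
  obtain ⟨C, hC, hmaj⟩ := hξ.exists_lintegral_chainingMajorant_le hn (Λ := 4) (by norm_num)
  have hlim : Tendsto (fun ρ : ℝ => ENNReal.ofReal (C / ρ)) atTop (𝓝 0) := by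
    have := ENNReal.tendsto_ofReal (tendsto_id.const_div_atTop C)
    simpa using this
  obtain ⟨ρ, hρ, hρ0⟩ := ((hlim.eventually_le_const (pos_iff_ne_zero.2 hη)).and
    (eventually_gt_atTop 0)).exists
  refine ⟨ρ, hρ0, fun m => ?_⟩
  set φ : ℕ → Space n → ℝ := fun i s =>
    1 * inner ℝ (rangeDiffGrad xo (b i)) (((1 : ℝ) / √(m : ℝ)) • s) with hφ
  have hLip : SquareLipschitz (Finset.range m) φ 4 := by
    have := squareLipschitz_rescale (ψ := fun i h => inner ℝ (rangeDiffGrad xo (b i)) h) (L := 2)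
      (fun i h h' => by
        rw [← inner_sub_right]; exact abs_inner_rangeDiffGrad_le xo (b i) (h - h'))
      (fun i => by fun_prop) m 1 1
    norm_num at this
    simpa [hφ] using this
  have hdom : ∀ ω, ENNReal.ofReal ‖score b xo ξ m ω‖ ≤
      chainingMajorant ξ (Finset.range m) φ 0 ω := by
    intro ω
    have h1 : ∀ s, weightedSum ξ (Finset.range m) φ ω s = inner ℝ (score b xo ξ m ω) s := by
      intro s
      rw [score, sum_inner]
      refine Finset.sum_congr rfl fun i _ => ?_
      rw [hφ]
      dsimp only
      rw [real_inner_smul_left, real_inner_smul_right, one_div]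
      ring
    set Z := score b xo ξ m ω with hZ
    by_cases hZ0 : Z = 0
    · simp [hZ0]
    have hZ' : ‖Z‖ ≠ 0 := norm_ne_zero_iff.2 hZ0
    -- The norm is the value of the linear process at the unit vector in the direction of the score.
    refine le_trans (le_of_eq ?_) (ofReal_abs_weightedSum_le (ξ := ξ) hLip 0 ω
      (norm_inv_norm_smul_le_one Z))
    rw [h1, real_inner_smul_right, real_inner_self_eq_norm_sq, sq, inv_mul_cancel_left₀ hZ',
      abs_of_nonneg (norm_nonneg _)]
  calc P {ω | ρ ≤ ‖score b xo ξ m ω‖}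
      ≤ P {ω | ENNReal.ofReal ρ ≤ chainingMajorant ξ (Finset.range m) φ 0 ω} :=
        measure_mono fun ω hω => (ENNReal.ofReal_le_ofReal hω).trans (hdom ω)
    _ ≤ (∫⁻ ω, chainingMajorant ξ (Finset.range m) φ 0 ω ∂P) / ENNReal.ofReal ρ :=
        meas_ge_le_lintegral_div (hξ.aemeasurable_chainingMajorant _ _ _)
            (ENNReal.ofReal_pos.2 hρ0).ne' ENNReal.ofReal_ne_top
    _ ≤ ENNReal.ofReal C / ENNReal.ofReal ρ :=
        ENNReal.div_le_div_right (hmaj _ _ hLip fun i => by simp [hφ]) _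
    _ = ENNReal.ofReal (C / ρ) := (ENNReal.ofReal_div_of_pos hρ0).symm
    _ ≤ η := hρ

/-- The contribution of the remainders to the noise term is uniformly negligible on bounded sets
of local parameters. -/
theorem FourthMomentBound.exists_abs_sum_rangeDiffRem_le (hn : n ≤ 3)
    (hξ : FourthMomentBound P ξ κ) {μ : Measure (Space n)} [IsProbabilityMeasure μ]
    (hconv : ∀ φ : Space n → ℝ, Continuous φ →
      Tendsto (fun m => average b m φ) atTop (𝓝 (∫ z, φ z ∂μ)))
    (hμ : μ {xo} = 0) (hxo : xo ≠ 0) (hb : ∀ i, b i ≠ xo) {ρ τ : ℝ} (hρ : 0 < ρ) (hτ : 0 < τ)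
    {η : ENNReal} (hη : η ≠ 0) :
    ∀ᶠ m in atTop, ∃ A : Set Ω, P A ≤ η ∧ ∀ ω ∉ A, ∀ s : Space n, ‖s‖ ≤ ρ →
      |∑ i ∈ Finset.range m, rangeDiffRem xo (b i) ((√(m : ℝ))⁻¹ • s) * ξ i ω| ≤ τ := by
  set φ : ℕ → ℕ → Space n → ℝ := fun m i s =>
    1 * rangeDiffRem xo (b i) ((ρ / √(m : ℝ)) • s) with hφ
  have hLip : ∀ m, SquareLipschitz (Finset.range m) (φ m) ((1 * 4 * ρ) ^ 2) := fun m =>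
    squareLipschitz_rescale (ψ := fun i => rangeDiffRem xo (b i)) (L := 4)
      (fun i => abs_rangeDiffRem_sub_le xo (b i)) (fun i => continuous_rangeDiffRem xo (b i)) m 1 ρ
  have hτ' : ENNReal.ofReal τ ≠ 0 := (ENNReal.ofReal_pos.2 hτ).ne'
  obtain ⟨K, hK⟩ := hξ.exists_lintegral_chainingMajorant_small hn (by positivity) hLip
    (fun h => by simpa [hφ] using tendsto_sum_rangeDiffRem_sq hconv hμ hxo hb ρ h)
    (ε := η * ENNReal.ofReal τ) (pos_iff_ne_zero.2 (mul_ne_zero hη hτ'))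
  filter_upwards [hK] with m hm
  refine ⟨{ω | ENNReal.ofReal τ ≤ chainingMajorant ξ (Finset.range m) (φ m) K ω}, ?_,
    fun ω hω s hs => ?_⟩
  · refine (meas_ge_le_lintegral_div (hξ.aemeasurable_chainingMajorant _ _ _) hτ'
      ENNReal.ofReal_ne_top).trans ?_
    exact ENNReal.div_le_of_le_mul hm.le
  · have h1 : ‖ρ⁻¹ • s‖ ≤ 1 := by
      rw [norm_smul, norm_inv, Real.norm_of_nonneg hρ.le, inv_mul_le_iff₀ hρ]
      linarith
    have h2 := (ofReal_abs_weightedSum_le (ξ := ξ) (hLip m) K ω h1).trans_lt (not_le.1 hω)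
    have h3 := (ENNReal.ofReal_lt_ofReal_iff_of_nonneg (abs_nonneg _)).1 h2
    have h4 : weightedSum ξ (Finset.range m) (φ m) ω (ρ⁻¹ • s) =
        ∑ i ∈ Finset.range m, rangeDiffRem xo (b i) ((√(m : ℝ))⁻¹ • s) * ξ i ω := by
      refine Finset.sum_congr rfl fun i _ => ?_
      rw [hφ]
      dsimp only
      rw [smul_smul, div_mul_eq_mul_div, mul_inv_cancel₀ hρ.ne', one_div, one_mul]
    rw [h4] at h3
    exact h3.le

/-- Null-measurable events that almost surely fail eventually have probabilities tending to
zero. -/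
theorem tendsto_measure_of_ae_eventually_notMem {E : ℕ → Set Ω}
    (hE : ∀ m, NullMeasurableSet (E m) P) (h : ∀ᵐ ω ∂P, ∀ᶠ m in atTop, ω ∉ E m) :
    Tendsto (fun m => P (E m)) atTop (𝓝 0) := by
  have h1 : TendstoInMeasure P (fun m => (E m).indicator (1 : Ω → ℝ)) atTop 0 := by
    refine tendstoInMeasure_of_tendsto_ae
      (fun m => (aestronglyMeasurable_const (b := (1 : ℝ))).indicator₀ (hE m)) ?_
    filter_upwards [h] with ω hω
    refine tendsto_const_nhds.congr' ?_
    filter_upwards [hω] with m hm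
    simp [hm]
  have h2 := tendstoInMeasure_iff_norm.1 h1 1 one_pos
  refine h2.congr fun m => ?_
  congr 1
  ext ω
  by_cases hω : ω ∈ E m <;> simp [hω]

end Stochastic

/-! ### Linearization of the estimates -/

section Linearization

variable {n : ℕ} {b : ℕ → Space n} {xo : Space n} {Ω : Type*} [MeasurableSpace Ω]
  {P : Measure Ω} {ξ : ℕ → Ω → ℝ} {κ : ℝ} {μ : Measure (Space n)}

theorem aemeasurable_score (hξ : ∀ i, AEMeasurable (ξ i) P) (m : ℕ) :
    AEMeasurable (score b xo ξ m) P :=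
  Finset.aemeasurable_fun_sum _ fun i _ => ((hξ i).const_mul _).smul_const _

theorem aemeasurable_localExcess (hξ : ∀ i, AEMeasurable (ξ i) P) (m : ℕ) {g : Ω → Space n}
    (hg : AEMeasurable g P) : AEMeasurable (fun ω => localExcess b xo ξ m ω (g ω)) P := by
  have h0 : AEMeasurable (fun ω => (√(m : ℝ))⁻¹ • g ω) P := by fun_prop
  have h1 : ∀ i, AEMeasurable (fun ω => rangeDiffIncr xo (b i) ((√(m : ℝ))⁻¹ • g ω)) P := fun i =>
    (continuous_rangeDiffIncr xo (b i)).measurable.comp_aemeasurable h0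
  exact (Finset.aemeasurable_fun_sum _ fun i _ => (h1 i).pow_const 2).sub
    ((Finset.aemeasurable_fun_sum _ fun i _ => (h1 i).mul (hξ i)).const_mul 2)

/-- The operator of the Gram matrix. -/
def gramOperator (μ : Measure (Space n)) (xo : Space n) : Space n →L[ℝ] Space n :=
  Matrix.toEuclideanCLM (𝕜 := ℝ) (gramMatrix μ xo)

/-- The operator of the inverse of the Gram matrix. -/
def gramInverse (μ : Measure (Space n)) (xo : Space n) : Space n →L[ℝ] Space n :=
  Matrix.toEuclideanCLM (𝕜 := ℝ) (gramMatrix μ xo)⁻¹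

theorem gramOperator_gramInverse (hM : (gramMatrix μ xo).PosDef) (z : Space n) :
    gramOperator μ xo (gramInverse μ xo z) = z := by
  have h : gramOperator μ xo * gramInverse μ xo = 1 := by
    rw [gramOperator, gramInverse, ← map_mul,
      Matrix.mul_nonsing_inv _ ((Matrix.isUnit_iff_isUnit_det _).1 hM.isUnit), map_one]
  have := congrArg (fun f : Space n →L[ℝ] Space n => f z) h
  simpa using this

theorem inner_toEuclideanCLM_comm {M : Matrix (Fin n) (Fin n) ℝ} (hM : M.IsHermitian)
    (x y : Space n) :
    inner ℝ x (Matrix.toEuclideanCLM (𝕜 := ℝ) M y) =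
      inner ℝ (Matrix.toEuclideanCLM (𝕜 := ℝ) M x) y := by
  have hT : M.transpose = M := by
    have := hM.eq
    rwa [Matrix.conjTranspose_eq_transpose_of_trivial] at this
  rw [real_inner_comm y, Matrix.inner_toEuclideanCLM, Matrix.inner_toEuclideanCLM,
    Matrix.dotProduct_mulVec, ← Matrix.mulVec_transpose, hT, dotProduct_comm]

/-- Completing the square. -/
theorem gramForm_sub_eq (hM : (gramMatrix μ xo).PosDef) (Z s : Space n) :
    gramForm μ xo (s - gramInverse μ xo Z) =
      (gramForm μ xo s - 2 * inner ℝ Z s) -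
        (gramForm μ xo (gramInverse μ xo Z) - 2 * inner ℝ Z (gramInverse μ xo Z)) := by
  have h1 : Matrix.toEuclideanCLM (𝕜 := ℝ) (gramMatrix μ xo) (gramInverse μ xo Z) = Z :=
    gramOperator_gramInverse hM Z
  simp only [gramForm_eq_inner]
  rw [map_sub, inner_sub_left, inner_sub_right, inner_sub_right, h1,
    inner_toEuclideanCLM_comm hM.isHermitian (gramInverse μ xo Z) s, h1, real_inner_comm Z s,
    real_inner_comm Z (gramInverse μ xo Z)]
  ring

/-- Local parameters that do not increase the objective compared with the source and with the
linearized estimate are asymptotically equivalent to the latter. -/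
theorem FourthMomentBound.tendstoInMeasure_sub_gramInverse_score [IsProbabilityMeasure P]
    [IsProbabilityMeasure μ] (hn : n ≤ 3) (hξ : FourthMomentBound P ξ κ)
    (hconv : ∀ φ : Space n → ℝ, Continuous φ →
      Tendsto (fun m => average b m φ) atTop (𝓝 (∫ z, φ z ∂μ)))
    (hμ : μ {xo} = 0) (hxo : xo ≠ 0) (hb : ∀ i, b i ≠ xo)
    (hpos : ∀ h : Space n, h ≠ 0 → 0 < gramForm μ xo h)
    {shat : ℕ → Ω → Space n} (hmeas : ∀ m, AEMeasurable (shat m) P)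
    (hsmall : ∀ᵐ ω ∂P, Tendsto (fun m : ℕ => (√(m : ℝ))⁻¹ • shat m ω) atTop (𝓝 0))
    (hle0 : ∀ᵐ ω ∂P, ∀ᶠ m in atTop, localExcess b xo ξ m ω (shat m ω) ≤ 0)
    (hle1 : ∀ᵐ ω ∂P, ∀ᶠ m in atTop, localExcess b xo ξ m ω (shat m ω) ≤
      localExcess b xo ξ m ω (gramInverse μ xo (score b xo ξ m ω))) :
    TendstoInMeasure P (fun m ω => shat m ω - gramInverse μ xo (score b xo ξ m ω)) atTop 0 := by
  have hM := gramMatrix_posDef hpos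
  obtain ⟨c, hc, hcoer⟩ := exists_gramForm_ge hpos
  have hstar : ∀ m, AEMeasurable (fun ω => gramInverse μ xo (score b xo ξ m ω)) P := fun m =>
    (gramInverse μ xo).continuous.measurable.comp_aemeasurable
      (aemeasurable_score hξ.aemeasurable m)
  rw [tendstoInMeasure_iff_norm]
  intro ε hε
  rw [ENNReal.tendsto_nhds_zero]
  intro θ hθ
  set η : ENNReal := θ / 6 with hη
  have hη0 : η ≠ 0 := (ENNReal.div_pos hθ.ne' (by norm_num)).ne'
  have hη6 : η + η + η + η + η + η = θ := by
    rw [show η + η + η + η + η + η = 6 * η by ring, hη]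
    exact ENNReal.mul_div_cancel (by norm_num) (by norm_num)
  obtain ⟨δ₁, hδ₁, hquad₁⟩ := abs_localSignal_sub_gramForm_le hconv hμ hxo hb
    (show 0 < c / 2 by positivity)
  obtain ⟨J, hJ⟩ := hξ.exists_abs_localNoise_le (b := b) (xo := xo) hn
    (show 0 < c / 8 by positivity) hη0
  obtain ⟨ρ₀, hρ₀, hscore⟩ := hξ.exists_norm_score_le (b := b) (xo := xo) hn hη0
  -- A common radius, outside the exceptional events, for the estimate (first summand) and for the
  -- linearized estimate (second summand).
  set ρ : ℝ := 2 ^ J + ‖gramInverse μ xo‖ * ρ₀ with hρ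
  have hρ0 : 0 < ρ := by positivity
  obtain ⟨δ₂, hδ₂, hquad₂⟩ := abs_localSignal_sub_gramForm_le hconv hμ hxo hb
    (show 0 < c * ε ^ 2 / (8 * ρ ^ 2) by positivity)
  have hrem := hξ.exists_abs_sum_rangeDiffRem_le hn hconv hμ hxo hb hρ0
    (show 0 < c * ε ^ 2 / 16 by positivity) hη0
  have hB1 : Tendsto (fun m : ℕ => P {ω | δ₁ < ‖(√(m : ℝ))⁻¹ • shat m ω‖}) atTop (𝓝 0) := by
    refine tendsto_measure_of_ae_eventually_notMem (fun m => ?_) ?_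
    · have h0 : AEMeasurable (fun ω => (√(m : ℝ))⁻¹ • shat m ω) P := (hmeas m).fun_const_smul _
      exact nullMeasurableSet_lt aemeasurable_const h0.norm
    · filter_upwards [hsmall] with ω hω
      have h1 : Tendsto (fun m : ℕ => ‖(√(m : ℝ))⁻¹ • shat m ω‖) atTop (𝓝 0) := by
        simpa using hω.norm
      filter_upwards [h1.eventually_le_const hδ₁] with m hm
      exact not_lt.2 hm
  have hB2 : Tendsto (fun m : ℕ => P {ω | 0 < localExcess b xo ξ m ω (shat m ω)}) atTop
      (𝓝 0) := by
    refine tendsto_measure_of_ae_eventually_notMem (fun m => ?_) ?_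
    · exact nullMeasurableSet_lt aemeasurable_const
        (aemeasurable_localExcess hξ.aemeasurable m (hmeas m))
    · filter_upwards [hle0] with ω hω
      filter_upwards [hω] with m hm
      exact not_lt.2 hm
  have hB3 : Tendsto (fun m : ℕ => P {ω |
      localExcess b xo ξ m ω (gramInverse μ xo (score b xo ξ m ω)) <
        localExcess b xo ξ m ω (shat m ω)}) atTop (𝓝 0) := by
    refine tendsto_measure_of_ae_eventually_notMem (fun m => ?_) ?_
    · exact nullMeasurableSet_lt (aemeasurable_localExcess hξ.aemeasurable m (hstar m))
        (aemeasurable_localExcess hξ.aemeasurable m (hmeas m))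
    · filter_upwards [hle1] with ω hω
      filter_upwards [hω] with m hm
      exact not_lt.2 hm
  have hη1 : 0 < η := pos_iff_ne_zero.2 hη0
  have hsqrt : Tendsto (fun m : ℕ => δ₂ * √(m : ℝ)) atTop atTop :=
    (Real.tendsto_sqrt_atTop.comp tendsto_natCast_atTop_atTop).const_mul_atTop hδ₂
  filter_upwards [hquad₁, hquad₂, hrem, ENNReal.tendsto_nhds_zero.1 hB1 η hη1,
    ENNReal.tendsto_nhds_zero.1 hB2 η hη1, ENNReal.tendsto_nhds_zero.1 hB3 η hη1,
    hsqrt.eventually_ge_atTop ρ, eventually_gt_atTop 0]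
    with m hq₁ hq₂ ⟨A, hA, hAω⟩ hm1 hm2 hm3 hmρ hm0
  obtain ⟨A', hA', hA'ω⟩ := hJ m
  have hm' : (0 : ℝ) < √(m : ℝ) := Real.sqrt_pos.2 (by exact_mod_cast hm0)
  have hsub : {ω | ε ≤ ‖(shat m ω - gramInverse μ xo (score b xo ξ m ω)) - (0 : Ω → Space n) ω‖} ⊆
      {ω | δ₁ < ‖(√(m : ℝ))⁻¹ • shat m ω‖} ∪ {ω | 0 < localExcess b xo ξ m ω (shat m ω)} ∪
      {ω | localExcess b xo ξ m ω (gramInverse μ xo (score b xo ξ m ω)) <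
        localExcess b xo ξ m ω (shat m ω)} ∪ A ∪ A' ∪ {ω | ρ₀ ≤ ‖score b xo ξ m ω‖} := by
    intro ω hω
    by_contra hcon
    simp only [Set.mem_union, Set.mem_ofPred_eq, not_or, not_lt, not_le] at hcon
    obtain ⟨⟨⟨⟨⟨h1, h2⟩, h3⟩, h4⟩, h5⟩, h6⟩ := hcon
    set s := shat m ω with hs
    set Z := score b xo ξ m ω with hZ
    set t := gramInverse μ xo Z with ht
    have hω' : ε ≤ ‖s - t‖ := by simpa using hω
    -- For larger `s` the signal is at least `(c / 2)‖s‖²` and twice the noise at most `(c /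
    -- 4)‖s‖²`, so the excess would be positive.
    have hsρ : ‖s‖ ≤ ρ := by
      by_contra hlarge
      have hJs : 2 ^ J ≤ ‖s‖ := by
        have : 0 ≤ ‖gramInverse μ xo‖ * ρ₀ := by positivity
        linarith
      have hs0 : 0 < ‖s‖ := hρ0.trans (not_le.1 hlarge)
      have e1 := hA'ω ω h5 s hJs
      have e2 := hq₁ s (by
        rwa [norm_smul, norm_inv, Real.norm_of_nonneg hm'.le, inv_mul_le_iff₀ hm',
          mul_comm] at h1)
      have e3 := hcoer s
      rw [localExcess] at h2
      have e4 := (abs_le.1 e1).2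
      have e5 := (abs_le.1 e2).1
      nlinarith [sq_pos_of_pos hs0]
    have htρ : ‖t‖ ≤ ρ := by
      have e1 := (gramInverse μ xo).le_opNorm Z
      have e2 : ‖gramInverse μ xo‖ * ‖Z‖ ≤ ‖gramInverse μ xo‖ * ρ₀ := by gcongr
      have e3 : (0 : ℝ) ≤ 2 ^ J := by positivity
      linarith
    -- The error is `cε² / 8` from the signal plus twice `cε² / 16` from the remainders in the
    -- noise.
    have hexp : ∀ y : Space n, ‖y‖ ≤ ρ → |localExcess b xo ξ m ω y -
        (gramForm μ xo y - 2 * inner ℝ Z y)| ≤ c * ε ^ 2 / 4 := by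
      intro y hy
      have e1 := hq₂ y (hy.trans hmρ)
      have e2 := hAω ω h4 y hy
      have e3 : c * ε ^ 2 / (8 * ρ ^ 2) * ‖y‖ ^ 2 ≤ c * ε ^ 2 / 8 := by
        calc _ ≤ c * ε ^ 2 / (8 * ρ ^ 2) * ρ ^ 2 := by gcongr
          _ = c * ε ^ 2 / 8 := by field_simp
      rw [localExcess, localNoise_eq, ← hZ]
      rw [abs_le] at e1 e2 ⊢
      constructor <;> linarith [e1.1, e1.2, e2.1, e2.2]
    have e1 := abs_le.1 (hexp s hsρ)
    have e2 := abs_le.1 (hexp t htρ)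
    have e3 := gramForm_sub_eq hM Z s
    rw [← ht] at e3
    have e4 := hcoer (s - t)
    have e5 : ε ^ 2 ≤ ‖s - t‖ ^ 2 := by gcongr
    have e6 : 0 < c * ε ^ 2 := by positivity
    -- The excess at `s` is at most that at `t`, so the completed square is at most `cε² / 2`,
    -- whereas coercivity makes it at least `cε²`.
    nlinarith [e1.1, e1.2, e2.1, e2.2]
  calc _ ≤ _ := measure_mono hsub
    _ ≤ η + η + η + η + η + η := by
        refine (measure_union_le _ _).trans (add_le_add ?_ (hscore m))
        refine (measure_union_le _ _).trans (add_le_add ?_ hA')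
        refine (measure_union_le _ _).trans (add_le_add ?_ hA)
        refine (measure_union_le _ _).trans (add_le_add ?_ hm3)
        exact (measure_union_le _ _).trans (add_le_add hm1 hm2)
    _ = θ := hη6

/-- The linearized estimates, on the original scale, tend to zero almost surely. -/
theorem FourthMomentBound.ae_tendsto_inv_sqrt_smul_score (hξ : FourthMomentBound P ξ κ) :
    ∀ᵐ ω ∂P, Tendsto (fun m : ℕ => (√(m : ℝ))⁻¹ • score b xo ξ m ω) atTop (𝓝 0) := by
  have h1 : ∀ᵐ ω ∂P, ∀ j, Tendsto (fun m : ℕ => (m : ℝ)⁻¹ *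
      ∑ i ∈ Finset.range m, rangeDiffGrad xo (b i) j * ξ i ω) atTop (𝓝 0) :=
    ae_all_iff.2 fun j => hξ.ae_tendsto_weighted_average fun i =>
      abs_rangeDiffGrad_apply_le xo (b i) j
  filter_upwards [h1] with ω hω
  have h2 : Tendsto (fun (m : ℕ) (j : Fin n) => (m : ℝ)⁻¹ *
      ∑ i ∈ Finset.range m, rangeDiffGrad xo (b i) j * ξ i ω) atTop (𝓝 0) :=
    tendsto_pi_nhds.2 hω
  have h3 := ((PiLp.continuous_toLp 2 fun _ : Fin n => ℝ).tendsto 0).comp h2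
  refine h3.congr fun m => ?_
  ext j
  have h4 : (√(m : ℝ))⁻¹ * (√(m : ℝ))⁻¹ = (m : ℝ)⁻¹ := by
    rw [← mul_inv, Real.mul_self_sqrt (Nat.cast_nonneg m)]
  simp only [Function.comp_apply, score, PiLp.smul_apply, smul_eq_mul, WithLp.ofLp_sum,
    WithLp.ofLp_smul, Finset.sum_apply, Pi.smul_apply]
  rw [Finset.mul_sum, Finset.mul_sum]
  refine Finset.sum_congr rfl fun i _ => ?_
  rw [← h4]; ring

end Linearization

/-! ### Convergence in distribution of the linearized estimates -/

section Distribution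

variable {n : ℕ}

theorem inner_gramInverse_score {b : ℕ → Space n} {xo : Space n} {Ω : Type*} {ξ : ℕ → Ω → ℝ}
    {μ : Measure (Space n)} (hM : (gramMatrix μ xo).PosDef) (m : ℕ) (ω : Ω) (t : Space n) :
    inner ℝ (gramInverse μ xo (score b xo ξ m ω)) t =
      ∑ i ∈ Finset.range m,
        ((√(m : ℝ))⁻¹ * inner ℝ (rangeDiffGrad xo (b i)) (gramInverse μ xo t)) * ξ i ω := by
  rw [gramInverse, ← inner_toEuclideanCLM_comm hM.inv.isHermitian, score, sum_inner]
  refine Finset.sum_congr rfl fun i _ => ?_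
  rw [real_inner_smul_left]
  ring

variable {b : ℕ → Space n} {xo : Space n} {Ω : Type*} [MeasurableSpace Ω]
  {P : Measure Ω} [IsProbabilityMeasure P] {ξ : ℕ → Ω → ℝ} {μ : Measure (Space n)}
  [IsProbabilityMeasure μ]

/-- Projections on `t` are exactly Gaussian with variance `v` times the average of `⟨g, w⟩²`, where
`g` runs over the gradients and `w = M⁻¹ t`. The limit is `v⟨w, M w⟩ = v⟨t, M⁻¹ t⟩`, and convergence
of characteristic functions concludes. -/
theorem tendstoInDistribution_gramInverse_score {v : ℝ≥0} (hind : iIndepFun ξ P)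
    (hlaw : ∀ i, HasLaw (ξ i) (gaussianReal 0 v) P)
    (hconv : ∀ φ : Space n → ℝ, Continuous φ →
      Tendsto (fun m => average b m φ) atTop (𝓝 (∫ z, φ z ∂μ)))
    (hμ : μ {xo} = 0) (hM : (gramMatrix μ xo).PosDef) :
    TendstoInDistribution (fun m ω => gramInverse μ xo (score b xo ξ m ω)) atTop
      (id : Space n → Space n) (fun _ => P)
      (multivariateGaussian 0 ((v : ℝ) • (gramMatrix μ xo)⁻¹)) := by
  have hmeas : ∀ m, AEMeasurable (fun ω => gramInverse μ xo (score b xo ξ m ω)) P := fun m =>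
    (gramInverse μ xo).continuous.measurable.comp_aemeasurable
      (aemeasurable_score (fun i => (hlaw i).aemeasurable) m)
  refine ⟨hmeas, aemeasurable_id, ?_⟩
  refine ProbabilityMeasure.tendsto_of_tendsto_charFun fun t => ?_
  change Tendsto (fun m => charFun (P.map fun ω => gramInverse μ xo (score b xo ξ m ω)) t) atTop
    (𝓝 (charFun ((multivariateGaussian 0 ((v : ℝ) • (gramMatrix μ xo)⁻¹)).map id) t))
  rw [Measure.map_id]
  set w := gramInverse μ xo t with hw
  have hS : ((v : ℝ) • (gramMatrix μ xo)⁻¹).PosSemidef := hM.inv.posSemidef.smul v.coe_nonneg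
  rw [charFun_multivariateGaussian hS]
  have hchar : ∀ m, charFun (P.map fun ω => gramInverse μ xo (score b xo ξ m ω)) t =
      Complex.exp (-(((v : ℝ) * ∑ i ∈ Finset.range m,
        ((√(m : ℝ))⁻¹ * inner ℝ (rangeDiffGrad xo (b i)) w) ^ 2 : ℝ) : ℂ) / 2) := by
    intro m
    set c : ℕ → ℝ := fun i => (√(m : ℝ))⁻¹ * inner ℝ (rangeDiffGrad xo (b i)) w with hc
    have hm1 : AEMeasurable (fun ω => ∑ i ∈ Finset.range m, c i * ξ i ω) P :=
      Finset.aemeasurable_fun_sum _ fun i _ => (hlaw i).aemeasurable.const_mul _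
    have h1 : charFun (P.map fun ω => gramInverse μ xo (score b xo ξ m ω)) t =
        charFun (P.map fun ω => ∑ i ∈ Finset.range m, c i * ξ i ω) 1 := by
      rw [charFun_apply, charFun_apply, integral_map (hmeas m) (by fun_prop),
        integral_map hm1 (by fun_prop)]
      refine integral_congr_ae (ae_of_all _ fun ω => ?_)
      dsimp only
      rw [inner_gramInverse_score hM]
      simp [hc, hw]
    rw [h1, map_weightedSum_gaussian hind hlaw, charFun_gaussianReal]
    change _ = Complex.exp (-(((v : ℝ) * ∑ i ∈ Finset.range m, (c i) ^ 2 : ℝ) : ℂ) / 2)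
    congr 1
    have h2 : 0 ≤ ∑ i ∈ Finset.range m, (c i) ^ 2 := Finset.sum_nonneg fun _ _ => sq_nonneg _
    rw [NNReal.coe_mul, Real.coe_toNNReal _ h2]
    push_cast
    ring
  simp_rw [hchar]
  have hsum : ∀ m : ℕ, ∑ i ∈ Finset.range m,
      ((√(m : ℝ))⁻¹ * inner ℝ (rangeDiffGrad xo (b i)) w) ^ 2 =
      average b m fun z => (inner ℝ (rangeDiffGrad xo z) w) ^ 2 := by
    intro m
    rw [average, Finset.mul_sum]
    refine Finset.sum_congr rfl fun i _ => ?_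
    rw [mul_pow, inv_pow, Real.sq_sqrt (Nat.cast_nonneg m)]
  simp_rw [hsum]
  have hlim := (tendsto_average_inner_rangeDiffGrad_sq hconv hμ w).const_mul (v : ℝ)
  have hform : (v : ℝ) * gramForm μ xo w =
      t.ofLp ⬝ᵥ Matrix.mulVec ((v : ℝ) • (gramMatrix μ xo)⁻¹) t.ofLp := by
    have h1 : Matrix.toEuclideanCLM (𝕜 := ℝ) (gramMatrix μ xo) w = t :=
      gramOperator_gramInverse hM t
    rw [gramForm_eq_inner, h1, real_inner_comm, hw, gramInverse, Matrix.inner_toEuclideanCLM,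
      Matrix.smul_mulVec, dotProduct_smul, smul_eq_mul]
  have hlim2 : Tendsto (fun m => Complex.exp (-(((v : ℝ) *
      average b m fun z => (inner ℝ (rangeDiffGrad xo z) w) ^ 2 : ℝ) : ℂ) / 2)) atTop
      (𝓝 (Complex.exp (-(((v : ℝ) * gramForm μ xo w : ℝ) : ℂ) / 2))) :=
    (Complex.continuous_exp.tendsto _).comp
      ((((Complex.continuous_ofReal.tendsto _).comp hlim).neg).div_const 2)
  convert hlim2 using 2
  rw [hform]
  congr 1
  simp [neg_div]

end Distribution

/-! ### The least-squares objective -/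

section Objective

variable {n : ℕ}

theorem sum_Icc_one_eq_sum_range (f : ℕ → ℝ) (m : ℕ) :
    ∑ i ∈ Finset.Icc 1 m, f i = ∑ i ∈ Finset.range m, f (i + 1) := by
  induction m with
  | zero => simp
  | succ m ih => rw [Finset.sum_Icc_succ_top (by omega), ih, Finset.sum_range_succ]

theorem objective_measurement_eq (a : ℕ → Space n) (xo : Space n) (r : ℕ → ℝ) (m : ℕ)
    (x : Space n) :
    objective a (measurement a xo r) m x = (m : ℝ)⁻¹ * ∑ i ∈ Finset.range m,
      (r (i + 1) + (rangeDiff (a (i + 1)) xo - rangeDiff (a (i + 1)) x)) ^ 2 := by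
  rw [objective, sum_Icc_one_eq_sum_range, one_div]
  congr 1
  refine Finset.sum_congr rfl fun i _ => ?_
  rw [measurement, rangeDiff, rangeDiff]
  ring

/-- The squares of the noise cancel, which leaves a nonnegative signal and a term linear in the
noise. -/
theorem objective_sub_objective (a : ℕ → Space n) (xo : Space n) (r : ℕ → ℝ) (m : ℕ)
    (x : Space n) :
    objective a (measurement a xo r) m x - objective a (measurement a xo r) m xo =
      average (fun i => a (i + 1)) m (fun z => (rangeDiff z xo - rangeDiff z x) ^ 2) +
        2 * ((m : ℝ)⁻¹ * ∑ i ∈ Finset.range m,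
          (rangeDiff (a (i + 1)) xo - rangeDiff (a (i + 1)) x) * r (i + 1)) := by
  rw [objective_measurement_eq, objective_measurement_eq, average, ← mul_sub,
    ← Finset.sum_sub_distrib, mul_left_comm, ← mul_add]
  congr 1
  rw [Finset.mul_sum, ← Finset.sum_add_distrib]
  exact Finset.sum_congr rfl fun i _ => by ring

theorem localExcess_eq {Ω : Type*} (a : ℕ → Space n) (xo : Space n) (r : ℕ → Ω → ℝ) {m : ℕ}
    (hm : 0 < m) (ω : Ω) (x : Space n) :
    localExcess (fun i => a (i + 1)) xo (fun i => r (i + 1)) m ω (√(m : ℝ) • (x - xo)) =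
      m * (objective a (measurement a xo fun i => r i ω) m x -
        objective a (measurement a xo fun i => r i ω) m xo) := by
  have hm' : (0 : ℝ) < m := by exact_mod_cast hm
  have hs : (√(m : ℝ))⁻¹ • √(m : ℝ) • (x - xo) = x - xo :=
    inv_smul_smul₀ (Real.sqrt_pos.2 hm').ne' _
  rw [objective_sub_objective, localExcess, localSignal, localNoise, average, hs, mul_add,
    mul_left_comm (m : ℝ) 2, mul_inv_cancel_left₀ hm'.ne', mul_inv_cancel_left₀ hm'.ne',
    sub_eq_add_neg, ← mul_neg, ← Finset.sum_neg_distrib]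
  congr 1
  · refine Finset.sum_congr rfl fun i _ => ?_
    rw [rangeDiffIncr, add_sub_cancel]; ring
  · congr 1
    refine Finset.sum_congr rfl fun i _ => ?_
    rw [rangeDiffIncr, add_sub_cancel]; ring

theorem average_indicator_eq_sampleDistribution (a : ℕ → Space n) (m : ℕ) (z : Space n) :
    average (fun i => a (i + 1)) m ({y | ∀ j, y j ≤ z j}.indicator 1) =
      sampleDistribution a m z := by
  classical
  rw [average, sampleDistribution, div_eq_inv_mul,
    ← sum_Icc_one_eq_sum_range fun i => {y : Space n | ∀ j, y j ≤ z j}.indicator 1 (a i),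
    Finset.card_filter]
  push_cast
  congr 1
  refine Finset.sum_congr rfl fun i _ => ?_
  simp [Set.indicator_apply]

/-- Consistency of the maximum likelihood estimates, along one realization of the noise that
satisfies the uniform strong law. -/
theorem tendsto_of_isMLEstimate {a : ℕ → Space n} {xo : Space n} {μ : Measure (Space n)}
    [IsProbabilityMeasure μ] {R : ℝ} (hb : ∀ i, ‖a (i + 1)‖ ≤ R) (hball : ∀ᵐ z ∂μ, ‖z‖ ≤ R)
    (hconv : ∀ φ : Space n → ℝ, Continuous φ →
      Tendsto (fun m => average (fun i => a (i + 1)) m φ) atTop (𝓝 (∫ z, φ z ∂μ)))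
    (hfin : ∀ x, x ≠ xo → ¬ ∀ᵐ z ∂μ, rangeDiff z xo = rangeDiff z x) {Θ : Set (Space n)}
    (hxo : xo ∈ Θ)
    (hinf : Bornology.IsBounded Θ ∨
      ∀ u : Space n, ‖u‖ = 1 → ¬ ∀ᵐ z ∂μ, rangeDiff z xo = - inner ℝ u z)
    {r : ℕ → ℝ}
    (hr : ∀ ε > 0, ∀ᶠ m : ℕ in atTop, ∀ φ : Space n → ℝ,
      (∀ x y, |φ x - φ y| ≤ 2 * dist x y) → (∀ i, |φ (a (i + 1))| ≤ 2 * R) →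
      |(m : ℝ)⁻¹ * ∑ i ∈ Finset.range m, φ (a (i + 1)) * r (i + 1)| ≤ ε)
    {x : ℕ → Space n} (hx : ∀ᶠ m in atTop, IsMLEstimate Θ a (measurement a xo r) m (x m)) :
    Tendsto x atTop (𝓝 xo) := by
  refine tendsto_of_tendsto_average_sq hb hball hconv hfin ?_ ?_
  · refine hinf.imp_left fun h => ?_
    obtain ⟨C, hC⟩ := h.exists_norm_le
    exact ⟨C, hx.mono fun m hm => hC _ hm.1⟩
  · rw [Metric.tendsto_nhds]
    intro ε hε
    filter_upwards [hx, hr (ε / 4) (by positivity)] with m hm hrm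
    have h1 := hm.2 xo hxo
    have h2 := objective_sub_objective a xo r m (x m)
    -- The weight depends on the noise through `x m`, which is why the strong law must be uniform.
    -- Its Lipschitz constant in `z` and its bound `2R` do not depend on `x m`.
    have h3 := hrm (fun z => rangeDiff z xo - rangeDiff z (x m)) (fun y z => ?_) (fun i => ?_)
    · have h4 := (abs_le.1 h3).1
      have h5 : 0 ≤ average (fun i => a (i + 1)) m
          fun z => (rangeDiff z xo - rangeDiff z (x m)) ^ 2 :=
        mul_nonneg (by positivity) (Finset.sum_nonneg fun _ _ => sq_nonneg _)
      rw [Real.dist_0_eq_abs, abs_of_nonneg h5]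
      linarith
    · have e1 := abs_le.1 (abs_rangeDiff_sub_left_le y z xo)
      have e2 := abs_le.1 (abs_rangeDiff_sub_left_le y z (x m))
      rw [dist_eq_norm, abs_le]
      constructor <;> linarith [e1.1, e1.2, e2.1, e2.2]
    · have e1 := abs_le.1 ((abs_rangeDiff_le (a (i + 1)) xo).trans (hb i))
      have e2 := abs_le.1 ((abs_rangeDiff_le (a (i + 1)) (x m)).trans (hb i))
      rw [abs_le]
      constructor <;> linarith [e1.1, e1.2, e2.1, e2.2]

end Objective

end TDOA

end

/-! ### The main theorem -/

theorem theorem1 {n : ℕ} (hn : n = 2 ∨ n = 3)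
    {Ω : Type*} [MeasurableSpace Ω] (P : Measure Ω) [IsProbabilityMeasure P]
    -- the source, the sensors (the reference sensor `a 0` being the origin), the limit measure
    (xo : TDOA.Space n) (a : ℕ → TDOA.Space n) (ha0 : a 0 = 0)
    (ha_bdd : Bornology.IsBounded (Set.range a)) (ha_ne : ∀ i, a i ≠ xo)
    (μ : Measure (TDOA.Space n)) [IsProbabilityMeasure μ]
    (hμ : ∀ z, Tendsto (fun m => TDOA.sampleDistribution a m z) atTop
      (𝓝 (TDOA.distributionFunction μ z)))
    (h_hyperboloid : ∀ S, TDOA.IsHyperboloidWithFocus xo S → a 0 ∈ S → μ S ≠ 1)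
    (h_hyperplane : ∀ S : Set (TDOA.Space n), TDOA.IsHyperplane S → μ S ≠ 1)
    -- the noise
    (σ : ℝ≥0) (r : ℕ → Ω → ℝ)
    (hr_indep : iIndepFun (fun i => r (i + 1)) P)
    (hr_law : ∀ i, 1 ≤ i → HasLaw (r i) (gaussianReal 0 (σ ^ 2)) P)
    -- the parameter set: compact, or all of `ℝⁿ`
    (Θ : Set (TDOA.Space n)) (hxo : xo ∈ Θ)
    (hΘ : IsCompact Θ ∨
      (Θ = Set.univ ∧ ∀ S, TDOA.IsParaboloidWithFocus xo S → a 0 ∈ S → μ S ≠ 1))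
    -- the maximum likelihood estimates
    (xhat : ℕ → Ω → TDOA.Space n) (hxhat_meas : ∀ m, AEMeasurable (xhat m) P)
    (hxhat : ∀ᵐ ω ∂P, ∀ᶠ m in atTop,
      TDOA.IsMLEstimate Θ a (TDOA.measurement a xo fun i => r i ω) m (xhat m ω)) :
    (∀ᵐ ω ∂P, Tendsto (fun m => xhat m ω) atTop (𝓝 xo)) ∧
    (xo ∈ interior Θ → μ {xo} = 0 →
      (∀ S, TDOA.IsConeWithVertex xo S → a 0 ∈ S → μ S ≠ 1) →
      ∃ M : Matrix (Fin n) (Fin n) ℝ, TDOA.IsTailGram a xo M ∧ M.PosDef ∧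
        TendstoInDistribution (fun (m : ℕ) ω => √(m : ℝ) • (xhat m ω - xo)) atTop
          (id : TDOA.Space n → TDOA.Space n) (fun _ => P)
          (multivariateGaussian 0 ((σ : ℝ) ^ 2 • M⁻¹))) := by
  have hn2 : 2 ≤ n := by omega
  have hn3 : n ≤ 3 := by omega
  -- The reference sensor is not at the source; this makes `‖x‖` differentiable at `xo`.
  have hxo0 : xo ≠ 0 := fun h => ha_ne 0 (by rw [ha0, h])
  rw [ha0] at h_hyperboloid hΘ
  set b : ℕ → TDOA.Space n := fun i => a (i + 1) with hb_def
  set ξ : ℕ → Ω → ℝ := fun i => r (i + 1) with hξ_def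
  have hlaw : ∀ i, HasLaw (ξ i) (gaussianReal 0 (σ ^ 2)) P := fun i => hr_law (i + 1) (by omega)
  have hb_ne : ∀ i, b i ≠ xo := fun i => ha_ne (i + 1)
  obtain ⟨R, hR⟩ := ha_bdd.exists_norm_le
  have hbR : ∀ i, ‖b i‖ ≤ R := fun i => hR _ ⟨i + 1, rfl⟩
  have hb_tb : TotallyBounded (Set.range b) := by
    refine (isCompact_closedBall (0 : TDOA.Space n) R).totallyBounded.subset ?_
    rintro _ ⟨i, rfl⟩
    exact mem_closedBall_zero_iff.2 (hbR i)
  obtain ⟨hball, hconv⟩ := TDOA.empirical_convergence (μ := μ) hbR fun z =>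
    (hμ z).congr fun m => (TDOA.average_indicator_eq_sampleDistribution a m z).symm
  obtain ⟨κ, hξ⟩ := TDOA.exists_fourthMomentBound_of_gaussian hr_indep hlaw
  obtain ⟨A, hA, habs⟩ := TDOA.ae_eventually_average_abs_le hr_indep hlaw
  have hcons : ∀ᵐ ω ∂P, Tendsto (fun m => xhat m ω) atTop (𝓝 xo) := by
    filter_upwards [hxhat,
      hξ.ae_uniform_weighted_average hA habs hb_tb (L := 2) two_pos (C := 2 * R)] with ω hω hωr
    refine TDOA.tendsto_of_isMLEstimate hbR hball hconv
      (fun x hx => TDOA.not_ae_rangeDiff_eq hn2 h_hyperboloid h_hyperplane hx) hxo ?_ hωr hω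
    exact hΘ.imp (fun h => h.isBounded) fun h u hu =>
      TDOA.not_ae_rangeDiff_eq_neg_inner hn2 h_hyperplane h.2 hu
  refine ⟨hcons, fun h_int hμxo h_cone => ?_⟩
  rw [ha0] at h_cone
  have hpos : ∀ h : TDOA.Space n, h ≠ 0 → 0 < TDOA.gramForm μ xo h := fun h hh =>
    TDOA.gramForm_pos hn2 hconv hμxo hxo0 h_hyperplane h_cone hh
  have hM := TDOA.gramMatrix_posDef hpos
  refine ⟨TDOA.gramMatrix μ xo, fun j k => ?_, hM, ?_⟩
  · refine (TDOA.tendsto_average_rangeDiffGrad_mul hconv hμxo j k).congr fun m => ?_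
    rw [TDOA.sum_Icc_one_eq_sum_range]
    simp only [TDOA.partialRangeDiff_eq hxo0 (ha_ne _)]
    rfl
  · have hdist := TDOA.tendstoInDistribution_gramInverse_score hr_indep hlaw hconv hμxo hM
    rw [NNReal.coe_pow] at hdist
    have hmeas : ∀ m : ℕ, AEMeasurable (fun ω => √(m : ℝ) • (xhat m ω - xo)) P := fun m =>
      ((hxhat_meas m).sub_const xo).fun_const_smul _
    -- Slutsky: it remains to show that the difference from the linearized estimates tends to zero
    -- in probability.
    refine tendstoInDistribution_of_tendstoInMeasure_sub _ _ hdist ?_ hmeas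
    have hcompare : ∀ᵐ ω ∂P, ∀ᶠ m in atTop, ∀ y ∈ Θ,
        TDOA.localExcess b xo ξ m ω (√(m : ℝ) • (xhat m ω - xo)) ≤
          TDOA.localExcess b xo ξ m ω (√(m : ℝ) • (y - xo)) := by
      filter_upwards [hxhat] with ω hω
      filter_upwards [hω, eventually_gt_atTop 0] with m hm hm0 y hy
      rw [TDOA.localExcess_eq a xo r hm0, TDOA.localExcess_eq a xo r hm0]
      gcongr
      exact hm.2 y hy
    refine hξ.tendstoInMeasure_sub_gramInverse_score hn3 hconv hμxo hxo0 hb_ne hpos hmeas ?_ ?_ ?_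
    · filter_upwards [hcons] with ω hω
      have h1 : Tendsto (fun m => xhat m ω - xo) atTop (𝓝 0) := by
        simpa using hω.sub_const xo
      refine h1.congr' ?_
      filter_upwards [eventually_gt_atTop 0] with m hm0
      exact (inv_smul_smul₀ (Real.sqrt_pos.2 (by exact_mod_cast hm0)).ne' _).symm
    · filter_upwards [hcompare] with ω hω
      filter_upwards [hω] with m hm
      refine (hm xo hxo).trans_eq ?_
      simp [TDOA.localExcess, TDOA.localSignal, TDOA.localNoise]
    · filter_upwards [hcompare, hξ.ae_tendsto_inv_sqrt_smul_score (b := b) (xo := xo)]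
        with ω hω hωs
      -- The linearized estimate, back on the original scale, tends to the interior point `xo`. It
      -- therefore lies in `Θ` eventually and may compete with the minimizer.
      have h1 : Tendsto (fun m : ℕ => xo + TDOA.gramInverse μ xo
          ((√(m : ℝ))⁻¹ • TDOA.score b xo ξ m ω)) atTop (𝓝 xo) := by
        have := ((TDOA.gramInverse μ xo).continuous.tendsto 0).comp hωs
        simpa using this.const_add xo
      filter_upwards [hω, h1.eventually (mem_interior_iff_mem_nhds.1 h_int),
        eventually_gt_atTop 0] with m hm hmΘ hm0
      have h2 := hm _ hmΘ
      rwa [add_sub_cancel_left, map_smul,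
        smul_inv_smul₀ (Real.sqrt_pos.2 (by exact_mod_cast hm0)).ne'] at h2
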